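/- All graphs are finite and simple. A pair $\{K_1,K_2\}$ of non-empty, vertex-disjoint cliques of a graph is a PH pair if it is homogeneous (every vertex outside $K_1\cup K_2$ is either adjacent to all or to none of the vertices of $K_1$, and likewise for $K_2$) and proper (every vertex of $K_1$ has both a neighbour and a non-neighbour in $K_2$, and vice versa). There are an algorithm $P$, an algorithm $Q$ and a constant $C$ such that the following holds for every graph $G=(V,E)$, with time bound $T(G)=C\,|V|^{5/2}|E|$ if $E\neq\emptyset$ and $T(G)=C(|V|^{5/2}+1)$ if $E=\emptyset$. On input $G$, the algorithm $P$ computes in time at most $T(G)$ a graph $G'$ on the vertex set $V$ such that: 1. $G'$ has no PH pair of cliques; 2. $\chi(G)=\chi(G')$ and $\omega(G)=\omega(G')$; 3. on input $G$ and any optimal colouring of $G'$ (a proper colouring with $\chi(G')$ colours), the algorithm $Q$ computes an optimal colouring of $G$ in time at most $T(G)$; 4. every maximum clique of $G'$ is a maximum clique of $G$. Here graphs on $V=\{0,\dots,n-1\}$ are given by $n$ and the adjacency matrix, colourings by the array of the colours $0,\dots,\chi(G')-1$ of the vertices, and time is the number of steps of a word RAM with words of $O(\log(n+2))$ bits (unit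 cost for constants, memory accesses, $+$, truncated $-$, $\times$, comparisons, assignments and tests). -/

import Mathlib

/-! ## Proper and homogeneous pairs of cliques -/

namespace SimpleGraph

variable {V : Type*}

/-- `x` is complete to `S`: it is adjacent to every vertex of `S`. -/
def CompleteTo (G : SimpleGraph V) (x : V) (S : Set V) : Prop :=
  ∀ y ∈ S, G.Adj x y

/-- `x` is anticomplete to `S`: it is adjacent to no vertex of `S`. -/
def AnticompleteTo (G : SimpleGraph V) (x : V) (S : Set V) : Prop :=
  ∀ y ∈ S, ¬ G.Adj x y

/-- `{K₁, K₂}` is a pair of non-empty, vertex-disjoint cliques. -/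
structure IsCliquePair (G : SimpleGraph V) (K₁ K₂ : Set V) : Prop where
  clique_left : G.IsClique K₁
  clique_right : G.IsClique K₂
  nonempty_left : K₁.Nonempty
  nonempty_right : K₂.Nonempty
  disjoint : Disjoint K₁ K₂

/-- Each vertex outside `K₁ ∪ K₂` is complete or anticomplete to `K₁`, and complete or
anticomplete to `K₂`. -/
def IsHomogeneousPair (G : SimpleGraph V) (K₁ K₂ : Set V) : Prop :=
  ∀ z, z ∉ K₁ ∪ K₂ →
    (G.CompleteTo z K₁ ∨ G.AnticompleteTo z K₁) ∧ (G.CompleteTo z K₂ ∨ G.AnticompleteTo z K₂)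

/-- `v` is proper to `K`: it is neither complete nor anticomplete to `K`. -/
def ProperTo (G : SimpleGraph V) (v : V) (K : Set V) : Prop :=
  ¬ G.CompleteTo v K ∧ ¬ G.AnticompleteTo v K

/-- Each vertex of `K₁` is proper to `K₂`, and each vertex of `K₂` is proper to `K₁`. -/
def IsProperPair (G : SimpleGraph V) (K₁ K₂ : Set V) : Prop :=
  (∀ u ∈ K₁, G.ProperTo u K₂) ∧ (∀ u ∈ K₂, G.ProperTo u K₁)

/-- A PH pair: a pair of non-empty vertex-disjoint cliques that is proper and homogeneous. -/
def IsPHPair (G : SimpleGraph V) (K₁ K₂ : Set V) : Prop :=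
  G.IsCliquePair K₁ K₂ ∧ G.IsProperPair K₁ K₂ ∧ G.IsHomogeneousPair K₁ K₂

end SimpleGraph

/-! ## The machine model: structured programs for a word RAM, with a step count

A program uses finitely many registers and finitely many arrays of words (those that it names).
A word is a natural number smaller than a bound `W`; a computation in which some value or address
reaches `W` is not a legal run. Each arithmetic or comparison operation, memory access, constant,
assignment and test costs one step. -/

namespace WordRAM

/-- The contents of the registers and of the arrays. -/
structure Store where
  reg : ℕ → ℕ
  arr : ℕ → ℕ → ℕ

/-- Assign the value `k` to register `x`. -/
def Store.setReg (s : Store) (x k : ℕ) : Store :=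
  { s with reg := Function.update s.reg x k }

/-- Assign the value `k` to cell `i` of array `a`. -/
def Store.setArr (s : Store) (a i k : ℕ) : Store :=
  { s with arr := Function.update s.arr a (Function.update (s.arr a) i k) }

/-- The binary operations; `sub` is truncated, the comparisons give `1` (true) or `0` (false). -/
inductive Op
  | add
  | sub
  | mul
  | eq
  | lt

def Op.apply : Op → ℕ → ℕ → ℕ
  | .add, a, b => a + b
  | .sub, a, b => a - b
  | .mul, a, b => a * b
  | .eq, a, b => if a = b then 1 else 0
  | .lt, a, b => if a < b then 1 else 0

/-- Expressions: a constant, the content of register `x`, the content of the cell of array `a`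
whose index is the value of `i`, and the application of an operation. -/
inductive Expr
  | lit (k : ℕ)
  | reg (x : ℕ)
  | get (a : ℕ) (i : Expr)
  | bin (o : Op) (e₁ e₂ : Expr)

/-- The value of an expression. -/
def Expr.eval (s : Store) : Expr → ℕ
  | .lit k => k
  | .reg x => s.reg x
  | .get a i => s.arr a (i.eval s)
  | .bin o e₁ e₂ => o.apply (e₁.eval s) (e₂.eval s)

/-- All values (and addresses) that arise when the expression is evaluated are smaller than `W`. -/
def Expr.Fits (W : ℕ) (s : Store) : Expr → Prop
  | .lit k => k < W
  | .reg x => s.reg x < W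
  | .get a i => i.Fits W s ∧ s.arr a (i.eval s) < W
  | .bin o e₁ e₂ => e₁.Fits W s ∧ e₂.Fits W s ∧ o.apply (e₁.eval s) (e₂.eval s) < W

/-- The number of steps needed to evaluate an expression: one for each node. -/
def Expr.cost : Expr → ℕ
  | .lit _ => 1
  | .reg _ => 1
  | .get _ i => i.cost + 1
  | .bin _ e₁ e₂ => e₁.cost + e₂.cost + 1

/-- Programs. A test succeeds if the value of its expression is not `0`. -/
inductive Prog
  | skip
  | assign (x : ℕ) (e : Expr)
  | write (a : ℕ) (i e : Expr)
  | seq (p q : Prog)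
  | cond (e : Expr) (p q : Prog)
  | loop (e : Expr) (p : Prog)

/-- `Run W p s t s'`: on words smaller than `W`, the program `p`, started in the store `s`, halts
after exactly `t` steps in the store `s'`. (At most one pair `(t, s')` has this property.) -/
inductive Run (W : ℕ) : Prog → Store → ℕ → Store → Prop
  | skip (s : Store) : Run W .skip s 1 s
  | assign (s : Store) (x : ℕ) (e : Expr) (he : e.Fits W s) :
      Run W (.assign x e) s (e.cost + 1) (s.setReg x (e.eval s))
  | write (s : Store) (a : ℕ) (i e : Expr) (hi : i.Fits W s) (he : e.Fits W s) :
      Run W (.write a i e) s (i.cost + e.cost + 1) (s.setArr a (i.eval s) (e.eval s))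
  | seq {p q : Prog} {s s' s'' : Store} {t t' : ℕ} (hp : Run W p s t s') (hq : Run W q s' t' s'') :
      Run W (.seq p q) s (t + t') s''
  | cond_true {e : Expr} {p q : Prog} {s s' : Store} {t : ℕ} (he : e.Fits W s)
      (h : e.eval s ≠ 0) (hp : Run W p s t s') :
      Run W (.cond e p q) s (e.cost + 1 + t) s'
  | cond_false {e : Expr} {p q : Prog} {s s' : Store} {t : ℕ} (he : e.Fits W s)
      (h : e.eval s = 0) (hq : Run W q s t s') :
      Run W (.cond e p q) s (e.cost + 1 + t) s'
  | loop_true {e : Expr} {p : Prog} {s s' s'' : Store} {t t' : ℕ} (he : e.Fits W s)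
      (h : e.eval s ≠ 0) (hp : Run W p s t s') (hl : Run W (.loop e p) s' t' s'') :
      Run W (.loop e p) s (e.cost + 1 + t + t') s''
  | loop_false {e : Expr} {p : Prog} {s : Store} (he : e.Fits W s) (h : e.eval s = 0) :
      Run W (.loop e p) s (e.cost + 1) s

open Classical in
/-- The entry of the adjacency matrix of `G` in row `u` and column `v`. -/
noncomputable def adjEntry {n : ℕ} (G : SimpleGraph (Fin n)) (u v : Fin n) : ℕ :=
  if G.Adj u v then 1 else 0

/-- The adjacency matrix of `G` as an array of length `n * n`, row by row; all further cells
hold `0`. -/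
noncomputable def matrixCells {n : ℕ} (G : SimpleGraph (Fin n)) (k : ℕ) : ℕ :=
  if h : k < n * n then
    adjEntry G (Fin.divNat ⟨k, h⟩) (Fin.modNat ⟨k, h⟩)
  else 0

/-- A colouring as an array of length `n`; all further cells hold `0`. -/
def colourCells {n k : ℕ} (c : Fin n → Fin k) (i : ℕ) : ℕ :=
  if h : i < n then (c ⟨i, h⟩ : ℕ) else 0

/-- The initial store for the input `G`: the number of vertices is in register `0`, the adjacency
matrix in array `0`; everything else is `0`. -/
noncomputable def graphInput {n : ℕ} (G : SimpleGraph (Fin n)) : Store where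
  reg := Function.update (fun _ => 0) 0 n
  arr := Function.update (fun _ _ => 0) 0 (matrixCells G)

/-- The initial store for the input `G`, `c`: as for the input `G`, and in addition the colouring
`c` is in array `1`. -/
noncomputable def graphColourInput {n k : ℕ} (G : SimpleGraph (Fin n)) (c : Fin n → Fin k) :
    Store where
  reg := Function.update (fun _ => 0) 0 n
  arr := Function.update (Function.update (fun _ _ => 0) 0 (matrixCells G)) 1 (colourCells c)

/-- The store holds the adjacency matrix of `G` in (the first `n * n` cells of) array `2`. -/
def HoldsGraph {n : ℕ} (s : Store) (G : SimpleGraph (Fin n)) : Prop :=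
  ∀ u v : Fin n, s.arr 2 (u * n + v) = adjEntry G u v

/-- The store holds the colouring `c` in (the first `n` cells of) array `2`. -/
def HoldsColouring {n k : ℕ} (s : Store) (c : Fin n → Fin k) : Prop :=
  ∀ v : Fin n, s.arr 2 v = c v

/-- `t` is at most `C * n ^ (5/2) * m` for graphs with `n` vertices and `m ≥ 1` edges; for edgeless
graphs, where this product vanishes, `t` is at most `C * (n ^ (5/2) + 1)`. -/
def TimeBound {n : ℕ} (C : ℝ) (G : SimpleGraph (Fin n)) (t : ℕ) : Prop :=
  (1 ≤ G.edgeSet.ncard → (t : ℝ) ≤ C * (n : ℝ) ^ (5 / 2 : ℝ) * G.edgeSet.ncard) ∧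
  (G.edgeSet.ncard = 0 → (t : ℝ) ≤ C * ((n : ℝ) ^ (5 / 2 : ℝ) + 1))

end WordRAM

/-! Two vertices `b`, `b'` of one clique of a PH pair form a seed if each has a neighbour in the
other clique that the other one lacks. Every PH pair contains a seed (`IsPHPair.exists_isSeed`), so
it is enough to destroy all seeds.

For an adjacent pair `b`, `b'`, start with the sides `{a}` and `{b, b'}`, where `a` is adjacent to
`b` and not to `b'`, and keep moving each outside vertex that is mixed on one side to the opposite
side. All these moves are forced, so every PH pair with `b`, `b'` in its second clique contains the
result (`Clos`). Either the two sides are cliques and, given also a vertex adjacent to `b'` and not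
to `b`, form a PH pair `K₁`, `K₂`, or `b`, `b'` is no seed.

The reduction takes a maximum matching `M` of non-adjacent pairs between `K₁` and `K₂`. By König's
theorem the vertices of `K₁ ∪ K₂` outside a minimum vertex cover form a clique `T` with `|K₁| + |K₂|
- |M|` vertices (`free_adj`, `free_card`). All edges between `K₁` and `K₂` that do not lie inside
`X` are deleted, where `X` is `T` if `T` meets both cliques, and the two ends of some edge between
them otherwise.

This preserves ω: no clique inside `K₁ ∪ K₂` is larger than `T`, so a clique meeting both sides can
exchange its part there for `T` (`Step.exists_clique`). It preserves χ: in a colouring of the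
reduced graph `T` forces at least `|T|` colours on `K₁ ∪ K₂`, so at most `|M|` colours occur in both
cliques. Permuting the colours within each clique puts the common ones on matched pairs, and the
result is proper for the original graph (`Step.recolour`).

It makes progress: afterwards the neighbourhoods of any two vertices of `K₂` are nested, so `b`,
`b'` is no seed (`IsCore.not_isSeed_thin`), and no new seed arises (`IsCore.isSeed_of_thin`). For
the latter, a PH pair of the thinned graph either avoids `K₁ ∪ K₂`, and then it is one of the old
graph, or merges with `K₁`, `K₂` into a larger PH pair of the old graph. Hence a single sweep over
all ordered pairs leaves a graph without PH pairs.

The time is amortised. Each adjacent pair costs `O(n²)` apart from the matching, which costs `O(n²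
(|M| + 1))` by plain augmenting paths; and `|M|` is at most twice the number of deleted edges
(`thin_adjCard`). This gives `O(n² (m + 1))` in all, which is within the bound claimed. The second
program repeats the sweep to recover the history of reductions and undoes them in reverse order. -/

namespace SimpleGraph

/-! ### Thinning, seeds, and elementary facts about PH pairs -/

variable {V : Type*}

/-- `G` with the edges between `K₁` and `K₂` that do not lie inside `X` removed. -/
def thin (G : SimpleGraph V) (K₁ K₂ X : Set V) : SimpleGraph V where
  Adj u v := G.Adj u v ∧ (u ∈ K₁ ∧ v ∈ K₂ ∨ u ∈ K₂ ∧ v ∈ K₁ → u ∈ X ∧ v ∈ X)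
  symm := ⟨fun u v h => ⟨h.1.symm, fun h' => (h.2 (by tauto)).symm⟩⟩
  loopless := ⟨fun u h => G.loopless.irrefl u h.1⟩

/-- The ordered pair `b, b'` lies in one clique of some PH pair, and each of the two vertices has
a neighbour in the other clique that the other one does not have. -/
def IsSeed (G : SimpleGraph V) (b b' : V) : Prop :=
  ∃ K₁ K₂, G.IsPHPair K₁ K₂ ∧ b ∈ K₂ ∧ b' ∈ K₂ ∧ ∃ a ∈ K₁, ∃ a' ∈ K₁,
    G.Adj a b ∧ ¬ G.Adj a b' ∧ G.Adj a' b' ∧ ¬ G.Adj a' b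

/-- `X` meets both cliques of the PH pair `{K₁, K₂}`, and its two traces are complete to each
other. -/
structure IsCore (G : SimpleGraph V) (K₁ K₂ X : Set V) : Prop where
  ph : G.IsPHPair K₁ K₂
  adj : ∀ u ∈ K₁, ∀ v ∈ K₂, u ∈ X → v ∈ X → G.Adj u v
  left : ∃ u ∈ K₁, u ∈ X
  right : ∃ u ∈ K₂, u ∈ X

variable {G : SimpleGraph V} {K₁ K₂ L₁ L₂ X : Set V}

theorem IsHomogeneousPair.symm (h : G.IsHomogeneousPair K₁ K₂) : G.IsHomogeneousPair K₂ K₁ :=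
  fun z hz => (h z (by rwa [Set.union_comm])).symm

theorem IsPHPair.symm (h : G.IsPHPair K₁ K₂) : G.IsPHPair K₂ K₁ :=
  ⟨⟨h.1.clique_right, h.1.clique_left, h.1.nonempty_right, h.1.nonempty_left, h.1.disjoint.symm⟩,
    ⟨h.2.1.2, h.2.1.1⟩, h.2.2.symm⟩

theorem IsCore.symm (h : G.IsCore K₁ K₂ X) : G.IsCore K₂ K₁ X :=
  ⟨h.ph.symm, fun u hu v hv hx hy => (h.adj v hv u hu hy hx).symm, h.right, h.left⟩

theorem thin_comm : G.thin K₁ K₂ X = G.thin K₂ K₁ X := by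
  ext u v; simp only [thin]; tauto

theorem thin_le : G.thin K₁ K₂ X ≤ G := fun _ _ h => h.1

theorem IsPHPair.notMem (h : G.IsPHPair K₁ K₂) {v : V} (h1 : v ∈ K₁) : v ∉ K₂ :=
  fun h2 => Set.disjoint_left.1 h.1.disjoint h1 h2

theorem IsPHPair.exists_adj (h : G.IsPHPair K₁ K₂) {u : V} (hu : u ∈ K₁) :
    ∃ v ∈ K₂, G.Adj u v := by
  by_contra! h'
  exact (h.2.1.1 u hu).2 h'

theorem IsPHPair.exists_not_adj (h : G.IsPHPair K₁ K₂) {u : V} (hu : u ∈ K₁) :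
    ∃ v ∈ K₂, ¬ G.Adj u v := by
  by_contra! h'
  exact (h.2.1.1 u hu).1 h'

/-- A vertex with a neighbour and a non-neighbour in one clique of a pair lies in the pair. -/
theorem IsHomogeneousPair.mem_of_mixed (h : G.IsHomogeneousPair K₁ K₂) {z p q : V} (hp : p ∈ K₂)
    (hq : q ∈ K₂) (hzp : G.Adj z p) (hzq : ¬ G.Adj z q) : z ∈ K₁ ∨ z ∈ K₂ := by
  by_contra hz
  rcases (h z (by simpa using hz)).2 with h' | h'
  · exact hzq (h' q hq)
  · exact h' p hp hzp

theorem IsHomogeneousPair.adj_left (h : G.IsHomogeneousPair K₁ K₂) {z p q : V} (h1 : z ∉ K₁)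
    (h2 : z ∉ K₂) (hp : p ∈ K₁) (hq : q ∈ K₁) (hzp : G.Adj z p) : G.Adj z q := by
  by_contra hzq
  rcases h.symm.mem_of_mixed hp hq hzp hzq with h' | h'
  exacts [h2 h', h1 h']

theorem IsPHPair.clique (h : G.IsPHPair K₁ K₂) {u v : V} (hu : u ∈ K₁) (hv : v ∈ K₁)
    (huv : u ≠ v) : G.Adj u v := h.1.clique_left hu hv huv

/-- Choose `b` in `K₂` with the most neighbours in `K₁`. Properness gives it a non-neighbour `a'` in
`K₁`, and gives `a'` a neighbour `b'` in `K₂`. If `b'` saw every neighbour of `b` in `K₁` as well,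
it would have more of them than `b`. -/
theorem IsPHPair.exists_isSeed (h : G.IsPHPair K₁ K₂) [Finite V] : ∃ b b', G.IsSeed b b' := by
  classical
  obtain ⟨b, hb, hmax⟩ := Set.exists_max_image K₂ (fun b => (K₁ ∩ {a | G.Adj b a}).ncard)
    (Set.toFinite _) h.1.nonempty_right
  obtain ⟨a', ha', hba'⟩ := h.symm.exists_not_adj hb
  obtain ⟨b', hb', hab'⟩ := h.exists_adj ha'
  obtain ⟨a, ha, h1, h2⟩ : ∃ a ∈ K₁, G.Adj b a ∧ ¬ G.Adj b' a := by
    by_contra! hc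
    have : (K₁ ∩ {a | G.Adj b a}) ⊂ (K₁ ∩ {a | G.Adj b' a}) :=
      ⟨fun x hx => ⟨hx.1, hc x hx.1 hx.2⟩, fun hs => hba' (hs ⟨ha', hab'.symm⟩).2⟩
    exact absurd (hmax b' hb') (not_le.2 (Set.ncard_lt_ncard this (Set.toFinite _)))
  exact ⟨b, b', K₁, K₂, h, hb, hb', a, ha, a', ha', h1.symm, fun h => h2 h.symm, hab',
    fun h => hba' h.symm⟩

/-! ### PH pairs of the thinned graph: no new seeds -/

namespace IsCore

theorem thin_adj (h : G.IsCore K₁ K₂ X) {u v : V} (hu : u ∈ K₁) (hv : v ∈ K₂) :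
    (G.thin K₁ K₂ X).Adj u v ↔ u ∈ X ∧ v ∈ X :=
  ⟨fun h' => h'.2 (Or.inl ⟨hu, hv⟩), fun h' => ⟨h.adj u hu v hv h'.1 h'.2, fun _ => h'⟩⟩

theorem thin_clique (h : G.IsCore K₁ K₂ X) {u v : V} (hu : u ∈ K₁) (hv : v ∈ K₁) (huv : u ≠ v) :
    (G.thin K₁ K₂ X).Adj u v :=
  ⟨h.ph.clique hu hv huv, fun h' => absurd h' (by
    have := h.ph.notMem hu; have := h.ph.notMem hv; tauto)⟩

/-- Inside `K₁`, membership in `X` is all that matters for adjacency in the thinned graph. -/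
theorem thin_mono (h : G.IsCore K₁ K₂ X) {x x' z : V} (hx : x ∈ K₁) (hx' : x' ∈ K₁)
    (hX : x ∈ X → x' ∈ X) (hz : z ≠ x') (ha : (G.thin K₁ K₂ X).Adj x z) :
    (G.thin K₁ K₂ X).Adj x' z := by
  by_cases h1 : z ∈ K₁
  · exact h.thin_clique hx' h1 hz.symm
  by_cases h2 : z ∈ K₂
  · rw [h.thin_adj hx h2] at ha
    exact (h.thin_adj hx' h2).2 ⟨hX ha.1, ha.2⟩
  · refine ⟨(h.ph.2.2.adj_left h1 h2 hx hx' ha.1.symm).symm, fun h' => ?_⟩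
    tauto

/-- A vertex of `X ∩ K₂` has a non-neighbour in `K₁`, which cannot be in `X` because the traces of
`X` are complete to each other. -/
theorem exists_notMem (h : G.IsCore K₁ K₂ X) : ∃ y ∈ K₁, y ∉ X := by
  obtain ⟨x, hx, hxX⟩ := h.right
  obtain ⟨y, hy, hxy⟩ := h.ph.symm.exists_not_adj hx
  exact ⟨y, hy, fun hyX => hxy (h.adj y hy x hx hyX hxX).symm⟩

/-- By `thin_mono`, the thinned neighbourhoods of two vertices of `K₂` are nested up to the two
vertices themselves, so they cannot both have private neighbours. This rules out every PH pair of
the thinned graph as a witness, not just `K₁`, `K₂`. -/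
theorem not_isSeed_thin (h : G.IsCore K₁ K₂ X) {b b' : V} (hb : b ∈ K₂) (hb' : b' ∈ K₂) :
    ¬ (G.thin K₁ K₂ X).IsSeed b b' := by
  rintro ⟨L₁, L₂, hL, hbL, hbL', a, ha, a', ha', h1, h2, h3, h4⟩
  rw [thin_comm] at *
  by_cases hX : b ∈ X → b' ∈ X
  · exact h2 (h.symm.thin_mono hb hb' hX (by rintro rfl; exact hL.notMem ha hbL') h1.symm).symm
  · refine h4 (h.symm.thin_mono hb' hb (by tauto) ?_ h3.symm).symm
    rintro rfl; exact hL.notMem ha' hbL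

variable (h : G.IsCore K₁ K₂ X) (hL : (G.thin K₁ K₂ X).IsPHPair L₁ L₂)

include h hL

/-- `x` and `x'` are adjacent twins of the thinned graph. So `x'` is mixed on `L₂` like `x`, hence
lies in the pair; in `L₂` it would have a non-neighbour in the clique `L₁`, and so would `x`. -/
theorem twin_mem {x x' : V} (hx : x ∈ K₁) (hx' : x' ∈ K₁) (hX : x ∈ X ↔ x' ∈ X) (hxL : x ∈ L₁) :
    x' ∈ L₁ := by
  by_cases hne : x = x'
  · exact hne ▸ hxL
  have h2 : x' ∉ L₂ := fun hx2 => by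
    obtain ⟨y, hy, hxy⟩ := hL.symm.exists_not_adj hx2
    have hyx : y ≠ x := by rintro rfl; exact hxy (h.thin_clique hx' hx (Ne.symm hne))
    refine hxy (h.thin_mono hx hx' hX.1 ?_ (hL.clique hxL hy hyx.symm))
    rintro rfl; exact hL.notMem hy hx2
  obtain ⟨p, hp, hxp⟩ := hL.exists_adj hxL
  obtain ⟨q, hq, hxq⟩ := hL.exists_not_adj hxL
  refine (hL.2.2.mem_of_mixed (z := x') hp hq (h.thin_mono hx hx' hX.1 ?_ hxp) ?_).resolve_right h2
  · rintro rfl; exact h2 hp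
  · refine fun ha => hxq (h.thin_mono hx' hx hX.2 ?_ ha)
    rintro rfl; exact hL.notMem hxL hq

/-- The closed neighbourhood of `y` is contained in that of `x`. With `y` in the clique `L₂`, the
vertex `x` would be complete to `L₂`, against properness. -/
theorem notMem_right {x y : V} (hx : x ∈ K₁) (hy : y ∈ K₁) (hxX : x ∈ X) (hyX : y ∉ X)
    (hxL : x ∈ L₁) : y ∉ L₂ := by
  intro hyL
  obtain ⟨v, hv, hxv⟩ := hL.exists_not_adj hxL
  have hvy : v ≠ y := by
    rintro rfl
    exact hxv (h.thin_clique hx hy (by rintro rfl; exact hyX hxX))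
  exact hxv (h.thin_mono hy hx (by tauto) (by rintro rfl; exact hL.notMem hxL hv)
    (hL.symm.clique hyL hv hvy.symm))

/-- Compare `x` with a vertex `y` of `K₁` outside `X`; in the thinned graph `x₂` sees `x` and not
`y`. If `y ∈ L₁`, then `x₂` is mixed on `L₁` and is forced into `L₂`. If not, and `x₂` were missing
from `L₂`, then by `twin_mem` the set `L₂` would miss all of `X ∩ K₂`, so `y` would be mixed on `L₂`
just like `x`, although it lies outside the pair. -/
theorem mem_right {x x₂ : V} (hx : x ∈ K₁) (hx₂ : x₂ ∈ K₂) (hxX : x ∈ X) (hxX₂ : x₂ ∈ X)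
    (hxL : x ∈ L₁) : x₂ ∈ L₂ := by
  obtain ⟨y, hy, hyX⟩ := h.exists_notMem
  have hxy : y ≠ x := by rintro rfl; exact hyX hxX
  by_cases hyL : y ∈ L₁
  · have h1 : x₂ ∉ L₁ := fun h2 => hyX
      ((h.thin_adj hy hx₂).1 (hL.clique hyL h2 (by rintro rfl; exact h.ph.notMem hy hx₂))).1
    refine (hL.symm.2.2.mem_of_mixed hxL hyL ((h.thin_adj hx hx₂).2 ⟨hxX, hxX₂⟩).symm
      fun ha => hyX ((h.thin_adj hy hx₂).1 ha.symm).1).resolve_right h1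
  · by_contra hx2
    have hyL₂ := h.notMem_right hL hx hy hxX hyX hxL
    obtain ⟨p, hp, hxp⟩ := hL.exists_adj hxL
    obtain ⟨q, hq, hxq⟩ := hL.exists_not_adj hxL
    refine (hL.2.2.mem_of_mixed (z := y) hp hq ?_ ?_).elim hyL hyL₂
    · by_cases h1 : p ∈ K₁
      · exact h.thin_clique hy h1 (by rintro rfl; exact hyL₂ hp)
      by_cases h2 : p ∈ K₂
      · have := (h.thin_adj hx h2).1 hxp
        refine absurd ?_ hx2
        rw [thin_comm] at hL
        exact h.symm.twin_mem hL.symm h2 hx₂ (by tauto) hp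
      · exact ⟨(h.ph.2.2.adj_left h1 h2 hx hy hxp.1.symm).symm, by tauto⟩
    · exact fun ha => hxq (h.thin_mono hy hx (by tauto)
        (by rintro rfl; exact hL.notMem hxL hq) ha)

/-- If a PH pair of the thinned graph contains a vertex of `X ∩ K₁` on its left side, then it
extends, together with `K₁` on the left and `K₂` on the right. -/
theorem placed {x : V} (hx : x ∈ K₁) (hxX : x ∈ X) (hxL : x ∈ L₁) :
    (∃ u ∈ K₁, u ∈ L₁) ∧ (∃ u ∈ K₂, u ∈ L₂) ∧ (∀ u ∈ K₂, u ∉ L₁) ∧ ∀ u ∈ K₁, u ∉ L₂ := by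
  obtain ⟨x₂, hx₂, hxX₂⟩ := h.right
  have hxL₂ := h.mem_right hL hx hx₂ hxX hxX₂ hxL
  have hL' := hL
  rw [thin_comm] at hL'
  refine ⟨⟨x, hx, hxL⟩, ⟨x₂, hx₂, hxL₂⟩, fun u hu huL => ?_, fun u hu huL => ?_⟩
  · by_cases huX : u ∈ X
    · exact hL.notMem (h.symm.twin_mem hL' hu hx₂ (by tauto) huL) hxL₂
    · exact h.symm.notMem_right hL'.symm hx₂ hu hxX₂ huX hxL₂ huL
  · by_cases huX : u ∈ X
    · exact hL.notMem hxL (h.twin_mem hL.symm hu hx (by tauto) huL)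
    · exact h.notMem_right hL hx hu hxX huX hxL huL

/-- A PH pair of the thinned graph that meets `K₁ ∪ K₂` also meets the core. Otherwise `y ∉ X`, and
a core vertex `x` of `K₁` has the same neighbours as `y` in `L₂`, because `x` sees more than `y`
only inside `X ∩ K₂`. So `x` is mixed on `L₂` and belongs to the pair after all. -/
theorem exists_core_mem {y : V} (hy : y ∈ K₁) (hyL : y ∈ L₁) :
    (∃ x ∈ K₁, x ∈ X ∧ (x ∈ L₁ ∨ x ∈ L₂)) ∨ ∃ x ∈ K₂, x ∈ X ∧ (x ∈ L₁ ∨ x ∈ L₂) := by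
  by_contra! hc
  obtain ⟨x, hx, hxX⟩ := h.left
  by_cases hyX : y ∈ X
  · exact (hc.1 y hy hyX).1 hyL
  obtain ⟨p, hp, hyp⟩ := hL.exists_adj hyL
  obtain ⟨q, hq, hyq⟩ := hL.exists_not_adj hyL
  refine (hL.2.2.mem_of_mixed (z := x) hp hq ?_ ?_).elim (hc.1 x hx hxX).1 (hc.1 x hx hxX).2
  · exact h.thin_mono hy hx (by tauto) (by rintro rfl; exact (hc.1 p hx hxX).2 hp) hyp
  · intro ha
    have hqy : q ≠ y := by rintro rfl; exact hL.notMem hyL hq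
    by_cases h1 : q ∈ K₁
    · exact hyq (h.thin_clique hy h1 hqy.symm)
    by_cases h2 : q ∈ K₂
    · exact (hc.2 q h2 ((h.thin_adj hx h2).1 ha).2).2 hq
    · exact hyq ⟨(h.ph.2.2.adj_left h1 h2 hx hy ha.1.symm).symm, by tauto⟩

omit h hL

theorem thin_adj_iff {u v : V} (huv : ¬ (u ∈ K₁ ∧ v ∈ K₂ ∨ u ∈ K₂ ∧ v ∈ K₁)) :
    (G.thin K₁ K₂ X).Adj u v ↔ G.Adj u v :=
  ⟨fun h => h.1, fun h => ⟨h, fun h' => absurd h' huv⟩⟩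

/-- A vertex of `L₁` outside `K₁` is outside `K₂` too and sees the common vertex `k`, so homogeneity
makes it complete to `K₁`. -/
theorem clique_union (h : G.IsCore K₁ K₂ X) (hL : (G.thin K₁ K₂ X).IsPHPair L₁ L₂)
    (h1 : ∃ u ∈ K₁, u ∈ L₁) (h3 : ∀ u ∈ K₂, u ∉ L₁) : G.IsClique (K₁ ∪ L₁) := by
  obtain ⟨k, hk, hkL⟩ := h1
  have key : ∀ u ∈ K₁, ∀ v ∈ L₁, v ∉ K₁ → G.Adj v u := fun u hu v hv hvK =>
    h.ph.2.2.adj_left hvK (fun h' => h3 v h' hv) hk hu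
      (hL.clique hv hkL (by rintro rfl; exact hvK hk)).1
  intro u hu v hv huv
  by_cases huK : u ∈ K₁ <;> by_cases hvK : v ∈ K₁
  · exact h.ph.clique huK hvK huv
  · exact (key u huK v (hv.resolve_left hvK) hvK).symm
  · exact key v hvK u (hu.resolve_left huK) huK
  · exact (hL.clique (hu.resolve_left huK) (hv.resolve_left hvK) huv).1

/-- A vertex of `K₁` is mixed on `K₂`. A vertex of `L₁` outside `K₁` is also outside `K₂`, so
thinning does not change its neighbourhood and it remains mixed on `L₂` in `G`. -/
theorem proper_union (h : G.IsCore K₁ K₂ X) (hL : (G.thin K₁ K₂ X).IsPHPair L₁ L₂)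
    (h3 : ∀ u ∈ K₂, u ∉ L₁) : ∀ u ∈ K₁ ∪ L₁, G.ProperTo u (K₂ ∪ L₂) := by
  intro u hu
  suffices ∃ p ∈ K₂ ∪ L₂, ∃ q ∈ K₂ ∪ L₂, G.Adj u p ∧ ¬ G.Adj u q by
    obtain ⟨p, hp, q, hq, hup, huq⟩ := this
    exact ⟨fun h => huq (h q hq), fun h => h p hp hup⟩
  by_cases huK : u ∈ K₁
  · obtain ⟨p, hp, hup⟩ := h.ph.exists_adj huK
    obtain ⟨q, hq, huq⟩ := h.ph.exists_not_adj huK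
    exact ⟨p, Or.inl hp, q, Or.inl hq, hup, huq⟩
  · have huL := hu.resolve_left huK
    obtain ⟨p, hp, hup⟩ := hL.exists_adj huL
    obtain ⟨q, hq, huq⟩ := hL.exists_not_adj huL
    refine ⟨p, Or.inr hp, q, Or.inr hq, hup.1, fun ha => huq ((thin_adj_iff ?_).2 ha)⟩
    have := h3 u; tauto

theorem homogeneous_union (h : G.IsCore K₁ K₂ X) (hL : (G.thin K₁ K₂ X).IsPHPair L₁ L₂)
    (h1 : ∃ u ∈ K₁, u ∈ L₁) {z : V} (hz : z ∉ K₁ ∪ L₁ ∪ (K₂ ∪ L₂)) :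
    G.CompleteTo z (K₁ ∪ L₁) ∨ G.AnticompleteTo z (K₁ ∪ L₁) := by
  obtain ⟨k, hk, hkL⟩ := h1
  simp only [Set.mem_union, not_or] at hz
  have hKz := (h.ph.2.2 z (by simp [hz])).1
  have hLz := (hL.2.2 z (by simp [hz])).1
  have e : ∀ y, (G.thin K₁ K₂ X).Adj z y ↔ G.Adj z y := fun y => thin_adj_iff (by tauto)
  simp only [CompleteTo, AnticompleteTo, e] at hKz hLz
  rcases hKz with hKz | hKz <;> rcases hLz with hLz | hLz
  · exact Or.inl fun y hy => hy.elim (hKz y) (hLz y)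
  · exact absurd (hKz k hk) (hLz k hkL)
  · exact absurd (hLz k hkL) (hKz k hk)
  · exact Or.inr fun y hy => hy.elim (hKz y) (hLz y)

theorem isPHPair_union (h : G.IsCore K₁ K₂ X) (hL : (G.thin K₁ K₂ X).IsPHPair L₁ L₂)
    (h1 : ∃ u ∈ K₁, u ∈ L₁) (h2 : ∃ u ∈ K₂, u ∈ L₂) (h3 : ∀ u ∈ K₂, u ∉ L₁)
    (h4 : ∀ u ∈ K₁, u ∉ L₂) : G.IsPHPair (K₁ ∪ L₁) (K₂ ∪ L₂) := by
  have hL' := hL.symm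
  rw [thin_comm] at hL'
  refine ⟨⟨h.clique_union hL h1 h3, h.symm.clique_union hL' h2 h4, ?_, ?_, ?_⟩,
    ⟨h.proper_union hL h3, h.symm.proper_union hL' h4⟩, fun z hz =>
    ⟨h.homogeneous_union hL h1 hz, h.symm.homogeneous_union hL' h2 (by rwa [Set.union_comm])⟩⟩
  · exact h.ph.1.nonempty_left.mono Set.subset_union_left
  · exact h.ph.1.nonempty_right.mono Set.subset_union_left
  · have a := h.ph.1.disjoint
    have b := hL.1.disjoint
    rw [Set.disjoint_left] at *
    rintro x (hx | hx) (hy | hy)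
    exacts [a hx hy, h4 x hx hy, h3 x hy hx, b hx hy]

/-- A seed of the thinned graph whose PH pair is placed alongside `K₁, K₂`. -/
theorem isSeed_of_placed (h : G.IsCore K₁ K₂ X) (hL : (G.thin K₁ K₂ X).IsPHPair L₁ L₂)
    (h1 : ∃ u ∈ K₁, u ∈ L₁) (h2 : ∃ u ∈ K₂, u ∈ L₂) (h3 : ∀ u ∈ K₂, u ∉ L₁)
    (h4 : ∀ u ∈ K₁, u ∉ L₂) {b b' : V} (hb : b ∈ L₂) (hb' : b' ∈ L₂)
    (hab : ∃ a ∈ L₁, (G.thin K₁ K₂ X).Adj a b ∧ ¬ (G.thin K₁ K₂ X).Adj a b')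
    (hab' : ∃ a ∈ L₁, (G.thin K₁ K₂ X).Adj a b' ∧ ¬ (G.thin K₁ K₂ X).Adj a b) :
    G.IsSeed b b' := by
  have key : ∀ {b b' : V}, b ∈ L₂ → b' ∈ L₂ →
      (∃ a ∈ L₁, (G.thin K₁ K₂ X).Adj a b ∧ ¬ (G.thin K₁ K₂ X).Adj a b') →
      (∃ a ∈ L₁, (G.thin K₁ K₂ X).Adj a b' ∧ ¬ (G.thin K₁ K₂ X).Adj a b) →
      ∃ a ∈ K₁ ∪ L₁, G.Adj a b ∧ ¬ G.Adj a b' := by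
    rintro b b' hb hb' ⟨a, ha, hab, hab'⟩ ⟨a', ha', ha'b', ha'b⟩
    -- Only here can `a b'` be an edge of `G` that was deleted. In this case `b` is outside `K₁ ∪
    -- K₂` and sees `a`, hence is complete to `K₁`, whereas `b'` has a non-neighbour in `K₁`; that
    -- vertex replaces `a`.
    by_cases hc : a ∈ K₁ ∧ b' ∈ K₂
    · have hbK₂ : b ∉ K₂ := fun hbK => by
        rw [thin_comm] at *
        refine ha'b (h.symm.thin_mono hc.2 hbK (fun _ => ?_) ?_ ha'b'.symm).symm
        · exact ((h.symm.thin_adj hbK hc.1).1 hab.symm).1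
        · rintro rfl; exact hL.notMem ha' hb
      obtain ⟨a₂, ha₂, h5⟩ := h.ph.symm.exists_not_adj hc.2
      exact ⟨a₂, Or.inl ha₂, (h.ph.2.2.adj_left (fun h' => h4 b h' hb) hbK₂ hc.1 ha₂
        hab.1.symm).symm, fun h' => h5 h'.symm⟩
    · refine ⟨a, Or.inr ha, hab.1, fun h' => hab' ((thin_adj_iff ?_).2 h')⟩
      have := h3 a; tauto
  obtain ⟨a, ha, h5, h6⟩ := key hb hb' hab hab'
  obtain ⟨a', ha', h7, h8⟩ := key hb' hb hab' hab
  exact ⟨_, _, h.isPHPair_union hL h1 h2 h3 h4, Or.inr hb, Or.inr hb', a, ha, a', ha', h5, h6,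
    h7, h8⟩

/-- A PH pair of the thinned graph which avoids `K₁ ∪ K₂` is one of `G`. -/
theorem isPHPair_of_avoid (hL : (G.thin K₁ K₂ X).IsPHPair L₁ L₂)
    (hd : ∀ u, u ∈ L₁ ∨ u ∈ L₂ → u ∉ K₁ ∧ u ∉ K₂) : G.IsPHPair L₁ L₂ := by
  have e : ∀ {x y}, (x ∈ L₁ ∨ x ∈ L₂) → ((G.thin K₁ K₂ X).Adj y x ↔ G.Adj y x) :=
    fun {x y} hx => thin_adj_iff (by have := hd x hx; tauto)
  have c₁ : ∀ {y}, G.CompleteTo y L₁ ↔ (G.thin K₁ K₂ X).CompleteTo y L₁ := fun {y} =>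
    forall₂_congr fun x hx => (e (Or.inl hx)).symm
  have c₂ : ∀ {y}, G.CompleteTo y L₂ ↔ (G.thin K₁ K₂ X).CompleteTo y L₂ := fun {y} =>
    forall₂_congr fun x hx => (e (Or.inr hx)).symm
  have a₁ : ∀ {y}, G.AnticompleteTo y L₁ ↔ (G.thin K₁ K₂ X).AnticompleteTo y L₁ := fun {y} =>
    forall₂_congr fun x hx => not_congr (e (Or.inl hx)).symm
  have a₂ : ∀ {y}, G.AnticompleteTo y L₂ ↔ (G.thin K₁ K₂ X).AnticompleteTo y L₂ := fun {y} =>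
    forall₂_congr fun x hx => not_congr (e (Or.inr hx)).symm
  obtain ⟨hc, hp, hh⟩ := hL
  refine ⟨⟨hc.1.mono thin_le, hc.2.mono thin_le, hc.3, hc.4, hc.5⟩, ?_, ?_⟩
  · simpa only [IsProperPair, ProperTo, c₁, c₂, a₁, a₂] using hp
  · simpa only [IsHomogeneousPair, c₁, c₂, a₁, a₂] using hh

/-- Thinning creates no new seeds. -/
theorem isSeed_of_thin (h : G.IsCore K₁ K₂ X) {b b' : V} (hs : (G.thin K₁ K₂ X).IsSeed b b') :
    G.IsSeed b b' := by
  obtain ⟨L₁, L₂, hL, hb, hb', a, ha, a', ha', h1, h2, h3, h4⟩ := hs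
  have hL' := hL
  rw [thin_comm] at hL'
  have ha1 : ∃ a ∈ L₁, (G.thin K₁ K₂ X).Adj a b ∧ ¬ (G.thin K₁ K₂ X).Adj a b' := ⟨a, ha, h1, h2⟩
  have ha2 : ∃ a ∈ L₁, (G.thin K₁ K₂ X).Adj a b' ∧ ¬ (G.thin K₁ K₂ X).Adj a b :=
    ⟨a', ha', h3, h4⟩
  -- If the pair meets the core, then up to swapping the cliques it lies alongside `K₁`, `K₂`, and
  -- the unions form a PH pair of `G` with the same seed. If it misses the core, it avoids `K₁ ∪
  -- K₂`.
  by_cases hx : (∃ x ∈ K₁, x ∈ X ∧ (x ∈ L₁ ∨ x ∈ L₂)) ∨ ∃ x ∈ K₂, x ∈ X ∧ (x ∈ L₁ ∨ x ∈ L₂)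
  · rcases hx with ⟨x, hx, hxX, hxL | hxL⟩ | ⟨x, hx, hxX, hxL | hxL⟩
    · obtain ⟨p1, p2, p3, p4⟩ := h.placed hL hx hxX hxL
      exact h.isSeed_of_placed hL p1 p2 p3 p4 hb hb' ha1 ha2
    · obtain ⟨p1, p2, p3, p4⟩ := h.placed hL.symm hx hxX hxL
      rw [thin_comm] at ha1 ha2
      exact h.symm.isSeed_of_placed hL' p2 p1 p4 p3 hb hb' ha1 ha2
    · obtain ⟨p1, p2, p3, p4⟩ := h.symm.placed hL' hx hxX hxL
      rw [thin_comm] at ha1 ha2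
      exact h.symm.isSeed_of_placed hL' p1 p2 p3 p4 hb hb' ha1 ha2
    · obtain ⟨p1, p2, p3, p4⟩ := h.symm.placed hL'.symm hx hxX hxL
      exact h.isSeed_of_placed hL p2 p1 p4 p3 hb hb' ha1 ha2
  · have hd : ∀ u, u ∈ L₁ ∨ u ∈ L₂ → u ∉ K₁ ∧ u ∉ K₂ := by
      rintro u (hu | hu)
      · exact ⟨fun hk => hx (h.exists_core_mem hL hk hu),
          fun hk => hx (h.symm.exists_core_mem hL' hk hu).symm⟩
      · simp only [or_comm (a := _ ∈ L₁)] at hx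
        exact ⟨fun hk => hx (h.exists_core_mem hL.symm hk hu),
          fun hk => hx (h.symm.exists_core_mem hL'.symm hk hu).symm⟩
    have e : ∀ {x y}, (x ∈ L₁ ∨ x ∈ L₂) → ((G.thin K₁ K₂ X).Adj x y ↔ G.Adj x y) :=
      fun {x y} hx => thin_adj_iff (by have := hd x hx; tauto)
    rw [e (Or.inl ha)] at h1 h2
    rw [e (Or.inl ha')] at h3 h4
    exact ⟨L₁, L₂, isPHPair_of_avoid hL hd, hb, hb', a, ha, a', ha', h1, h2, h3, h4⟩

end IsCore

end SimpleGraph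


/-! ### One reduction step: clique number and recolouring -/

namespace WordRAM

open Finset

variable {n : ℕ} {G G' : SimpleGraph (Fin n)} {sd mt : ℕ → ℕ}

/-- `mt` encodes a matching of non-adjacent pairs between the classes `1` and `2` of `sd`:
`mt z` is `0` if `z` is unmatched, and the partner of `z` plus one otherwise. -/
def IsMate (G : SimpleGraph (Fin n)) (sd mt : ℕ → ℕ) : Prop :=
  ∀ z : Fin n, mt z ≠ 0 → ∃ w : Fin n, mt z = w + 1 ∧ mt w = z + 1 ∧
    (sd z = 1 ∧ sd w = 2 ∨ sd z = 2 ∧ sd w = 1) ∧ ¬ G.Adj z w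

/-- The number of matched vertices. -/
def mateCard (n : ℕ) (mt : ℕ → ℕ) : ℕ := #{z : Fin n | mt z ≠ 0}

/-- The map from a matched vertex to its partner is injective, and it takes vertices with `P` to
vertices with `Q`. -/
theorem IsMate.card_le (h : IsMate G sd mt) {P Q : Fin n → Prop} [DecidablePred P]
    [DecidablePred Q] (hPQ : ∀ z w : Fin n, mt z = w + 1 → mt w = z + 1 → P z → Q w) :
    #{z : Fin n | mt z ≠ 0 ∧ P z} ≤ #{z : Fin n | mt z ≠ 0 ∧ Q z} := by
  choose! f hf using h
  refine card_le_card_of_injOn f (fun z hz => ?_) (fun z hz w hw hzw => ?_)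
  · simp only [coe_filter, mem_univ, true_and, Set.mem_ofPred_eq] at hz ⊢
    obtain ⟨h1, h2, h3, h4⟩ := hf z hz.1
    exact ⟨by omega, hPQ z _ h1 h2 hz.2⟩
  · simp only [coe_filter, mem_univ, true_and, Set.mem_ofPred_eq] at hz hw
    have h1 := (hf z hz.1).2.1
    have h2 := (hf w hw.1).2.1
    rw [hzw] at h1
    exact Fin.ext (by omega)

theorem card_split (P Q : Fin n → Prop) [DecidablePred P] [DecidablePred Q] :
    #{z | P z} = #{z | P z ∧ Q z} + #{z | P z ∧ ¬ Q z} := by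
  rw [← filter_filter, ← filter_filter, card_filter_add_card_filter_not]

theorem IsMate.two_mul (h : IsMate G sd mt) {P : Fin n → Prop} [DecidablePred P]
    (hP : ∀ z w : Fin n, mt z = w + 1 → mt w = z + 1 → (P z ↔ ¬ P w)) :
    2 * #{z : Fin n | mt z ≠ 0 ∧ P z} = mateCard n mt := by
  have h1 := h.card_le (P := P) (Q := fun z => ¬ P z) fun z w a b => (hP z w a b).1
  have h2 := h.card_le (P := fun z => ¬ P z) (Q := P) fun z w a b hz => by
    have := hP z w a b; tauto
  have := card_split (fun z : Fin n => mt z ≠ 0) P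
  rw [mateCard]; omega

theorem IsMate.two_mul_matched (h : IsMate G sd mt) :
    2 * #{z : Fin n | mt z ≠ 0 ∧ sd z = 1} = mateCard n mt := by
  refine h.two_mul fun z w hzw hwz => ?_
  obtain ⟨w', h1, h2, h3, h4⟩ := h z (by omega)
  obtain rfl : w' = w := Fin.ext (by omega)
  omega

/-- Weak duality: a clique misses at least one end of each matched pair, as the ends are not
adjacent. The factors 2 appear because `mateCard` counts matched vertices and not pairs. -/
theorem IsMate.clique_card (h : IsMate G sd mt) {C : Finset (Fin n)} (hC : G.IsClique C)
    (hCs : ∀ z ∈ C, sd z ≠ 0) : 2 * #C + mateCard n mt ≤ 2 * #{z : Fin n | sd z ≠ 0} := by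
  have h1 := h.card_le (P := fun z => z ∈ C) (Q := fun z => z ∉ C) fun z w a b hz hw => by
    obtain ⟨w', h1, h2, h3, h4⟩ := h z (by omega)
    obtain rfl : w' = w := Fin.ext (by omega)
    exact h4 (hC hz hw (by rintro rfl; omega))
  have h2 := card_split (fun z : Fin n => mt z ≠ 0) (fun z => z ∈ C)
  have h3 := card_split (fun z : Fin n => z ∈ C) (fun z => mt z ≠ 0)
  have h4 : #{z : Fin n | z ∈ C ∧ ¬ mt z ≠ 0} + mateCard n mt ≤ #{z : Fin n | sd z ≠ 0} := by
    rw [mateCard, ← card_union_of_disjoint]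
    · refine card_le_card fun z => ?_
      simp only [mem_union, mem_filter, mem_univ, true_and]
      rintro (hz | hz)
      · exact hCs z hz.1
      · obtain ⟨w', h1, h2, h3, h4⟩ := h z hz
        omega
    · rw [disjoint_filter]; tauto
  have h5 : #{z : Fin n | z ∈ C} = #C := by congr 1; ext; simp
  simp only [and_comm (b := _ ∈ C)] at h1 h2
  rw [mateCard] at *
  omega

/-- One reduction: `G'` arises from `G` by deleting edges between the two classes `1` and `2` of
`sd`, which are homogeneous cliques of `G`, such that a clique of `G'` in these classes proves
the matching `mt` of non-adjacent pairs maximum. -/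
structure Step (G G' : SimpleGraph (Fin n)) (sd mt : ℕ → ℕ) : Prop where
  sd_le : ∀ z : Fin n, sd z ≤ 2
  clique : ∀ u v : Fin n, sd u ≠ 0 → sd u = sd v → u ≠ v → G.Adj u v
  homogeneous : ∀ z u v : Fin n, sd z = 0 → sd u ≠ 0 → sd u = sd v → G.Adj z u → G.Adj z v
  le : G' ≤ G
  agree : ∀ u v : Fin n, sd u + sd v ≠ 3 → G.Adj u v → G'.Adj u v
  mate : IsMate G sd mt
  core : ∃ T : Finset (Fin n), G'.IsClique T ∧ (∀ z ∈ T, sd z ≠ 0) ∧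
    2 * #{z : Fin n | sd z ≠ 0} = 2 * #T + mateCard n mt

namespace Step

/-- A clique that does not meet both classes loses no edge. In one that does, the part inside the
classes is exchanged for the clique `T` of `core`, which is at least as large by
`IsMate.clique_card`; the other vertices of the clique are complete to both classes by homogeneity.
-/
theorem exists_clique (h : Step G G' sd mt) {C : Finset (Fin n)} (hC : G.IsClique C) :
    ∃ C' : Finset (Fin n), G'.IsClique C' ∧ #C ≤ #C' := by
  by_cases h1 : ∃ u ∈ C, ∃ v ∈ C, sd u + sd v = 3
  · obtain ⟨u, hu, v, hv, huv⟩ := h1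
    obtain ⟨T, hT, hTs, hcard⟩ := h.core
    have hin := h.mate.clique_card (C := C.filter fun z => sd z ≠ 0)
      (hC.subset (by exact_mod_cast filter_subset _ _)) (by simp)
    have hz : ∀ z ∈ C, sd z = 0 → ∀ t ∈ T, G.Adj z t := by
      intro z hz hz0 t ht
      have htu : sd t = sd u ∨ sd t = sd v := by
        have := h.sd_le t; have := hTs t ht; have := h.sd_le u; have := h.sd_le v; omega
      have := h.sd_le u; have := h.sd_le v
      rcases htu with e | e
      · exact h.homogeneous z u t hz0 (by omega) e.symm
          (hC hz hu (by rintro rfl; omega))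
      · exact h.homogeneous z v t hz0 (by omega) e.symm
          (hC hz hv (by rintro rfl; omega))
    refine ⟨C.filter (fun z => sd z = 0) ∪ T, ?_, ?_⟩
    · intro x hx y hy hxy
      simp only [coe_union, coe_filter, Set.mem_union, Set.mem_ofPred_eq, mem_coe] at hx hy
      rcases hx with hx | hx <;> rcases hy with hy | hy
      · exact h.agree x y (by omega) (hC hx.1 hy.1 hxy)
      · exact h.agree x y (by have := h.sd_le y; omega) (hz x hx.1 hx.2 y hy)
      · exact (h.agree y x (by have := h.sd_le x; omega) (hz y hy.1 hy.2 x hx)).symm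
      · exact hT hx hy hxy
    · rw [card_union_of_disjoint]
      · have := card_filter_add_card_filter_not (s := C) (fun z => sd z = 0)
        simp only [ne_eq] at *
        omega
      · rw [Finset.disjoint_left]
        intro x hx hxT
        exact hTs x hxT (by simpa using (mem_filter.1 hx).2)
  · push Not at h1
    exact ⟨C, fun x hx y hy hxy => h.agree x y (h1 x hx y hy) (hC hx hy hxy), le_rfl⟩

theorem cliqueNum_eq (h : Step G G' sd mt) : G.cliqueNum = G'.cliqueNum := by
  apply le_antisymm
  · obtain ⟨C, hC⟩ := G.exists_isNClique_cliqueNum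
    obtain ⟨C', hC', hle⟩ := h.exists_clique hC.isClique
    rw [← hC.card_eq]
    exact hle.trans hC'.card_le_cliqueNum
  · obtain ⟨C, hC⟩ := G'.exists_isNClique_cliqueNum
    rw [← hC.card_eq]
    exact (hC.isClique.mono h.le).card_le_cliqueNum

/-- In a colouring of the reduced graph, the two cliques have at most as many colours in common
as the matching has edges. -/
theorem common_card (h : Step G G' sd mt) {c : ℕ → ℕ}
    (hc : ∀ u v : Fin n, G'.Adj u v → c u ≠ c v) :
    2 * #(({z : Fin n | sd z = 1} : Finset (Fin n)).image (fun z : Fin n => c z) ∩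
      ({z : Fin n | sd z = 2} : Finset (Fin n)).image (fun z : Fin n => c z)) ≤ mateCard n mt := by
  obtain ⟨T, hT, hTs, hcard⟩ := h.core
  set K₁ : Finset (Fin n) := {z : Fin n | sd z = 1}
  set K₂ : Finset (Fin n) := {z : Fin n | sd z = 2}
  have hK : #K₁ + #K₂ = #{z : Fin n | sd z ≠ 0} := by
    rw [← card_union_of_disjoint]
    · congr 1; ext z; have := h.sd_le z; simp [K₁, K₂]; omega
    · simp only [K₁, K₂]; rw [disjoint_filter]; intros; omega
  -- The colours on the clique `T` are distinct, so the two classes together carry at least `|K₁| +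
  -- |K₂| - |M|` colours. Inclusion-exclusion then bounds the number of common ones.
  have h1 : #T ≤ #(K₁.image (fun z : Fin n => c z) ∪ K₂.image (fun z : Fin n => c z)) := by
    refine card_le_card_of_injOn (fun z => c z) (fun z hz => ?_) (fun x hx y hy hxy => ?_)
    · have := h.sd_le z; have := hTs z hz
      rw [mem_coe, mem_union]
      rcases (by omega : sd z = 1 ∨ sd z = 2) with e | e
      · exact Or.inl (mem_image.2 ⟨z, by simp [K₁, e], rfl⟩)
      · exact Or.inr (mem_image.2 ⟨z, by simp [K₂, e], rfl⟩)
    · by_contra hne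
      exact hc x y (hT hx hy hne) hxy
  have h2 := card_union_add_card_inter (K₁.image (fun z : Fin n => c z))
    (K₂.image (fun z : Fin n => c z))
  have h3 := card_image_le (s := K₁) (f := fun z : Fin n => c z)
  have h4 := card_image_le (s := K₂) (f := fun z : Fin n => c z)
  omega

end Step

/-! ### Vertex orders, palettes, and the new colouring -/

/-- The natural numbers below `n` with property `p`, in increasing order. -/
def sel (n : ℕ) (p : ℕ → Prop) [DecidablePred p] : List ℕ := (List.range n).filter p

theorem mem_sel {p : ℕ → Prop} [DecidablePred p] {x : ℕ} : x ∈ sel n p ↔ x < n ∧ p x := by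
  simp [sel]

theorem nodup_sel {p : ℕ → Prop} [DecidablePred p] : (sel n p).Nodup :=
  List.nodup_range.filter _

theorem sel_succ {p : ℕ → Prop} [DecidablePred p] (k : ℕ) :
    sel (k + 1) p = sel k p ++ if p k then [k] else [] := by
  simp only [sel, List.range_succ, List.filter_append]
  congr 1
  split_ifs with h <;> simp [h]

theorem length_sel {p : ℕ → Prop} [DecidablePred p] :
    (sel n p).length = #{z : Fin n | p z} := by
  rw [← List.toFinset_card_of_nodup nodup_sel, ← card_map Fin.valEmbedding]
  congr 1
  ext x
  simp only [List.mem_toFinset, mem_sel, mem_map, mem_filter, mem_univ, true_and,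
    Fin.valEmbedding_apply]
  exact ⟨fun h => ⟨⟨x, h.1⟩, h.2, rfl⟩, by rintro ⟨z, hz, rfl⟩; exact ⟨z.2, hz⟩⟩

theorem length_sel_le {p : ℕ → Prop} [DecidablePred p] : (sel n p).length ≤ n := by
  simpa [sel] using List.length_filter_le (fun x => decide (p x)) (List.range n)

theorem nodup_append_sel {p q : ℕ → Prop} [DecidablePred p] [DecidablePred q]
    (h : ∀ x, p x → ¬ q x) : (sel n p ++ sel n q).Nodup := by
  rw [List.nodup_append']
  refine ⟨nodup_sel, nodup_sel, fun x hx hy => ?_⟩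
  exact h x (mem_sel.1 hx).2 (mem_sel.1 hy).2

/-- The first clique, the matched vertices first. -/
def order₁ (n : ℕ) (sd mt : ℕ → ℕ) : List ℕ :=
  sel n (fun z => sd z = 1 ∧ mt z ≠ 0) ++ sel n (fun z => sd z = 1 ∧ mt z = 0)

/-- The second clique, the matched vertices first, in the order of their partners. -/
def order₂ (n : ℕ) (sd mt : ℕ → ℕ) : List ℕ :=
  (sel n (fun z => sd z = 1 ∧ mt z ≠ 0)).map (fun z => mt z - 1) ++
    sel n (fun z => sd z = 2 ∧ mt z = 0)

/-- The colours of which the flag `o₁` is set, those with the flag `o₂` first. -/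
def palette (n : ℕ) (o₁ o₂ : ℕ → ℕ) : List ℕ :=
  sel n (fun z => o₁ z ≠ 0 ∧ o₂ z ≠ 0) ++ sel n (fun z => o₁ z ≠ 0 ∧ o₂ z = 0)

theorem nodup_palette {o₁ o₂ : ℕ → ℕ} : (palette n o₁ o₂).Nodup :=
  nodup_append_sel fun _ h h' => h.2 h'.2

theorem mem_palette {o₁ o₂ : ℕ → ℕ} {x : ℕ} : x ∈ palette n o₁ o₂ ↔ x < n ∧ o₁ x ≠ 0 := by
  simp only [palette, List.mem_append, mem_sel]; tauto

theorem nodup_order₁ : (order₁ n sd mt).Nodup := nodup_append_sel fun _ h h' => h.2 h'.2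

theorem mem_order₁ {x : ℕ} : x ∈ order₁ n sd mt ↔ x < n ∧ sd x = 1 := by
  simp only [order₁, List.mem_append, mem_sel]; tauto

theorem IsMate.exists_partner (h : IsMate G sd mt) {x : ℕ}
    (hx : x ∈ sel n (fun z => sd z = 1 ∧ mt z ≠ 0)) :
    ∃ z w : Fin n, x = z ∧ mt x = w + 1 ∧ mt w = x + 1 ∧ sd w = 2 ∧ ¬ G.Adj z w := by
  obtain ⟨h1, h2, h3⟩ := mem_sel.1 hx
  obtain ⟨w, h4, h5, h6, h7⟩ := h ⟨x, h1⟩ h3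
  simp only at h4 h5 h6
  exact ⟨⟨x, h1⟩, w, rfl, h4, h5, by omega, h7⟩

theorem IsMate.mem_order₂ (h : IsMate G sd mt) {x : ℕ} :
    x ∈ order₂ n sd mt ↔ x < n ∧ sd x = 2 := by
  simp only [order₂, List.mem_append, List.mem_map]
  constructor
  · rintro (⟨y, hy, rfl⟩ | hx)
    · obtain ⟨z, w, -, h1, -, h2, -⟩ := h.exists_partner hy
      rw [h1, Nat.add_sub_cancel]
      exact ⟨w.2, h2⟩
    · have := mem_sel.1 hx; tauto
  · rintro ⟨h1, h2⟩
    by_cases hm : mt x = 0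
    · exact Or.inr (mem_sel.2 ⟨h1, h2, hm⟩)
    · obtain ⟨w, h4, h5, h6, -⟩ := h ⟨x, h1⟩ hm
      simp only at h4 h5 h6
      exact Or.inl ⟨w, mem_sel.2 ⟨w.2, by omega, by omega⟩, by omega⟩

theorem IsMate.nodup_order₂ (h : IsMate G sd mt) : (order₂ n sd mt).Nodup := by
  rw [order₂, List.nodup_append']
  refine ⟨List.Nodup.map_on (fun x hx y hy hxy => ?_) nodup_sel, nodup_sel, fun x hx hy => ?_⟩
  · obtain ⟨z, w, h0, h1, h2, -⟩ := h.exists_partner hx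
    obtain ⟨z', w', h0', h1', h2', -⟩ := h.exists_partner hy
    have : w = w' := Fin.ext (by omega)
    subst this
    omega
  · obtain ⟨y, hy', rfl⟩ := List.mem_map.1 hx
    obtain ⟨z, w, -, h1, h2, -⟩ := h.exists_partner hy'
    have := (mem_sel.1 hy).2.2
    rw [h1, Nat.add_sub_cancel] at this
    omega

/-- Two lists of the same size: an injective image. -/
theorem length_eq_of_image {l s : List ℕ} (hl : l.Nodup) (hs : s.Nodup) (c : ℕ → ℕ)
    (hinj : ∀ x ∈ l, ∀ y ∈ l, c x = c y → x = y) (him : ∀ y, y ∈ s ↔ ∃ x ∈ l, c x = y) :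
    l.length = s.length := by
  rw [← List.toFinset_card_of_nodup hl, ← List.toFinset_card_of_nodup hs,
    ← card_image_of_injOn (s := l.toFinset) (f := c)
      (fun x hx y hy => hinj x (by simpa using hx) y (by simpa using hy))]
  congr 1
  ext y
  simp [him]

/-- The colouring is injective on a class, which is a clique, so the class has as many vertices as
colours and the palette can be dealt out along `l` exactly. -/
theorem palette_length {o₁ o₂ : ℕ → ℕ} {c : ℕ → ℕ} {i : ℕ} {l : List ℕ} (hl : l.Nodup)
    (hmem : ∀ x, x ∈ l ↔ x < n ∧ sd x = i)
    (hcl : ∀ u v : Fin n, sd u = i → sd v = i → u ≠ v → c u ≠ c v)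
    (ho : ∀ x < n, o₁ x ≠ 0 ↔ ∃ z : Fin n, sd z = i ∧ c z = x) (hcn : ∀ u : Fin n, c u < n) :
    l.length = (palette n o₁ o₂).length := by
  refine length_eq_of_image hl nodup_palette c (fun x hx y hy hxy => ?_) fun y => ?_
  · rw [hmem] at hx hy
    by_contra hne
    exact hcl ⟨x, hx.1⟩ ⟨y, hy.1⟩ hx.2 hy.2 (by simpa using hne) hxy
  · rw [mem_palette]
    constructor
    · rintro ⟨h1, h2⟩
      obtain ⟨z, hz, hzc⟩ := (ho y h1).1 h2
      exact ⟨z, (hmem z).2 ⟨z.2, hz⟩, hzc⟩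
    · rintro ⟨x, hx, rfl⟩
      rw [hmem] at hx
      exact ⟨hcn ⟨x, hx.1⟩, (ho _ (hcn ⟨x, hx.1⟩)).2 ⟨⟨x, hx.1⟩, hx.2, rfl⟩⟩

theorem index_of_mem_common {p q : ℕ → Prop} [DecidablePred p] [DecidablePred q] {i : ℕ}
    (h : i < (sel n p ++ sel n q).length) (hp : ¬ q ((sel n p ++ sel n q).getD i 0)) :
    i < (sel n p).length := by
  by_contra hi
  rw [List.getD_append_right _ _ _ _ (by omega)] at hp
  rw [List.length_append] at h
  rw [List.getD_eq_getElem _ _ (by omega)] at hp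
  exact hp (mem_sel.1 (List.getElem_mem _)).2

/-- The new colouring is proper. -/
theorem Step.recolour (h : Step G G' sd mt) {c c' o₁ o₂ : ℕ → ℕ}
    (hc : ∀ u v : Fin n, G'.Adj u v → c u ≠ c v) (hcn : ∀ u : Fin n, c u < n)
    (ho₁ : ∀ x < n, o₁ x ≠ 0 ↔ ∃ z : Fin n, sd z = 1 ∧ c z = x)
    (ho₂ : ∀ x < n, o₂ x ≠ 0 ↔ ∃ z : Fin n, sd z = 2 ∧ c z = x)
    (h0 : ∀ z : Fin n, sd z = 0 → c' z = c z)
    (h1 : ∀ i < (order₁ n sd mt).length,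
      c' ((order₁ n sd mt).getD i 0) = (palette n o₁ o₂).getD i 0)
    (h2 : ∀ i < (order₂ n sd mt).length,
      c' ((order₂ n sd mt).getD i 0) = (palette n o₂ o₁).getD i 0) :
    (∀ u v : Fin n, G.Adj u v → c' u ≠ c' v) ∧ ∀ z : Fin n, ∃ w : Fin n, c' z = c w := by
  have hin : ∀ u v : Fin n, sd u ≠ 0 → sd u = sd v → u ≠ v → c u ≠ c v := fun u v hu huv hne =>
    hc u v (h.agree u v (by omega) (h.clique u v hu huv hne))
  have len₁ := palette_length (o₂ := o₂) nodup_order₁ (fun x => mem_order₁ (mt := mt))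
    (fun u v hu hv => hin u v (by omega) (by omega)) ho₁ hcn
  have len₂ := palette_length (o₂ := o₁) h.mate.nodup_order₂ (fun x => h.mate.mem_order₂)
    (fun u v hu hv => hin u v (by omega) (by omega)) ho₂ hcn
  -- the position of a vertex of one of the cliques, and its colour
  have pos₁ : ∀ u : Fin n, sd u = 1 → ∃ i < (order₁ n sd mt).length,
      (order₁ n sd mt).getD i 0 = u ∧ c' u = (palette n o₁ o₂).getD i 0 := by
    intro u hu
    obtain ⟨i, hi, e⟩ := List.getElem_of_mem (mem_order₁ (mt := mt).2 ⟨u.2, hu⟩)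
    have e' : (order₁ n sd mt).getD i 0 = u := by rw [List.getD_eq_getElem _ _ hi, e]
    exact ⟨i, hi, e', e' ▸ h1 i hi⟩
  have pos₂ : ∀ u : Fin n, sd u = 2 → ∃ i < (order₂ n sd mt).length,
      (order₂ n sd mt).getD i 0 = u ∧ c' u = (palette n o₂ o₁).getD i 0 := by
    intro u hu
    obtain ⟨i, hi, e⟩ := List.getElem_of_mem (h.mate.mem_order₂.2 ⟨u.2, hu⟩)
    have e' : (order₂ n sd mt).getD i 0 = u := by rw [List.getD_eq_getElem _ _ hi, e]
    exact ⟨i, hi, e', e' ▸ h2 i hi⟩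
  have mem₁ : ∀ i < (order₁ n sd mt).length, (palette n o₁ o₂).getD i 0 ∈ palette n o₁ o₂ := by
    intro i hi
    rw [List.getD_eq_getElem _ _ (len₁ ▸ hi)]
    exact List.getElem_mem _
  have mem₂ : ∀ i < (order₂ n sd mt).length, (palette n o₂ o₁).getD i 0 ∈ palette n o₂ o₁ := by
    intro i hi
    rw [List.getD_eq_getElem _ _ (len₂ ▸ hi)]
    exact List.getElem_mem _
  have col₁ : ∀ u : Fin n, sd u = 1 → ∃ w : Fin n, sd w = 1 ∧ c w = c' u := by
    intro u hu
    obtain ⟨i, hi, -, e⟩ := pos₁ u hu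
    have := mem_palette.1 (mem₁ i hi)
    rw [← e] at this
    exact (ho₁ _ this.1).1 this.2
  have col₂ : ∀ u : Fin n, sd u = 2 → ∃ w : Fin n, sd w = 2 ∧ c w = c' u := by
    intro u hu
    obtain ⟨i, hi, -, e⟩ := pos₂ u hu
    have := mem_palette.1 (mem₂ i hi)
    rw [← e] at this
    exact (ho₂ _ this.1).1 this.2
  -- Each class keeps its set of colours; only their distribution within the class changes.
  have col : ∀ u : Fin n, ∃ w : Fin n, sd w = sd u ∧ (sd u = 0 → w = u) ∧ c w = c' u := by
    intro u
    have := h.sd_le u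
    rcases (by omega : sd u = 0 ∨ sd u = 1 ∨ sd u = 2) with e | e | e
    · exact ⟨u, rfl, fun _ => rfl, (h0 u e).symm⟩
    · obtain ⟨w, hw⟩ := col₁ u e
      exact ⟨w, by omega, by omega, hw.2⟩
    · obtain ⟨w, hw⟩ := col₂ u e
      exact ⟨w, by omega, by omega, hw.2⟩
  have hlen : (sel n (fun z => o₁ z ≠ 0 ∧ o₂ z ≠ 0)).length ≤
      (sel n (fun z => sd z = 1 ∧ mt z ≠ 0)).length := by
    have e1 := h.common_card hc
    have e2 := h.mate.two_mul_matched
    rw [length_sel (p := fun z => sd z = 1 ∧ mt z ≠ 0)]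
    simp only [and_comm (a := sd _ = 1)]
    suffices (sel n (fun z => o₁ z ≠ 0 ∧ o₂ z ≠ 0)).length ≤
      #(({z : Fin n | sd z = 1} : Finset (Fin n)).image (fun z : Fin n => c z) ∩
      ({z : Fin n | sd z = 2} : Finset (Fin n)).image (fun z : Fin n => c z)) by omega
    rw [← List.toFinset_card_of_nodup nodup_sel]
    refine card_le_card fun x hx => ?_
    rw [List.mem_toFinset, mem_sel] at hx
    rw [ho₁ x hx.1, ho₂ x hx.1] at hx
    simpa using hx.2
  -- A colour shared by `u` and `v` is common to both classes. Both palettes start with the common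
  -- colours in the same order, so it has the same index in each, and by `hlen` this index is that
  -- of a matched pair in both vertex orders. So `u` and `v` are partners and not adjacent.
  have cross : ∀ u v : Fin n, sd u = 1 → sd v = 2 → G.Adj u v → c' u ≠ c' v := by
    intro u v hu hv huv hcc
    obtain ⟨i, hi, eu, ei⟩ := pos₁ u hu
    obtain ⟨j, hj, ev, ej⟩ := pos₂ v hv
    have m1 := mem_palette.1 (mem₁ i hi)
    have m2 := mem_palette.1 (mem₂ j hj)
    rw [← ei] at m1
    rw [← ej, ← hcc] at m2
    have i1 : i < (sel n (fun z => o₁ z ≠ 0 ∧ o₂ z ≠ 0)).length :=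
      index_of_mem_common (len₁ ▸ hi) (by
        change ¬ (o₁ ((palette n o₁ o₂).getD i 0) ≠ 0 ∧ o₂ ((palette n o₁ o₂).getD i 0) = 0)
        rw [← ei]; tauto)
    have j1 : j < (sel n (fun z => o₂ z ≠ 0 ∧ o₁ z ≠ 0)).length :=
      index_of_mem_common (len₂ ▸ hj) (by
        change ¬ (o₂ ((palette n o₂ o₁).getD j 0) ≠ 0 ∧ o₁ ((palette n o₂ o₁).getD j 0) = 0)
        rw [← ej, ← hcc]; tauto)
    have comm : sel n (fun z => o₂ z ≠ 0 ∧ o₁ z ≠ 0) = sel n (fun z => o₁ z ≠ 0 ∧ o₂ z ≠ 0) := by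
      simp only [sel, and_comm]
    have ei' := ei
    have ej' := ej
    rw [palette, List.getD_append _ _ _ _ i1, List.getD_eq_getElem _ _ i1] at ei'
    rw [palette, List.getD_append _ _ _ _ j1, List.getD_eq_getElem _ _ j1] at ej'
    simp only [comm] at ej' j1
    have hij : i = j := (nodup_sel.getElem_inj_iff).1 (ei'.symm.trans (hcc.trans ej'))
    subst hij
    have i2 := i1.trans_le hlen
    rw [order₁, List.getD_append _ _ _ _ i2] at eu
    rw [order₂, List.getD_append _ _ _ _ (by simpa using i2),
      List.getD_eq_getElem _ _ (by simpa using i2), List.getElem_map] at ev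
    rw [List.getD_eq_getElem _ _ i2] at eu
    obtain ⟨z, w, e1, e2, -, -, e3⟩ := h.mate.exists_partner (List.getElem_mem i2)
    rw [eu] at e1 e2 ev
    obtain rfl : u = z := Fin.ext e1
    obtain rfl : v = w := Fin.ext (by omega)
    exact e3 huv
  -- The new colour of `v` is the old colour of some `v'` in the same class. By homogeneity `u` sees
  -- `v'` too, and that edge survives the reduction.
  have adj0 : ∀ u v : Fin n, sd u = 0 → G.Adj u v → c' u ≠ c' v := by
    intro u v hu huv hcc
    obtain ⟨v', hv', hv0, ev⟩ := col v
    refine hc u v' (h.agree u v' ?_ ?_) (by rw [ev, ← hcc, h0 u hu])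
    · have := h.sd_le v'; omega
    · by_cases hv : sd v = 0
      · rwa [hv0 hv]
      · exact h.homogeneous u v v' hu hv hv'.symm huv
  refine ⟨fun u v huv hcc => ?_, fun z => (col z).imp fun w hw => hw.2.2.symm⟩
  by_cases hu0 : sd u = 0
  · exact adj0 u v hu0 huv hcc
  by_cases hv0 : sd v = 0
  · exact adj0 v u hv0 huv.symm hcc.symm
  have a1 := h.sd_le u
  have a2 := h.sd_le v
  rcases (by omega : sd u = 1 ∧ sd v = 2 ∨ sd u = 2 ∧ sd v = 1 ∨ sd u = 1 ∧ sd v = 1 ∨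
    sd u = 2 ∧ sd v = 2) with e | e | e | e
  · exact cross u v e.1 e.2 huv hcc
  · exact cross v u e.2 e.1 huv.symm hcc.symm
  · obtain ⟨i, hi, eu, ei⟩ := pos₁ u e.1
    obtain ⟨j, hj, ev, ej⟩ := pos₁ v e.2
    rw [ei, ej, List.getD_eq_getElem _ _ (len₁ ▸ hi), List.getD_eq_getElem _ _ (len₁ ▸ hj),
      nodup_palette.getElem_inj_iff] at hcc
    subst hcc
    exact huv.ne (Fin.ext (eu.symm.trans ev))
  · obtain ⟨i, hi, eu, ei⟩ := pos₂ u e.1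
    obtain ⟨j, hj, ev, ej⟩ := pos₂ v e.2
    rw [ei, ej, List.getD_eq_getElem _ _ (len₂ ▸ hi), List.getD_eq_getElem _ _ (len₂ ▸ hj),
      nodup_palette.getElem_inj_iff] at hcc
    subst hcc
    exact huv.ne (Fin.ext (eu.symm.trans ev))

end WordRAM


/-! ### A program logic with total correctness and step counts -/

namespace WordRAM

theorem Op.add_apply (a b : ℕ) : Op.add.apply a b = a + b := rfl

theorem Op.sub_apply (a b : ℕ) : Op.sub.apply a b = a - b := rfl

theorem Op.mul_apply (a b : ℕ) : Op.mul.apply a b = a * b := rfl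

theorem Op.eq_eq_zero {a b : ℕ} : Op.eq.apply a b = 0 ↔ ¬ a = b := by simp [Op.apply]

theorem Op.lt_eq_zero {a b : ℕ} : Op.lt.apply a b = 0 ↔ ¬ a < b := by simp [Op.apply]

theorem Op.eq_fits {a b W : ℕ} (h : 1 < W) : Op.eq.apply a b < W := by
  simp only [Op.apply]; split_ifs <;> omega

theorem Op.lt_fits {a b W : ℕ} (h : 1 < W) : Op.lt.apply a b < W := by
  simp only [Op.apply]; split_ifs <;> omega

/-- `p`, started in `s`, halts after some number `t` of steps in a store `s'` with `Q t s'`. -/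
def WP (W : ℕ) (p : Prog) (s : Store) (Q : ℕ → Store → Prop) : Prop :=
  ∃ t s', Run W p s t s' ∧ Q t s'

/-- Does the program contain an assignment to register `x`? -/
def Prog.wr : Prog → ℕ → Bool
  | .skip, _ => false
  | .assign y _, x => y == x
  | .write _ _ _, _ => false
  | .seq p q, x => p.wr x || q.wr x
  | .cond _ p q, x => p.wr x || q.wr x
  | .loop _ p, x => p.wr x

/-- Does the program write to array `a`? -/
def Prog.wa : Prog → ℕ → Bool
  | .skip, _ => false
  | .assign _ _, _ => false
  | .write b _ _, a => b == a
  | .seq p q, a => p.wa a || q.wa a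
  | .cond _ p q, a => p.wa a || q.wa a
  | .loop _ p, a => p.wa a

/-- `s'` agrees with `s` on everything that `p` does not write to. -/
def Frame (p : Prog) (s s' : Store) : Prop :=
  (∀ x, p.wr x = false → s'.reg x = s.reg x) ∧ ∀ a, p.wa a = false → s'.arr a = s.arr a

section Rules

variable {W : ℕ} {p q : Prog} {s s' : Store} {Q R : ℕ → Store → Prop} {e i : Expr} {x a : ℕ}

@[simp] theorem setReg_reg (k y : ℕ) :
    (s.setReg x k).reg y = if y = x then k else s.reg y := by
  simp [Store.setReg, Function.update_apply]

@[simp] theorem setReg_arr (k : ℕ) : (s.setReg x k).arr = s.arr := rfl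

@[simp] theorem setArr_reg (j k : ℕ) : (s.setArr a j k).reg = s.reg := rfl

@[simp] theorem setArr_arr (j k b : ℕ) : (s.setArr a j k).arr b =
    if b = a then Function.update (s.arr a) j k else s.arr b := by
  simp [Store.setArr, Function.update_apply]

theorem Frame.refl : Frame p s s := ⟨fun _ _ => rfl, fun _ _ => rfl⟩

theorem Frame.trans {s'' : Store} (h : Frame p s s') (h' : Frame p s' s'') : Frame p s s'' :=
  ⟨fun x hx => (h'.1 x hx).trans (h.1 x hx), fun a ha => (h'.2 a ha).trans (h.2 a ha)⟩

theorem Frame.mono (h : Frame p s s') (h1 : ∀ x, q.wr x = false → p.wr x = false)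
    (h2 : ∀ a, q.wa a = false → p.wa a = false) : Frame q s s' :=
  ⟨fun x hx => h.1 x (h1 x hx), fun a ha => h.2 a (h2 a ha)⟩

/-- The sets of written registers and arrays are computed from the syntax, so for a concrete program
the preservation of a register or array is later proved by `rfl`. -/
theorem Run.frame {t : ℕ} (h : Run W p s t s') : Frame p s s' := by
  induction h with
  | skip => exact Frame.refl
  | assign s x e he =>
    refine ⟨fun y hy => ?_, fun _ _ => rfl⟩
    have : x ≠ y := by simpa [Prog.wr] using hy
    simp [this.symm]
  | write s a i e hi he =>
    refine ⟨fun _ _ => rfl, fun b hb => ?_⟩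
    have : a ≠ b := by simpa [Prog.wa] using hb
    simp [this.symm]
  | seq _ _ h1 h2 =>
    exact (h1.mono (by simp +contextual [Prog.wr]) (by simp +contextual [Prog.wa])).trans
      (h2.mono (by simp +contextual [Prog.wr]) (by simp +contextual [Prog.wa]))
  | cond_true _ _ _ h1 => exact h1.mono (by simp +contextual [Prog.wr]) (by simp +contextual [Prog.wa])
  | cond_false _ _ _ h1 => exact h1.mono (by simp +contextual [Prog.wr]) (by simp +contextual [Prog.wa])
  | loop_true _ _ _ _ h1 h2 =>
    exact (h1.mono (by simp [Prog.wr]) (by simp [Prog.wa])).trans h2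
  | loop_false => exact Frame.refl

theorem WP.mono (h : WP W p s Q) (hQ : ∀ t s', Frame p s s' → Q t s' → R t s') : WP W p s R := by
  obtain ⟨t, s', hr, hq⟩ := h
  exact ⟨t, s', hr, hQ t s' hr.frame hq⟩

theorem wp_skip : WP W .skip s Q ↔ Q 1 s := by
  constructor
  · rintro ⟨t, s', h, hq⟩
    cases h
    exact hq
  · exact fun h => ⟨_, _, .skip s, h⟩

theorem wp_assign : WP W (.assign x e) s Q ↔
    e.Fits W s ∧ Q (e.cost + 1) (s.setReg x (e.eval s)) := by
  constructor
  · rintro ⟨t, s', h, hq⟩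
    cases h
    exact ⟨by assumption, hq⟩
  · exact fun h => ⟨_, _, .assign s x e h.1, h.2⟩

theorem wp_write : WP W (.write a i e) s Q ↔
    (i.Fits W s ∧ e.Fits W s) ∧ Q (i.cost + e.cost + 1) (s.setArr a (i.eval s) (e.eval s)) := by
  constructor
  · rintro ⟨t, s', h, hq⟩
    cases h
    exact ⟨⟨by assumption, by assumption⟩, hq⟩
  · exact fun h => ⟨_, _, .write s a i e h.1.1 h.1.2, h.2⟩

theorem wp_seq : WP W (.seq p q) s Q ↔
    WP W p s fun t s' => WP W q s' fun t' s'' => Q (t + t') s'' := by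
  constructor
  · rintro ⟨t, s', h, hq⟩
    cases h with
    | seq h1 h2 => exact ⟨_, _, h1, _, _, h2, hq⟩
  · rintro ⟨t, s', h1, t', s'', h2, hq⟩
    exact ⟨_, _, .seq h1 h2, hq⟩

theorem wp_cond : WP W (.cond e p q) s Q ↔ e.Fits W s ∧
    (e.eval s ≠ 0 → WP W p s fun t s' => Q (e.cost + 1 + t) s') ∧
    (e.eval s = 0 → WP W q s fun t s' => Q (e.cost + 1 + t) s') := by
  constructor
  · rintro ⟨t, s', h, hq⟩
    cases h with
    | cond_true he h h1 => exact ⟨he, fun _ => ⟨_, _, h1, hq⟩, fun h' => absurd h' h⟩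
    | cond_false he h h1 => exact ⟨he, fun h' => absurd h h', fun _ => ⟨_, _, h1, hq⟩⟩
  · rintro ⟨he, h1, h2⟩
    by_cases h : e.eval s = 0
    · obtain ⟨t, s', hr, hq⟩ := h2 h
      exact ⟨_, _, .cond_false he h hr, hq⟩
    · obtain ⟨t, s', hr, hq⟩ := h1 h
      exact ⟨_, _, .cond_true he h hr, hq⟩

theorem WP.seq (h : WP W p s fun t s' => WP W q s' fun t' s'' => Q (t + t') s'') :
    WP W (.seq p q) s Q := wp_seq.2 h

/-- A loop with invariant `I k t s` (`k` rounds and `t` steps done) that makes at most `N`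
rounds. -/
theorem WP.loop {I : ℕ → ℕ → Store → Prop} (N : ℕ) (h0 : I 0 0 s)
    (hN : ∀ k t s', I k t s' → k ≤ N)
    (hfit : ∀ k t s', I k t s' → e.Fits W s')
    (hstep : ∀ k t s', I k t s' → Frame p s s' → e.eval s' ≠ 0 →
      WP W p s' fun t' s'' => I (k + 1) (t + (e.cost + 1 + t')) s'')
    (hQ : ∀ k t s', I k t s' → Frame p s s' → e.eval s' = 0 → Q (t + (e.cost + 1)) s') :
    WP W (.loop e p) s Q := by
  -- Induction on the number of rounds left; with `N + 1` in place of `N` the base case contradicts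
  -- `k ≤ N`.
  suffices ∀ m k t s', N + 1 - k ≤ m → I k t s' → Frame p s s' →
      WP W (.loop e p) s' fun t' s'' => Q (t + t') s'' by
    have := this _ 0 0 s le_rfl h0 Frame.refl
    simpa using this
  intro m
  induction m with
  | zero => exact fun k t s' hk hI => absurd (hN k t s' hI) (by omega)
  | succ m ih =>
    intro k t s' hk hI hF
    by_cases h : e.eval s' = 0
    · exact ⟨_, _, .loop_false (hfit _ _ _ hI) h, hQ k t s' hI hF h⟩
    · obtain ⟨t1, s1, hr, hI1⟩ := hstep k t s' hI hF h
      obtain ⟨t2, s2, hr2, hq⟩ := ih (k + 1) _ s1 (by have := hN k t s' hI; omega) hI1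
        (hF.trans hr.frame)
      refine ⟨_, _, .loop_true (hfit _ _ _ hI) h hr hr2, ?_⟩
      have e : t + (e.cost + 1 + t1 + t2) = t + (e.cost + 1 + t1) + t2 := by omega
      change Q (t + _) s2
      rw [e]
      exact hq

/-- `for x := 0, …, reg N - 1 do p`. -/
def Prog.for (x N : ℕ) (p : Prog) : Prog :=
  .seq (.assign x (.lit 0)) (.loop (.bin .lt (.reg x) (.reg N))
    (.seq p (.assign x (.bin .add (.reg x) (.lit 1)))))

/-- Each round costs 8 steps besides the body: 4 for the test and 4 for the increment. The final 6
are the assignment of `0` and the failing test. The invariant sees the elapsed time, which allows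
amortised bounds. -/
theorem WP.forTime {n N : ℕ} {I : ℕ → ℕ → Store → Prop} (hxN : x ≠ N) (hx : p.wr x = false)
    (hpN : p.wr N = false) (hn : s.reg N = n) (hW : n + 1 < W) (h0 : I 0 0 (s.setReg x 0))
    (hstep : ∀ k t s', k < n → s'.reg x = k → Frame (.for x N p) s s' → I k t s' →
      WP W p s' fun t' s'' => I (k + 1) (t + (t' + 8)) (s''.setReg x (k + 1)))
    (hQ : ∀ t s', Frame (.for x N p) s s' → I n t s' → Q (t + 6) s') :
    WP W (.for x N p) s Q := by
  have hwx : ∀ y, (Prog.for x N p).wr y = false ↔ x ≠ y ∧ p.wr y = false := by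
    intro y; simp [Prog.for, Prog.wr]; tauto
  have hwa : ∀ a, (Prog.for x N p).wa a = p.wa a := by
    intro a; simp [Prog.for, Prog.wa]
  refine wp_seq.2 (wp_assign.2 ⟨by simp only [Expr.Fits]; omega, ?_⟩)
  simp only [Expr.cost, Expr.eval]
  have hF0 : Frame (.for x N p) s (s.setReg x 0) :=
    ⟨fun y hy => by simp [((hwx y).1 hy).1.symm], fun _ _ => rfl⟩
  have hF1 : ∀ {s'}, Frame (.seq p (.assign x (.bin .add (.reg x) (.lit 1)))) (s.setReg x 0) s' →
      Frame (.for x N p) s s' := fun h => hF0.trans (h.mono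
        (fun y hy => by simp only [hwx] at hy; simp [Prog.wr, hy])
        (fun y hy => by rw [hwa] at hy; simp [Prog.wa, hy]))
  refine WP.loop (I := fun k t s' => k ≤ n ∧ s'.reg x = k ∧ s'.reg N = n ∧ I k t s') n ?_
    (fun k t s' h => h.1) ?_ ?_ ?_
  · exact ⟨Nat.zero_le _, by simp, by simp [hxN.symm, hn], h0⟩
  · rintro k t s' ⟨h1, h2, h3, -⟩
    simp only [Expr.Fits, Expr.eval, Op.apply, h2, h3]
    refine ⟨by omega, by omega, ?_⟩
    split_ifs <;> omega
  · rintro k t s' ⟨h1, h2, h3, h4⟩ hF he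
    have hk : k < n := by simpa [Expr.eval, Op.apply, h2, h3] using he
    refine wp_seq.2 ((hstep k t s' hk h2 (hF1 hF) h4).mono fun t' s'' hF' hI => ?_)
    have e1 := (hF'.1 x hx).trans h2
    have e2 := (hF'.1 N hpN).trans h3
    rw [wp_assign]
    simp only [Expr.Fits, Expr.eval, Op.apply, Expr.cost, e1]
    refine ⟨⟨by omega, by omega, by omega⟩, by omega, by simp, by simp [hxN.symm, e2], ?_⟩
    convert hI using 1
    ring
  · rintro k t s' ⟨h1, h2, h3, h4⟩ hF he
    have hk : ¬ k < n := by simpa [Expr.eval, Op.apply, h2, h3] using he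
    obtain rfl : k = n := by omega
    have := hQ t s' (hF1 hF) h4
    simp only [Expr.cost]
    convert this using 1
    ring

theorem WP.for {n N T : ℕ} {I : ℕ → Store → Prop} (hxN : x ≠ N) (hx : p.wr x = false)
    (hpN : p.wr N = false) (hn : s.reg N = n) (hW : n + 1 < W) (h0 : I 0 (s.setReg x 0))
    (hstep : ∀ (k : Fin n) s', s'.reg x = (k : ℕ) → Frame (.for x N p) s s' → I k s' →
      WP W p s' fun t' s'' => t' ≤ T ∧ I (k + 1) (s''.setReg x (k + 1)))
    (hQ : ∀ t s', t ≤ n * (T + 8) + 6 → Frame (.for x N p) s s' → I n s' → Q t s') :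
    WP W (.for x N p) s Q := by
  refine WP.forTime (I := fun k t s' => t ≤ k * (T + 8) ∧ I k s') hxN hx hpN hn hW ⟨by simp, h0⟩
    ?_ ?_
  · rintro k t s' hk hxk hF ⟨ht, hI⟩
    refine (hstep ⟨k, hk⟩ s' hxk hF hI).mono fun t' s'' _ h => ⟨?_, h.2⟩
    have := h.1
    rw [Nat.add_mul]
    omega
  · rintro t s' hF ⟨ht, hI⟩
    exact hQ _ _ (by omega) hF hI

end Rules

/-! ### Independence of arrays that a program does not touch -/

/-- Does the expression read array `b`? -/
def Expr.reads : Expr → ℕ → Bool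
  | .lit _, _ => false
  | .reg _, _ => false
  | .get a i, b => a == b || i.reads b
  | .bin _ e₁ e₂, b => e₁.reads b || e₂.reads b

/-- Does the program access array `b`? -/
def Prog.touches : Prog → ℕ → Bool
  | .skip, _ => false
  | .assign _ e, b => e.reads b
  | .write a i e, b => a == b || i.reads b || e.reads b
  | .seq p q, b => p.touches b || q.touches b
  | .cond e p q, b => e.reads b || p.touches b || q.touches b
  | .loop e p, b => e.reads b || p.touches b

/-- The store with array `b` replaced by `f`. -/
def Store.withArr (s : Store) (b : ℕ) (f : ℕ → ℕ) : Store :=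
  { s with arr := Function.update s.arr b f }

theorem Expr.eval_withArr {e : Expr} {b : ℕ} (h : e.reads b = false) (s : Store) (f : ℕ → ℕ) :
    e.eval (s.withArr b f) = e.eval s := by
  induction e with
  | lit k => rfl
  | reg x => rfl
  | get a i ih =>
    simp only [Expr.reads, Bool.or_eq_false_iff, beq_eq_false_iff_ne] at h
    have := ih h.2
    simp only [Expr.eval, this]
    simp [Store.withArr, Function.update_of_ne h.1]
  | bin o e₁ e₂ ih₁ ih₂ =>
    simp only [Expr.reads, Bool.or_eq_false_iff] at h
    simp [Expr.eval, ih₁ h.1, ih₂ h.2]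

theorem Expr.fits_withArr {W : ℕ} {e : Expr} {b : ℕ} (h : e.reads b = false) {s : Store}
    (f : ℕ → ℕ) (hf : e.Fits W s) : e.Fits W (s.withArr b f) := by
  induction e with
  | lit k => exact hf
  | reg x => exact hf
  | get a i ih =>
    simp only [Expr.reads, Bool.or_eq_false_iff, beq_eq_false_iff_ne] at h
    refine ⟨ih h.2 hf.1, ?_⟩
    rw [Expr.eval_withArr h.2]
    simpa [Store.withArr, Function.update_of_ne h.1] using hf.2
  | bin o e₁ e₂ ih₁ ih₂ =>
    simp only [Expr.reads, Bool.or_eq_false_iff] at h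
    refine ⟨ih₁ h.1 hf.1, ih₂ h.2 hf.2.1, ?_⟩
    rw [Expr.eval_withArr h.1, Expr.eval_withArr h.2]
    exact hf.2.2

/-- Programs that do not touch array `b` run in the same way whatever that array contains. -/
theorem Run.withArr {W : ℕ} {p : Prog} {s s' : Store} {t : ℕ} (h : Run W p s t s') {b : ℕ}
    (hb : p.touches b = false) (f : ℕ → ℕ) : Run W p (s.withArr b f) t (s'.withArr b f) := by
  induction h with
  | skip => exact .skip _
  | assign s x e he =>
    have := Run.assign (s.withArr b f) x e (Expr.fits_withArr hb f he)
    rwa [Expr.eval_withArr hb] at this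
  | write s a i e hi he =>
    simp only [Prog.touches, Bool.or_eq_false_iff, beq_eq_false_iff_ne] at hb
    have := Run.write (s.withArr b f) a i e (Expr.fits_withArr hb.1.2 f hi)
      (Expr.fits_withArr hb.2 f he)
    rw [Expr.eval_withArr hb.2, Expr.eval_withArr hb.1.2] at this
    convert this using 1
    simp [Store.setArr, Store.withArr, Function.update_comm hb.1.1,
      Function.update_of_ne hb.1.1]
  | seq _ _ h1 h2 =>
    simp only [Prog.touches, Bool.or_eq_false_iff] at hb
    exact .seq (h1 hb.1) (h2 hb.2)
  | cond_true he h _ h1 =>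
    simp only [Prog.touches, Bool.or_eq_false_iff] at hb
    exact .cond_true (Expr.fits_withArr hb.1.1 f he) (by rwa [Expr.eval_withArr hb.1.1]) (h1 hb.1.2)
  | cond_false he h _ h1 =>
    simp only [Prog.touches, Bool.or_eq_false_iff] at hb
    exact .cond_false (Expr.fits_withArr hb.1.1 f he) (by rwa [Expr.eval_withArr hb.1.1]) (h1 hb.2)
  | loop_true he h _ _ h1 h2 =>
    have hb' := hb
    simp only [Prog.touches, Bool.or_eq_false_iff] at hb
    exact .loop_true (Expr.fits_withArr hb.1 f he) (by rwa [Expr.eval_withArr hb.1]) (h1 hb.2)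
      (h2 hb')
  | loop_false he h =>
    simp only [Prog.touches, Bool.or_eq_false_iff] at hb
    exact .loop_false (Expr.fits_withArr hb.1 f he) (by rwa [Expr.eval_withArr hb.1])

end WordRAM


/-! ### Notation for programs, private neighbours, and the closure of a seed -/

namespace WordRAM

/-- Sequential composition. -/
infixr:60 " ;; " => Prog.seq

/-- Assignment to a register. -/
infix:65 " <~ " => Prog.assign

/-- The entry of the adjacency matrix in the row given by register `x` and the column given by
register `y`. -/
abbrev Expr.adj (x y : ℕ) : Expr := .get 0 (.bin .add (.bin .mul (.reg x) (.reg 0)) (.reg y))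

/-- The array holds the adjacency matrix of `G`. -/
def Mat {n : ℕ} (G : SimpleGraph (Fin n)) (A : ℕ → ℕ) : Prop :=
  ∀ u v : Fin n, A (u * n + v) = adjEntry G u v

variable {n W : ℕ} {G : SimpleGraph (Fin n)}

theorem adjEntry_eq_zero {u v : Fin n} : adjEntry G u v = 0 ↔ ¬ G.Adj u v := by
  simp [adjEntry]

theorem adjEntry_le (u v : Fin n) : adjEntry G u v ≤ 1 := by
  rw [adjEntry]; split_ifs <;> omega

theorem adjEntry_eq {u v u' v' : Fin n} :
    adjEntry G u v = adjEntry G u' v' ↔ (G.Adj u v ↔ G.Adj u' v') := by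
  simp only [adjEntry]; split_ifs <;> simp [*]

theorem index_lt (u v : Fin n) : (u * n + v : ℕ) < n * n := by
  have := u.2; have := v.2
  calc (u * n + v : ℕ) < u * n + n := by omega
    _ = (u + 1) * n := by ring
    _ ≤ n * n := Nat.mul_le_mul_right _ (by omega)

/-- The words are long enough for all values that our programs compute. -/
def Ample (n W : ℕ) : Prop := n * n * n + 2 * (n * n) + 2 * n + 10 < W

/-! ### Private neighbours -/

/-- The code `r` is that of a vertex adjacent to `b` and not to `b'`, or `0` if there is no such
vertex below `k`. -/
def Priv (G : SimpleGraph (Fin n)) (b b' : Fin n) (k r : ℕ) : Prop :=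
  r = 0 ∧ (∀ a : Fin n, a < k → G.Adj a b → ¬ G.Adj a b' → a = b') ∨
    ∃ a : Fin n, r = a + 1 ∧ G.Adj a b ∧ ¬ G.Adj a b' ∧ a ≠ b'

theorem Priv.succ {b b' z : Fin n} {r : ℕ} (h : Priv G b b' z r)
    (hz : G.Adj z b → ¬ G.Adj z b' → z = b') : Priv G b b' (z + 1) r := by
  refine h.imp (fun h' => ⟨h'.1, fun a ha hab hab' => ?_⟩) id
  by_cases e : a = z
  · subst e; exact hz hab hab'
  · exact h'.2 a (by have : (a : ℕ) ≠ z := fun e' => e (Fin.ext e'); omega) hab hab'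

/-- Find a vertex adjacent to `reg 1` and not to `reg 2`, and vice versa. -/
def privProg : Prog :=
  3 <~ .lit 0 ;; 4 <~ .lit 0 ;;
  .for 5 0 (
    .cond (.adj 5 1)
      (.cond (.adj 5 2) .skip
        -- When `b` and `b'` are adjacent, `b'` itself sees `b` and not `b'`, so it has to be
        -- excluded. Codes are shifted by one to make `0` mean that no vertex was found.
        (.cond (.bin .eq (.reg 5) (.reg 2)) .skip (3 <~ .bin .add (.reg 5) (.lit 1))))
      (.cond (.adj 5 2)
        (.cond (.bin .eq (.reg 5) (.reg 1)) .skip (4 <~ .bin .add (.reg 5) (.lit 1))) .skip))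

theorem privProg_spec (hW : Ample n W) {s : Store} (hA : Mat G (s.arr 0)) {b b' : Fin n}
    (h0 : s.reg 0 = n) (h1 : s.reg 1 = b) (h2 : s.reg 2 = b') :
    WP W privProg s fun t s' => t ≤ 50 * n + 20 ∧
      Priv G b b' n (s'.reg 3) ∧ Priv G b' b n (s'.reg 4) := by
  unfold Ample at hW
  rw [privProg, wp_seq, wp_assign]
  refine ⟨by simp only [Expr.Fits]; omega, ?_⟩
  rw [wp_seq, wp_assign]
  refine ⟨by simp only [Expr.Fits]; omega, ?_⟩
  refine WP.for (n := n) (T := 42) (I := fun k s' => 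
      Priv G b b' k (s'.reg 3) ∧ Priv G b' b k (s'.reg 4))
    (by decide) rfl rfl (by simp [h0]) (by omega) (by simp [Expr.eval, Priv]) ?_ ?_
  · rintro z s' hz hF ⟨hI, hI'⟩
    have e0 : s'.reg 0 = n := by simpa [h0] using hF.1 0 rfl
    have e1 : s'.reg 1 = b := by simpa [h1] using hF.1 1 rfl
    have e2 : s'.reg 2 = b' := by simpa [h2] using hF.1 2 rfl
    have eA : s'.arr 0 = s.arr 0 := by simpa using hF.2 0 rfl
    have i1 := index_lt z b
    have i2 := index_lt z b'
    have := adjEntry_le (G := G) z b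
    have := adjEntry_le (G := G) z b'
    simp only [wp_cond, wp_skip, wp_assign, Expr.Fits, Expr.eval, Op.apply, hz, e0, e1, e2, eA,
      hA z _, Expr.cost, setReg_reg, ne_eq, adjEntry_eq_zero, not_not, ite_eq_right_iff,
      one_ne_zero, imp_false, Fin.val_inj, Nat.reduceEqDiff, reduceIte, Nat.reduceAdd,
      Nat.reduceLeDiff, true_and]
    refine ⟨by omega, fun c1 => ⟨by omega, fun c2 => ?_, fun c2 => ⟨by split_ifs <;> omega,
      fun c3 => ?_, fun c3 => ?_⟩⟩, fun c1 => ⟨by omega, fun c2 => ⟨by split_ifs <;> omega,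
      fun c3 => ?_, fun c3 => ?_⟩, fun c2 => ?_⟩⟩
    · exact ⟨hI.succ (by tauto), hI'.succ (by tauto)⟩
    · exact ⟨hI.succ (by tauto), hI'.succ (by tauto)⟩
    · exact ⟨by omega, Or.inr ⟨z, rfl, c1, c2, c3⟩, hI'.succ (by tauto)⟩
    · exact ⟨hI.succ (by tauto), hI'.succ (by tauto)⟩
    · exact ⟨by omega, hI.succ (by tauto), Or.inr ⟨z, rfl, c2, c1, c3⟩⟩
    · exact ⟨hI.succ (by tauto), hI'.succ (by tauto)⟩
  · intro t s' ht hF hI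
    exact ⟨by simp only [Expr.cost]; omega, hI⟩

/-! ### The closure of a seed -/

/-- The vertices of the two sides `1` and `2` of `sd`, which contain `a` and `b, b'`,
respectively, are listed without repetition by `q`, in each side but for `b, b'` they are mixed on
the other one, and every PH pair with `b, b'` in the second clique contains them. -/
structure Clos (G : SimpleGraph (Fin n)) (b b' a : Fin n) (sd q : ℕ → ℕ) (len : ℕ) : Prop where
  sd_le : ∀ z : Fin n, sd z ≤ 2
  sd_b : sd b = 2
  sd_b' : sd b' = 2
  sd_a : sd a = 1
  q_mem : ∀ j < len, ∃ v : Fin n, q j = v ∧ sd v ≠ 0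
  q_inj : ∀ j < len, ∀ j' < len, q j = q j' → j = j'
  q_surj : ∀ v : Fin n, sd v ≠ 0 → ∃ j < len, q j = v
  mixed₁ : ∀ z : Fin n, sd z = 1 → ∃ p p' : Fin n, sd p = 2 ∧ sd p' = 2 ∧ G.Adj z p ∧ ¬ G.Adj z p'
  mixed₂ : ∀ z : Fin n, sd z = 2 → z ≠ b → z ≠ b' →
    ∃ p p' : Fin n, sd p = 1 ∧ sd p' = 1 ∧ G.Adj z p ∧ ¬ G.Adj z p'
  minimal : ∀ K₁ K₂ : Set (Fin n), G.IsPHPair K₁ K₂ → b ∈ K₂ → b' ∈ K₂ →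
    (∀ z : Fin n, sd z = 1 → z ∈ K₁) ∧ ∀ z : Fin n, sd z = 2 → z ∈ K₂

theorem card_le_of_injective {q : ℕ → ℕ} {len : ℕ} (h1 : ∀ j < len, q j < n)
    (h2 : ∀ j < len, ∀ j' < len, q j = q j' → j = j') : len ≤ n := by
  simpa using Finset.card_le_card_of_injOn (s := Finset.range len) (t := Finset.range n) q
    (fun j hj => by simpa using h1 j (by simpa using hj))
    (fun j hj j' hj' => h2 j (by simpa using hj) j' (by simpa using hj'))

namespace Clos

variable {b b' a : Fin n} {sd q : ℕ → ℕ} {len : ℕ}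

theorem len_le (h : Clos G b b' a sd q len) : len ≤ n :=
  card_le_of_injective (fun j hj => by obtain ⟨v, hv, -⟩ := h.q_mem j hj; rw [hv]; exact v.2)
    h.q_inj

theorem update_apply (f : ℕ → ℕ) (z w : Fin n) (k : ℕ) :
    Function.update f z k w = if w = z then k else f w := by
  simp [Function.update_apply, Fin.val_inj]

/-- The reference vertex of a side. -/
def rep (b a : Fin n) (i : ℕ) : Fin n := if i = 1 then a else b

/-- The vertices that are not in the sides are not mixed on `v` and its reference vertex. -/
def Processed (G : SimpleGraph (Fin n)) (b a : Fin n) (sd : ℕ → ℕ) (v z : Fin n) : Prop :=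
  sd z = 0 → (G.Adj z v ↔ G.Adj z (rep b a (sd v)))

/-- `z` distinguishes `v` from the reference vertex, so it is mixed on the side of `v` and must lie
in every PH pair that contains the sides. It cannot join the clique around that side, where it has a
non-neighbour, so the opposite side `3 - sd v` is forced. -/
theorem push (h : Clos G b b' a sd q len) {v z : Fin n} (hv : sd v ≠ 0) (hz : sd z = 0)
    (hvz : ¬ (G.Adj z v ↔ G.Adj z (rep b a (sd v)))) :
    Clos G b b' a (Function.update sd z (3 - sd v)) (Function.update q len z) (len + 1) := by
  have hle := h.sd_le v
  have hzn : ∀ {w : Fin n}, sd w ≠ 0 → w ≠ z := fun hw e => hw (e ▸ hz)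
  have hsd : ∀ {w : Fin n}, sd w ≠ 0 → Function.update sd z (3 - sd v) w = sd w := fun hw => by
    rw [update_apply, if_neg (hzn hw)]
  have hsz : Function.update sd z (3 - sd v) z = 3 - sd v := by simp
  -- the vertices on which `z` is mixed
  obtain ⟨p, p', hp, hp', hzp, hzp'⟩ : ∃ p p' : Fin n, sd p = sd v ∧ sd p' = sd v ∧ G.Adj z p ∧
      ¬ G.Adj z p' := by
    have hr : sd (rep b a (sd v)) = sd v := by
      unfold rep; split_ifs with e
      · rw [h.sd_a, e]
      · rw [h.sd_b]; omega
    by_cases hzv : G.Adj z v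
    · exact ⟨v, _, rfl, hr, hzv, by tauto⟩
    · exact ⟨_, v, hr, rfl, by tauto, hzv⟩
  have hcases : ∀ w : Fin n, w = z ∨ w ≠ z ∧ Function.update sd z (3 - sd v) w = sd w :=
    fun w => by rw [update_apply]; by_cases e : w = z <;> simp [e]
  have up : ∀ {w : Fin n} {i : ℕ}, i ≠ 0 → sd w = i → Function.update sd z (3 - sd v) w = i :=
    fun hi hw => by rw [hsd (by omega), hw]
  have qz : ∀ j < len, q j ≠ z := fun j hj e => by
    obtain ⟨w, hw, hw'⟩ := h.q_mem j hj
    exact hzn hw' (Fin.ext (hw.symm.trans e))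
  refine ⟨fun w => ?_, up (by omega) h.sd_b, up (by omega) h.sd_b', up (by omega) h.sd_a,
    fun j hj => ?_, fun j hj j' hj' hjj => ?_, fun w hw => ?_, fun w hw => ?_,
    fun w hw hwb hwb' => ?_, fun K₁ K₂ hK hb hb' => ?_⟩
  · rcases hcases w with rfl | ⟨-, e⟩
    · rw [hsz]; omega
    · rw [e]; exact h.sd_le w
  · by_cases e : j = len
    · subst e
      exact ⟨z, by simp, by rw [hsz]; omega⟩
    · obtain ⟨w, hw, hw'⟩ := h.q_mem j (by omega)
      exact ⟨w, by rw [Function.update_of_ne e, hw], by rwa [hsd hw']⟩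
  · by_cases e : j = len <;> by_cases e' : j' = len
    · omega
    · subst e
      rw [Function.update_self, Function.update_of_ne e'] at hjj
      exact absurd hjj.symm (qz j' (by omega))
    · subst e'
      rw [Function.update_self, Function.update_of_ne e] at hjj
      exact absurd hjj (qz j (by omega))
    · rw [Function.update_of_ne e, Function.update_of_ne e'] at hjj
      exact h.q_inj j (by omega) j' (by omega) hjj
  · rcases hcases w with rfl | ⟨-, e⟩
    · exact ⟨len, by omega, by simp⟩
    · obtain ⟨j, hj, hjw⟩ := h.q_surj w (by rwa [e] at hw)
      exact ⟨j, by omega, by rw [Function.update_of_ne (by omega), hjw]⟩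
  · rcases hcases w with rfl | ⟨-, e⟩
    · rw [hsz] at hw
      exact ⟨p, p', up (by omega) (by omega), up (by omega) (by omega), hzp, hzp'⟩
    · obtain ⟨x, x', hx, hx', h1⟩ := h.mixed₁ w (by rwa [e] at hw)
      exact ⟨x, x', up (by omega) hx, up (by omega) hx', h1⟩
  · rcases hcases w with rfl | ⟨-, e⟩
    · rw [hsz] at hw
      exact ⟨p, p', up (by omega) (by omega), up (by omega) (by omega), hzp, hzp'⟩
    · obtain ⟨x, x', hx, hx', h1⟩ := h.mixed₂ w (by rwa [e] at hw) hwb hwb'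
      exact ⟨x, x', up (by omega) hx, up (by omega) hx', h1⟩
  · obtain ⟨m1, m2⟩ := h.minimal K₁ K₂ hK hb hb'
    have hpz := hzn (w := p') (by omega)
    refine ⟨fun w hw => ?_, fun w hw => ?_⟩
    · rcases hcases w with rfl | ⟨-, e⟩
      · rw [hsz] at hw
        have q1 := m2 p (by omega)
        have q2 := m2 p' (by omega)
        exact (hK.2.2.mem_of_mixed q1 q2 hzp hzp').resolve_right fun h' =>
          hzp' (hK.symm.clique h' q2 hpz.symm)
      · exact m1 w (by rwa [e] at hw)
    · rcases hcases w with rfl | ⟨-, e⟩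
      · rw [hsz] at hw
        have q1 := m1 p (by omega)
        have q2 := m1 p' (by omega)
        exact (hK.symm.2.2.mem_of_mixed q1 q2 hzp hzp').resolve_right fun h' =>
          hzp' (hK.clique h' q2 hpz.symm)
      · exact m2 w (by rwa [e] at hw)

/-- The condition concerns outside vertices only, so it persists when the sides grow. Each listed
vertex therefore needs to be scanned once. -/
theorem processed_push {v z w x : Fin n} (hw : sd w ≠ 0) (hz : sd z = 0)
    (hv2 : sd v ≤ 2)
    (h : Processed G b a sd w x) : Processed G b a (Function.update sd z (3 - sd v)) w x := by
  intro hx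
  rw [update_apply] at hx
  rw [update_apply, if_neg (by rintro rfl; exact hw hz)]
  split_ifs at hx with e
  · omega
  · exact h hx

/-- The PH pair spanned by a closure whose sides are cliques. -/
theorem isPHPair (h : Clos G b b' a sd q len) (hP : ∀ v z : Fin n, sd v ≠ 0 →
      Processed G b a sd v z)
    (hc : ∀ u v : Fin n, sd u ≠ 0 → sd u = sd v → u ≠ v → G.Adj u v)
    (hab : G.Adj a b) (hab' : ¬ G.Adj a b') {a' : Fin n} (ha'b' : G.Adj a' b')
    (ha'b : ¬ G.Adj a' b) (hne : a' ≠ b) :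
    G.IsPHPair {z | sd z = 1} {z | sd z = 2} ∧ sd a' = 1 := by
  -- `a'` distinguishes `b'` from `b`, so it is not outside; the second side is a clique containing
  -- `b`, so it is not there either. Together with `a` it makes `b` and `b'` proper to the first
  -- side.
  have ha' : sd a' = 1 := by
    have := h.sd_le a'
    rcases (by omega : sd a' = 0 ∨ sd a' = 1 ∨ sd a' = 2) with e | e | e
    · have := (hP b' a' (by rw [h.sd_b']; omega) e).1 ha'b'
      rw [rep, h.sd_b', if_neg (by omega)] at this
      exact absurd this ha'b
    · exact e
    · exact absurd (hc a' b (by omega) (by rw [e, h.sd_b]) hne) ha'b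
  refine ⟨⟨⟨fun u hu v hv huv => hc u v ?_ ?_ huv, fun u hu v hv huv => hc u v ?_ ?_ huv,
    ⟨a, h.sd_a⟩, ⟨b, h.sd_b⟩, ?_⟩, ⟨fun u hu => ?_, fun u hu => ?_⟩, fun z hz => ?_⟩, ha'⟩
  any_goals simp only [Set.mem_ofPred_eq] at *; omega
  · rw [Set.disjoint_left]
    intro x hx hy
    simp only [Set.mem_ofPred_eq] at hx hy
    omega
  · obtain ⟨p, p', hp, hp', h1, h2⟩ := h.mixed₁ u hu
    exact ⟨fun h' => h2 (h' p' hp'), fun h' => h' p hp h1⟩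
  · by_cases e : u = b
    · subst e
      exact ⟨fun h' => ha'b (h' a' ha').symm, fun h' => h' a h.sd_a hab.symm⟩
    by_cases e : u = b'
    · subst e
      exact ⟨fun h' => hab' (h' a h.sd_a).symm, fun h' => h' a' ha' ha'b'.symm⟩
    obtain ⟨p, p', hp, hp', h1, h2⟩ := h.mixed₂ u hu (by assumption) e
    exact ⟨fun h' => h2 (h' p' hp'), fun h' => h' p hp h1⟩
  · have hz0 : sd z = 0 := by
      have := h.sd_le z
      simp only [Set.mem_union, Set.mem_ofPred_eq] at hz
      omega
    have key : ∀ i, i ≠ 0 → G.CompleteTo z {w : Fin n | sd w = i} ∨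
        G.AnticompleteTo z {w : Fin n | sd w = i} := by
      intro i hi
      by_cases hr : G.Adj z (rep b a i)
      · refine Or.inl fun w hw => ?_
        obtain rfl : sd w = i := hw
        exact (hP w z hi hz0).2 hr
      · refine Or.inr fun w hw => ?_
        obtain rfl : sd w = i := hw
        exact fun h' => hr ((hP w z hi hz0).1 h')
    exact ⟨key 1 (by omega), key 2 (by omega)⟩

end Clos

end WordRAM


/-! ### Programs for the closure and for the clique test -/

set_option linter.unusedSimpArgs false

namespace WordRAM

variable {n W : ℕ} {G : SimpleGraph (Fin n)}

theorem Ample.succ_lt (h : Ample n W) : n + 1 < W := by unfold Ample at h; omega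

/-- Push the vertices outside the two sides which distinguish `reg 8` from `reg 9`. -/
def scanProg : Prog :=
  .for 5 0 (.cond (.get 3 (.reg 5)) .skip
    (.cond (.bin .eq (.adj 5 8) (.adj 5 9)) .skip
      (.write 3 (.reg 5) (.bin .sub (.lit 3) (.get 3 (.reg 8))) ;;
        .write 4 (.reg 6) (.reg 5) ;; 6 <~ .bin .add (.reg 6) (.lit 1))))

theorem scanProg_spec (hW : Ample n W) {s : Store} (hA : Mat G (s.arr 0)) {b b' a v : Fin n}
    {i : ℕ} (h0 : s.reg 0 = n) (h8 : s.reg 8 = v)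
    (h9 : s.reg 9 = Clos.rep b a (s.arr 3 v)) (hC : Clos G b b' a (s.arr 3) (s.arr 4) (s.reg 6))
    (hv : s.arr 3 v ≠ 0) (hi : i < s.reg 6) (hqi : s.arr 4 i = v)
    (hP : ∀ j < i, ∀ w : Fin n, s.arr 4 j = w → ∀ z, Clos.Processed G b a (s.arr 3) w z) :
    WP W scanProg s fun t s' => t ≤ n * 60 + 6 ∧
      Clos G b b' a (s'.arr 3) (s'.arr 4) (s'.reg 6) ∧ i < s'.reg 6 ∧
      ∀ j < i + 1, ∀ w : Fin n, s'.arr 4 j = w → ∀ z, Clos.Processed G b a (s'.arr 3) w z := by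
  have hW' := hW
  unfold Ample at hW
  have one_lt : 1 < W := by omega
  refine WP.for (n := n) (T := 52) (I := fun k s' =>
      Clos G b b' a (s'.arr 3) (s'.arr 4) (s'.reg 6) ∧ s'.arr 3 v = s.arr 3 v ∧ i < s'.reg 6 ∧
      s'.arr 4 i = v ∧
      (∀ j < i, ∀ w : Fin n, s'.arr 4 j = w → ∀ z, Clos.Processed G b a (s'.arr 3) w z) ∧
      ∀ z : Fin n, z < k → Clos.Processed G b a (s'.arr 3) v z)
    (by decide) rfl rfl h0 hW'.succ_lt
    ⟨by simpa using hC, by simp, by simpa using hi, by simpa using hqi, by simpa using hP, by simp⟩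
    ?_ ?_
  · rintro z s' hz hF ⟨I1, I2, I3, I4, I5, I6⟩
    have e0 : s'.reg 0 = n := by simpa [h0] using hF.1 0 rfl
    have e8 : s'.reg 8 = v := by simpa [h8] using hF.1 8 rfl
    have e9 : s'.reg 9 = Clos.rep b a (s'.arr 3 v) := by simpa [h9, I2] using hF.1 9 rfl
    have eA : s'.arr 0 = s.arr 0 := hF.2 0 rfl
    have i1 := index_lt z v
    have i2 := index_lt z (Clos.rep b a (s'.arr 3 v))
    have := adjEntry_le (G := G) z v
    have := adjEntry_le (G := G) z (Clos.rep b a (s'.arr 3 v))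
    have := I1.sd_le z
    have := I1.sd_le v
    have := I1.len_le
    have i3 : (Clos.rep b a (s'.arr 3 v) : ℕ) < n := (Clos.rep b a (s'.arr 3 v)).2
    have step : ∀ {sd : ℕ → ℕ}, (∀ z' : Fin n, z' < z → Clos.Processed G b a sd v z') →
        Clos.Processed G b a sd v z → ∀ z' : Fin n, z' < (z + 1 : ℕ) →
        Clos.Processed G b a sd v z' := by
      intro sd h1 h2 z' hz'
      by_cases e : z' = z
      · rwa [e]
      · exact h1 z' (by have : (z' : ℕ) ≠ z := fun e' => e (Fin.ext e'); omega)
    simp only [wp_cond, wp_skip, wp_assign, wp_seq, wp_write, Expr.Fits, Expr.eval, Op.add_apply, Op.sub_apply,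
      Op.mul_apply, Op.eq_eq_zero, Op.lt_eq_zero, Op.eq_fits one_lt, Op.lt_fits one_lt, and_true, hz,
      e0, e8, e9, eA, hA z _, Expr.cost, setReg_reg, setReg_arr, setArr_reg, setArr_arr, ne_eq,
      Nat.reduceEqDiff, reduceIte, Nat.reduceAdd, Nat.reduceLeDiff, true_and, adjEntry_eq,
      not_not]
    refine ⟨by omega, fun c1 => ⟨I1, I2, I3, I4, I5, step I6 fun c => absurd c c1⟩, fun c1 =>
      ⟨by omega, fun c2 => ⟨I1, I2, I3, I4, I5,
        step I6 fun _ => c2⟩, fun c2 => ?_⟩⟩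
    have hvz : v ≠ z := by rintro rfl; exact hv (I2 ▸ c1)
    have hI := I1.push (I2 ▸ hv) c1 c2
    have hlen := hI.len_le
    have e5 : Function.update (s'.arr 3) (↑z) (3 - s'.arr 3 v) v = s.arr 3 v := by
      rw [Clos.update_apply, if_neg hvz, I2]
    have e6 : ∀ j < s'.reg 6, Function.update (s'.arr 4) (s'.reg 6) (↑z) j = s'.arr 4 j :=
      fun j hj => Function.update_of_ne (by omega) _ _
    refine ⟨by omega, by omega, by omega, hI, e5, by omega, by rw [e6 i I3, I4], ?_, ?_⟩
    · intro j hj w hw z'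
      rw [e6 j (by omega)] at hw
      obtain ⟨w', hw', hsw⟩ := I1.q_mem j (by omega)
      obtain rfl : w = w' := Fin.ext (hw.symm.trans hw')
      exact Clos.processed_push hsw c1 (by omega) (I5 j hj w hw z')
    -- For `z` itself the condition is now vacuous, as `z` has entered a side.
    · refine step (fun z' hz' => Clos.processed_push (I2 ▸ hv) c1 (by omega) (I6 z' hz')) ?_
      intro hsz
      rw [Function.update_self] at hsz
      omega
  · rintro t s' ht hF ⟨I1, I2, I3, I4, I5, I6⟩
    refine ⟨by omega, I1, I3, fun j hj w hw z => ?_⟩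
    by_cases e : j = i
    · subst e
      obtain rfl : w = v := Fin.ext (hw.symm.trans I4)
      exact I6 z z.2
    · exact I5 j (by omega) w hw z

/-- Initialise the closure of `b = reg 1`, `b' = reg 2`, `a = reg 3`. -/
def closInit : Prog :=
  .for 5 0 (.write 3 (.reg 5) (.lit 0)) ;;
  .write 3 (.reg 1) (.lit 2) ;; .write 3 (.reg 2) (.lit 2) ;; .write 3 (.reg 3) (.lit 1) ;;
  .write 4 (.lit 0) (.reg 1) ;; .write 4 (.lit 1) (.reg 2) ;; .write 4 (.lit 2) (.reg 3) ;;
  6 <~ .lit 3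

theorem clos_init {b b' a : Fin n} (hbb' : b ≠ b') (hab : G.Adj a b) (hab' : ¬ G.Adj a b')
    (hne : a ≠ b') {f q : ℕ → ℕ} (hf : ∀ z : Fin n, f z = 0) :
    Clos G b b' a (Function.update (Function.update (Function.update f b 2) b' 2) a 1)
      (Function.update (Function.update (Function.update q 0 b) 1 b') 2 a) 3 := by
  have hab0 := hab.ne
  have e : ∀ w : Fin n, Function.update (Function.update (Function.update f b 2) b' 2) a 1 w =
      if w = a then 1 else if w = b' then 2 else if w = b then 2 else 0 := by
    intro w; simp only [Clos.update_apply, hf]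
  have vb : (b : ℕ) ≠ b' := fun e => hbb' (Fin.ext e)
  have va : (a : ℕ) ≠ b' := fun e => hne (Fin.ext e)
  have vab : (a : ℕ) ≠ b := fun e => hab0 (Fin.ext e)
  have q0 : Function.update (Function.update (Function.update q 0 b) 1 b') 2 a 0 = b := by simp
  have q1 : Function.update (Function.update (Function.update q 0 b) 1 b') 2 a 1 = b' := by simp
  have q2 : Function.update (Function.update (Function.update q 0 b) 1 b') 2 a 2 = a := by simp
  refine ⟨fun w => ?_, ?_, ?_, ?_, fun j hj => ?_, fun j hj j' hj' hjj => ?_, fun w hw => ?_,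
    fun w hw => ?_, fun w hw h1 h2 => ?_, fun K₁ K₂ hK hb hb' => ⟨fun w hw => ?_, fun w hw => ?_⟩⟩
  · rw [e]; split_ifs <;> omega
  · simp [e, hab0.symm]
  · simp [e, hne.symm]
  · simp [e]
  · rcases (by omega : j = 0 ∨ j = 1 ∨ j = 2) with rfl | rfl | rfl
    · exact ⟨b, q0, by simp [e, hab0.symm]⟩
    · exact ⟨b', q1, by simp [e, hne.symm]⟩
    · exact ⟨a, q2, by simp [e]⟩
  · rcases (by omega : j = 0 ∨ j = 1 ∨ j = 2) with rfl | rfl | rfl <;>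
    rcases (by omega : j' = 0 ∨ j' = 1 ∨ j' = 2) with rfl | rfl | rfl <;>
    simp only [q0, q1, q2] at hjj <;> omega
  · rw [e] at hw
    by_cases h1 : w = a
    · exact ⟨2, by omega, by rw [q2, h1]⟩
    by_cases h2 : w = b'
    · exact ⟨1, by omega, by rw [q1, h2]⟩
    by_cases h3 : w = b
    · exact ⟨0, by omega, by rw [q0, h3]⟩
    simp [h1, h2, h3] at hw
  · rw [e] at hw
    have : w = a := by
      by_contra h1
      rw [if_neg h1] at hw
      split_ifs at hw <;> omega
    subst this
    exact ⟨b, b', by simp [e, hab0.symm], by simp [e, hne.symm], hab, hab'⟩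
  · rw [e] at hw
    split_ifs at hw <;> omega
  · rw [e] at hw
    have : w = a := by
      by_contra h1
      rw [if_neg h1] at hw
      split_ifs at hw <;> omega
    subst this
    -- `a` is mixed on `K₂` and, having the non-neighbour `b'` there, is not in `K₂`. So `a` lies in
    -- `K₁` whichever private neighbour the search returned.
    exact (hK.2.2.mem_of_mixed hb hb' hab hab').resolve_right fun h' => hab' (hK.symm.clique h' hb' hne)
  · rw [e] at hw
    split_ifs at hw with h1 h2 h3
    · omega
    · exact h2 ▸ hb'
    · exact h3 ▸ hb

theorem closInit_spec (hW : Ample n W) {s : Store} {b b' a : Fin n} (h0 : s.reg 0 = n)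
    (h1 : s.reg 1 = b) (h2 : s.reg 2 = b') (h3 : s.reg 3 = a) (hbb' : b ≠ b') (hab : G.Adj a b)
    (hab' : ¬ G.Adj a b') (hne : a ≠ b') :
    WP W closInit s fun t s' => t ≤ n * 11 + 40 ∧
      Clos G b b' a (s'.arr 3) (s'.arr 4) (s'.reg 6) := by
  have hW' := hW
  unfold Ample at hW
  have one_lt : 1 < W := by omega
  rw [closInit, wp_seq]
  refine WP.for (n := n) (T := 3) (I := fun k s' => ∀ z : Fin n, z < k → s'.arr 3 z = 0)
    (by decide) rfl rfl h0 hW'.succ_lt (by simp) ?_ ?_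
  · intro z s' hz hF hI
    simp only [wp_write, Expr.Fits, Expr.eval, Expr.cost, hz, setReg_arr, setArr_arr, reduceIte,
      Nat.reduceAdd, Nat.reduceLeDiff, true_and]
    refine ⟨by omega, fun w hw => ?_⟩
    rw [Clos.update_apply]
    split_ifs with e
    · rfl
    · exact hI w (by have : (w : ℕ) ≠ z := fun e' => e (Fin.ext e'); omega)
  · intro t s' ht hF hI
    have e1 : s'.reg 1 = b := by simpa [h1] using hF.1 1 rfl
    have e2 : s'.reg 2 = b' := by simpa [h2] using hF.1 2 rfl
    have e3 : s'.reg 3 = a := by simpa [h3] using hF.1 3 rfl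
    simp only [wp_assign, wp_seq, wp_write, Expr.Fits, Expr.eval, e1, e2, e3, Expr.cost, setReg_reg,
      setReg_arr, setArr_reg, setArr_arr, Nat.reduceEqDiff, reduceIte, Nat.reduceAdd]
    have key := clos_init (q := s'.arr 4) hbb' hab hab' hne (fun z => hI z z.2)
    refine ⟨by omega, by omega, by omega, by omega, by omega, by omega, by omega, by omega, key⟩

/-- The closure of `b = reg 1`, `b' = reg 2`, `a = reg 3`, in arrays `3` and `4`. -/
def closProg : Prog :=
  closInit ;;
  .for 7 0 (.cond (.bin .lt (.reg 7) (.reg 6))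
    (8 <~ .get 4 (.reg 7) ;;
      .cond (.bin .eq (.get 3 (.reg 8)) (.lit 1)) (9 <~ .reg 3) (9 <~ .reg 1) ;;
      scanProg) .skip)

/-- The queue grows during the loop, but it never holds more than `n` vertices. So `n` rounds, idle
once the queue is exhausted, process every vertex of the sides. -/
theorem closProg_spec (hW : Ample n W) {s : Store} (hA : Mat G (s.arr 0)) {b b' a : Fin n}
    (h0 : s.reg 0 = n) (h1 : s.reg 1 = b) (h2 : s.reg 2 = b') (h3 : s.reg 3 = a) (hbb' : b ≠ b')
    (hab : G.Adj a b) (hab' : ¬ G.Adj a b') (hne : a ≠ b') :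
    WP W closProg s fun t s' => t ≤ 100 * (n + 1) * (n + 1) ∧
      Clos G b b' a (s'.arr 3) (s'.arr 4) (s'.reg 6) ∧
      ∀ v z : Fin n, s'.arr 3 v ≠ 0 → Clos.Processed G b a (s'.arr 3) v z := by
  refine WP.seq ((closInit_spec hW h0 h1 h2 h3 hbb' hab hab' hne).mono ?_)
  rintro t1 s1 hF1 ⟨ht1, hC1⟩
  have f0 : s1.reg 0 = n := by simpa [h0] using hF1.1 0 rfl
  have f1 : s1.reg 1 = b := by simpa [h1] using hF1.1 1 rfl
  have f3 : s1.reg 3 = a := by simpa [h3] using hF1.1 3 rfl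
  have fA : s1.arr 0 = s.arr 0 := hF1.2 0 rfl
  refine WP.for (n := n) (T := n * 60 + 40) (I := fun k s' =>
      Clos G b b' a (s'.arr 3) (s'.arr 4) (s'.reg 6) ∧ ∀ j < k, j < s'.reg 6 → ∀ w : Fin n,
        s'.arr 4 j = w → ∀ z, Clos.Processed G b a (s'.arr 3) w z)
    (by decide) rfl rfl f0 hW.succ_lt (by simpa using hC1) ?_ ?_
  · rintro z s' hz hF ⟨I1, I2⟩
    have e0 : s'.reg 0 = n := by simpa [f0] using hF.1 0 rfl
    have e1 : s'.reg 1 = b := by simpa [f1] using hF.1 1 rfl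
    have e3 : s'.reg 3 = a := by simpa [f3] using hF.1 3 rfl
    have eA : s'.arr 0 = s.arr 0 := by simpa [fA] using hF.2 0 rfl
    have := I1.len_le
    have hW' := hW
    unfold Ample at hW'
    have one_lt : 1 < W := by omega
    rw [wp_cond]
    simp only [Expr.Fits, Expr.eval, Op.add_apply, Op.sub_apply,
      Op.mul_apply, Op.eq_eq_zero, Op.lt_eq_zero, Op.eq_fits one_lt, Op.lt_fits one_lt, and_true, hz, Expr.cost, ne_eq, not_not]
    refine ⟨by omega, fun c => ?_, fun c => ?_⟩
    · obtain ⟨v, hv, hv'⟩ := I1.q_mem z c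
      have := I1.sd_le v
      rw [wp_seq, wp_assign]
      simp only [Expr.Fits, Expr.eval, hz, hv, Expr.cost]
      refine ⟨by omega, ?_⟩
      rw [wp_seq, wp_cond]
      simp only [Expr.Fits, Expr.eval, Op.add_apply, Op.sub_apply,
      Op.mul_apply, Op.eq_eq_zero, Op.lt_eq_zero, Op.eq_fits one_lt, Op.lt_fits one_lt, and_true, Expr.cost, ne_eq, not_not, wp_assign, setReg_reg, setReg_arr, e1, e3, Nat.reduceEqDiff, reduceIte,
        Nat.reduceAdd]
      refine ⟨by omega, fun c2 => ⟨by omega, ?_⟩,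
        fun c2 => ⟨by omega, ?_⟩⟩
      all_goals
        refine (scanProg_spec (G := G) (b := b) (b' := b') (a := a) (v := v) (i := z) hW ?_ ?_ ?_ ?_ ?_ ?_ ?_ ?_ ?_).mono ?_
        · simpa [eA] using hA
        · simpa using e0
        · simp
        · simp [Clos.rep, c2]
        · simpa using I1
        · simpa using hv'
        · simpa using c
        · simpa using hv
        · simp only [setReg_arr]
          exact fun j hj => I2 j hj (by omega)
        · rintro t s'' hF2 ⟨g1, g2, g3, g4⟩
          exact ⟨by omega, by simpa using g2, fun j hj _ => by simpa using g4 j hj⟩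
    · rw [wp_skip]
      exact ⟨by omega, by simpa using I1, fun j hj hj' => I2 j (by simp at hj'; omega)
        (by simpa using hj')⟩
  · rintro t s' ht hF ⟨I1, I2⟩
    refine ⟨?_, I1, fun v z hv => ?_⟩
    · have : n * (n * 60 + 40 + 8) = 60 * (n * n) + 48 * n := by ring
      have : 100 * (n + 1) * (n + 1) = 100 * (n * n) + 200 * n + 100 := by ring
      omega
    · obtain ⟨j, hj, hjv⟩ := I1.q_surj v hv
      exact I2 j (by have := I1.len_le; omega) hj v hjv z

/-- Are the two sides cliques? -/
def checkProg : Prog :=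
  10 <~ .lit 1 ;;
  .for 11 0 (.for 5 0 (.cond (.get 3 (.reg 11))
    (.cond (.bin .eq (.get 3 (.reg 11)) (.get 3 (.reg 5)))
      (.cond (.bin .eq (.reg 11) (.reg 5)) .skip
        (.cond (.adj 11 5) .skip (10 <~ .lit 0))) .skip) .skip))

/-- The vertices `u` and `v` do not show that some side is not a clique. -/
def Fine (G : SimpleGraph (Fin n)) (sd : ℕ → ℕ) (u v : Fin n) : Prop :=
  sd u ≠ 0 → sd u = sd v → u ≠ v → G.Adj u v

theorem checkProg_spec (hW : Ample n W) {s : Store} (hA : Mat G (s.arr 0)) (h0 : s.reg 0 = n)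
    (hs : ∀ z : Fin n, s.arr 3 z ≤ 2) :
    WP W checkProg s fun t s' => t ≤ 100 * (n + 1) * (n + 1) ∧
      (s'.reg 10 ≠ 0 → ∀ u v, Fine G (s.arr 3) u v) ∧
      (s'.reg 10 = 0 → ∃ u v, ¬ Fine G (s.arr 3) u v) ∧ s'.reg 10 ≤ 1 := by
  have hW' := hW
  unfold Ample at hW'
  have one_lt : 1 < W := by omega
  rw [checkProg, wp_seq, wp_assign]
  refine ⟨by simp only [Expr.Fits]; omega, ?_⟩
  refine WP.for (n := n) (T := n * 58 + 6) (I := fun k s' =>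
      (s'.reg 10 ≠ 0 → ∀ u v : Fin n, u < k → Fine G (s.arr 3) u v) ∧
      (s'.reg 10 = 0 → ∃ u v, ¬ Fine G (s.arr 3) u v) ∧ s'.reg 10 ≤ 1)
    (by decide) rfl rfl (by simp [h0]) hW.succ_lt (by simp [Expr.eval]) ?_ ?_
  · rintro u s1 hu hF1 ⟨I1, I2, I3⟩
    have f0 : s1.reg 0 = n := by simpa [h0] using hF1.1 0 rfl
    have f3 : s1.arr 3 = s.arr 3 := by simpa using hF1.2 3 rfl
    have fA : s1.arr 0 = s.arr 0 := by simpa using hF1.2 0 rfl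
    refine WP.for (n := n) (T := 50) (I := fun k s' =>
      (s'.reg 10 ≠ 0 → s1.reg 10 ≠ 0 ∧ ∀ v : Fin n, v < k → Fine G (s.arr 3) u v) ∧
      (s'.reg 10 = 0 → ∃ u v, ¬ Fine G (s.arr 3) u v) ∧ s'.reg 10 ≤ 1)
      (by decide) rfl rfl f0 hW.succ_lt (by simpa using ⟨I2, I3⟩) ?_ ?_
    · rintro v s' hv hF ⟨J1, J2, J3⟩
      have e0 : s'.reg 0 = n := by simpa [f0] using hF.1 0 rfl
      have e11 : s'.reg 11 = u := by simpa [hu] using hF.1 11 rfl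
      have e3 : s'.arr 3 = s.arr 3 := by simpa [f3] using hF.2 3 rfl
      have eA : s'.arr 0 = s.arr 0 := by simpa [fA] using hF.2 0 rfl
      have i1 := index_lt u v
      have := adjEntry_le (G := G) u v
      have := hs u
      have := hs v
      have step : Fine G (s.arr 3) u v →
          (s'.reg 10 ≠ 0 → s1.reg 10 ≠ 0 ∧ ∀ w : Fin n, w < (v + 1 : ℕ) → Fine G (s.arr 3) u w) ∧
          (s'.reg 10 = 0 → ∃ u v, ¬ Fine G (s.arr 3) u v) ∧ s'.reg 10 ≤ 1 := by
        refine fun hf => ⟨fun h => ⟨(J1 h).1, fun w hw => ?_⟩, J2, J3⟩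
        by_cases e : w = v
        · rwa [e]
        · exact (J1 h).2 w (by have : (w : ℕ) ≠ v := fun e' => e (Fin.ext e'); omega)
      simp only [wp_cond, wp_skip, wp_assign, Expr.Fits, Expr.eval, Op.add_apply, Op.sub_apply,
      Op.mul_apply, Op.eq_eq_zero, Op.lt_eq_zero, Op.eq_fits one_lt, Op.lt_fits one_lt, and_true, hv, e11,
        e0, e3, eA, hA u _, Expr.cost, setReg_reg, ne_eq,
        Nat.reduceEqDiff, reduceIte, Nat.reduceAdd, Nat.reduceLeDiff, true_and, adjEntry_eq_zero,
        not_not, Fin.val_inj]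
      refine ⟨by omega, fun c1 => ⟨by omega,
        fun c2 => ⟨by omega, fun c3 => ?_,
          fun c3 => ⟨by omega, fun c4 => ?_, fun c4 => ?_⟩⟩, fun c2 => ?_⟩, fun c1 => ?_⟩
      · exact step fun _ _ h => absurd c3 h
      · exact step fun _ _ _ => c4
      · exact ⟨by omega, by simp, fun _ => ⟨u, v, fun h => c4 (h c1 c2 c3)⟩⟩
      · exact step fun _ h => absurd h c2
      · exact step fun h => absurd c1 h
    · rintro t s' ht hF ⟨J1, J2, J3⟩
      refine ⟨by omega, ?_, by simpa using J2, by simpa using J3⟩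
      simp only [setReg_reg, Nat.reduceEqDiff, reduceIte]
      intro h u' v' hu'
      by_cases e : u' = u
      · rw [e]; exact (J1 h).2 v' v'.2
      · exact I1 (J1 h).1 u' v' (by have : (u' : ℕ) ≠ u := fun e' => e (Fin.ext e'); omega)
  · rintro t s' ht hF ⟨I1, I2, I3⟩
    refine ⟨?_, fun h u v => I1 h u v u.2, I2, I3⟩
    have : n * (n * 58 + 6 + 8) = 58 * (n * n) + 14 * n := by ring
    have : 100 * (n + 1) * (n + 1) = 100 * (n * n) + 200 * n + 100 := by ring
    simp only [Expr.cost]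
    omega

end WordRAM


/-! ### Matchings of non-adjacent pairs and augmenting paths -/

namespace WordRAM

open Finset

variable {n W : ℕ} {G : SimpleGraph (Fin n)} {sd mt q par : ℕ → ℕ} {len fnd : ℕ}

/-! ### Matchings -/

/-- Match `u` and `v`. -/
def join (mt : ℕ → ℕ) (u v : Fin n) : ℕ → ℕ :=
  Function.update (Function.update mt u (v + 1)) v (u + 1)

theorem mateCard_le : mateCard n mt ≤ n :=
  (card_le_univ _).trans_eq (Fintype.card_fin n)

theorem join_apply (u v w : Fin n) :
    join mt u v w = if w = v then (u + 1 : ℕ) else if w = u then (v + 1 : ℕ) else mt w := by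
  simp only [join, Clos.update_apply]

theorem IsMate.join (h : IsMate G sd mt) {u v : Fin n} (hu : mt u = 0) (hv : mt v = 0)
    (hsu : sd u = 1) (hsv : sd v = 2) (huv : ¬ G.Adj u v) : IsMate G sd (join mt u v) := by
  have hne : u ≠ v := by rintro rfl; omega
  intro z hz
  rw [join_apply] at hz ⊢
  by_cases e1 : z = v
  · subst e1
    refine ⟨u, by simp, by rw [join_apply, if_neg hne, if_pos rfl], Or.inr ⟨hsv, hsu⟩,
      fun h' => huv h'.symm⟩
  by_cases e2 : z = u
  · subst e2
    exact ⟨v, by simp [e1], by simp [join_apply], Or.inl ⟨hsu, hsv⟩, huv⟩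
  · simp only [e1, e2, if_false] at hz ⊢
    obtain ⟨w, h1, h2, h3⟩ := h z hz
    refine ⟨w, h1, ?_, h3⟩
    rw [join_apply, if_neg (by rintro rfl; omega), if_neg (by rintro rfl; omega), h2]

theorem mateCard_join {u v : Fin n} (hu : mt u = 0) (hv : mt v = 0) (hne : u ≠ v) :
    mateCard n (join mt u v) = mateCard n mt + 2 := by
  have : ({z : Fin n | join mt u v z ≠ 0} : Finset (Fin n)) =
      insert u (insert v ({z : Fin n | mt z ≠ 0} : Finset (Fin n))) := by
    ext z
    simp only [mem_filter, mem_univ, true_and, mem_insert, join_apply]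
    by_cases e1 : z = v
    · simp [e1]
    by_cases e2 : z = u
    · subst e2; simp [hne]
    · simp [e1, e2]
  rw [mateCard, this, card_insert_of_notMem (by simp [hu, hne]),
    card_insert_of_notMem (by simp [hv]), mateCard]

/-- Unmatch `u` and `v`. -/
def part (mt : ℕ → ℕ) (u v : Fin n) : ℕ → ℕ :=
  Function.update (Function.update mt u 0) v 0

theorem part_apply (u v w : Fin n) :
    part mt u v w = if w = v then 0 else if w = u then 0 else mt w := by
  simp only [part, Clos.update_apply]

theorem IsMate.part (h : IsMate G sd mt) {u v : Fin n} (hu : mt u = v + 1) (hv : mt v = u + 1) :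
    IsMate G sd (part mt u v) := by
  intro z hz
  rw [part_apply] at hz ⊢
  by_cases e1 : z = v
  · simp [e1] at hz
  by_cases e2 : z = u
  · simp [e2] at hz
  simp only [e1, e2, if_false] at hz ⊢
  obtain ⟨w, h1, h2, h3⟩ := h z hz
  have hzu : (z : ℕ) ≠ u := fun e => e2 (Fin.ext e)
  have hzv : (z : ℕ) ≠ v := fun e => e1 (Fin.ext e)
  refine ⟨w, h1, ?_, h3⟩
  rw [part_apply, if_neg (by rintro rfl; omega), if_neg (by rintro rfl; omega), h2]

theorem mateCard_part {u v : Fin n} (hu : mt u ≠ 0) (hv : mt v ≠ 0) (hne : u ≠ v) :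
    mateCard n (part mt u v) + 2 = mateCard n mt := by
  have : ({z : Fin n | mt z ≠ 0} : Finset (Fin n)) =
      insert u (insert v ({z : Fin n | part mt u v z ≠ 0} : Finset (Fin n))) := by
    ext z
    simp only [mem_filter, mem_univ, true_and, mem_insert, part_apply]
    by_cases e1 : z = v
    · simp [e1, hv]
    by_cases e2 : z = u
    · simp [e2, hu]
    · simp [e1, e2]
  rw [mateCard, mateCard, this, card_insert_of_notMem (by simp [part_apply, hne]),
    card_insert_of_notMem (by simp [part_apply])]

/-- Rematching `u` from `v'` to `v`. -/
theorem IsMate.rematch (h : IsMate G sd mt) {u v v' : Fin n} (hu : mt u = v' + 1) (hv : mt v = 0)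
    (hsu : sd u = 1) (hsv : sd v = 2) (huv : ¬ G.Adj u v) :
    IsMate G sd (Function.update (WordRAM.join mt u v) v' 0) ∧
      mateCard n (Function.update (WordRAM.join mt u v) v' 0) = mateCard n mt := by
  obtain ⟨w, h1, h2, h3, -⟩ := h u (by omega)
  obtain rfl : w = v' := Fin.ext (by omega)
  have huw : u ≠ w := by rintro rfl; omega
  have hvw : v ≠ w := by rintro rfl; omega
  have huv' : u ≠ v := by rintro rfl; omega
  -- Writing the new pair first and then clearing the old partner has the same effect as parting the
  -- old pair before joining the new one.
  have e : Function.update (WordRAM.join mt u v) w 0 =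
      WordRAM.join (WordRAM.part mt u w) u v := by
    have f1 : (u : ℕ) ≠ w := fun e => huw (Fin.ext e)
    have f2 : (v : ℕ) ≠ w := fun e => hvw (Fin.ext e)
    have f3 : (u : ℕ) ≠ v := fun e => huv' (Fin.ext e)
    funext x
    simp only [WordRAM.join, WordRAM.part, Function.update_apply]
    split_ifs <;> omega
  have hp := h.part hu h2
  have p1 : WordRAM.part mt u w u = 0 := by rw [part_apply]; simp
  have p2 : WordRAM.part mt u w v = 0 := by rw [part_apply]; simp [hv]
  rw [e]
  refine ⟨hp.join p1 p2 hsu hsv huv, ?_⟩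
  rw [mateCard_join p1 p2 huv', mateCard_part (by omega) (by omega) huw]

/-- The state of the search for an augmenting path: `q` lists the vertices of the first class
that are reached by alternating paths from its unmatched vertices, and `par v` is the predecessor
(plus one) of a reached vertex `v` of the second class. -/
structure Search (G : SimpleGraph (Fin n)) (sd mt q par : ℕ → ℕ) (len fnd : ℕ) : Prop where
  q_mem : ∀ j < len, ∃ u : Fin n, q j = u ∧ sd u = 1
  q_inj : ∀ j < len, ∀ j' < len, q j = q j' → j = j'
  root : ∀ u : Fin n, sd u = 1 → mt u = 0 → ∃ j < len, q j = u
  par_spec : ∀ v : Fin n, par v ≠ 0 → sd v = 2 ∧ ∃ j < len, ∃ u : Fin n, par v = u + 1 ∧ q j = u ∧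
    ¬ G.Adj u v ∧ (mt v ≠ 0 → ∃ j' < len, j < j' ∧ q j' + 1 = mt v)
  q_par : ∀ j < len, ∀ u w : Fin n, q j = u → mt u = w + 1 → par w ≠ 0
  fnd_zero : fnd = 0 → ∀ v : Fin n, par v ≠ 0 → mt v ≠ 0
  fnd_ne : fnd ≠ 0 → ∃ v : Fin n, fnd = v + 1 ∧ par v ≠ 0 ∧ mt v = 0

/-- All non-neighbours in the second class of the first `i` listed vertices are reached. -/
def Scanned (G : SimpleGraph (Fin n)) (sd q par : ℕ → ℕ) (len i : ℕ) : Prop :=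
  ∀ j < i, j < len → ∀ u : Fin n, q j = u → ∀ v : Fin n, sd v = 2 → ¬ G.Adj u v → par v ≠ 0

namespace Search

theorem len_le (h : Search G sd mt q par len fnd) : len ≤ n :=
  card_le_of_injective (fun j hj => by obtain ⟨v, hv, -⟩ := h.q_mem j hj; rw [hv]; exact v.2)
    h.q_inj

theorem found (h : Search G sd mt q par len fnd) {u v : Fin n} {j : ℕ} (hj : j < len)
    (hqj : q j = u) (hv : sd v = 2) (huv : ¬ G.Adj u v) (hmv : mt v = 0) :
    Search G sd mt q (Function.update par v (u + 1)) len (v + 1) := by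
  have e : ∀ w : Fin n, par w ≠ 0 → Function.update par v (u + 1) w ≠ 0 := fun w hw => by
    rw [Clos.update_apply]; split_ifs <;> omega
  refine ⟨h.q_mem, h.q_inj, h.root, fun w hw => ?_, fun i hi x w h1 h2 => e w (h.q_par i hi x w h1 h2),
    fun h' => by omega, fun _ => ⟨v, rfl, by simp, hmv⟩⟩
  rw [Clos.update_apply] at hw ⊢
  split_ifs at hw ⊢ with hwv
  · subst hwv
    exact ⟨hv, j, hj, u, rfl, hqj, huv, fun h' => absurd hmv h'⟩
  · exact h.par_spec w hw

theorem visit (h : Search G sd mt q par len fnd) (hm : IsMate G sd mt) {u v : Fin n} {j : ℕ}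
    (hj : j < len) (hqj : q j = u) (hv : sd v = 2) (hpv : par v = 0) (huv : ¬ G.Adj u v)
    (hmv : mt v ≠ 0) :
    Search G sd mt (Function.update q len (mt v - 1)) (Function.update par v (u + 1)) (len + 1)
      fnd := by
  obtain ⟨x, hx1, hx2, hx3, -⟩ := hm v hmv
  have e : ∀ w : Fin n, par w ≠ 0 → Function.update par v (u + 1) w ≠ 0 := fun w hw => by
    rw [Clos.update_apply]; split_ifs <;> omega
  -- A listed partner `x` of `v` would, by `q_par`, mean that `v` had been reached before.
  have hxq : ∀ i < len, q i ≠ x := fun i hi hqi => h.q_par i hi x v hqi hx2 hpv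
  have eq : ∀ i < len, Function.update q len (mt v - 1) i = q i := fun i hi =>
    Function.update_of_ne (by omega) _ _
  have eql : Function.update q len (mt v - 1) len = x := by
    rw [Function.update_self, hx1, Nat.add_sub_cancel]
  refine ⟨fun i hi => ?_, fun i hi i' hi' hii => ?_, fun w hw hmw => ?_, fun w hw => ?_,
    fun i hi y w hy hyw => ?_, fun h' w hw => ?_, fun h' => ?_⟩
  · by_cases ei : i = len
    · subst ei; exact ⟨x, eql, by omega⟩
    · rw [eq i (by omega)]; exact h.q_mem i (by omega)
  · by_cases ei : i = len <;> by_cases ei' : i' = len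
    · omega
    · subst ei
      rw [eql, eq i' (by omega)] at hii
      exact absurd hii.symm (hxq i' (by omega))
    · subst ei'
      rw [eql, eq i (by omega)] at hii
      exact absurd hii (hxq i (by omega))
    · rw [eq i (by omega), eq i' (by omega)] at hii
      exact h.q_inj i (by omega) i' (by omega) hii
  · obtain ⟨i, hi, hiw⟩ := h.root w hw hmw
    exact ⟨i, by omega, by rw [eq i hi, hiw]⟩
  · rw [Clos.update_apply] at hw ⊢
    split_ifs at hw ⊢ with hwv
    · subst hwv
      exact ⟨hv, j, by omega, u, rfl, by rw [eq j hj, hqj], huv, fun _ =>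
        ⟨len, by omega, hj, by rw [eql, hx1]⟩⟩
    · obtain ⟨g1, i, hi, y, g2, g3, g4, g5⟩ := h.par_spec w hw
      refine ⟨g1, i, by omega, y, g2, by rw [eq i hi, g3], g4, fun g6 => ?_⟩
      obtain ⟨i', hi', g7, g8⟩ := g5 g6
      exact ⟨i', by omega, g7, by rw [eq i' hi', g8]⟩
  · by_cases ei : i = len
    · subst ei
      rw [eql] at hy
      obtain rfl : x = y := Fin.ext hy
      obtain rfl : v = w := Fin.ext (by omega)
      simp
    · rw [eq i (by omega)] at hy
      exact e w (h.q_par i (by omega) y w hy hyw)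
  · rw [Clos.update_apply] at hw
    split_ifs at hw with hwv
    · rwa [hwv]
    · exact h.fnd_zero h' w hw
  · obtain ⟨w, h1, h2, h3⟩ := h.fnd_ne h'
    exact ⟨w, h1, e w h2, h3⟩

end Search

theorem Scanned.visit {i : ℕ} (h : Scanned G sd q par len i) {x k : ℕ} {v : Fin n} (hk : k ≠ 0)
    (hi : i ≤ len) : Scanned G sd (Function.update q len x) (Function.update par v k) (len + 1) i := by
  intro j hj hj' u hu w hw huw
  rw [Function.update_of_ne (by omega)] at hu
  have := h j hj (by omega) u hu w hw huw
  rw [Clos.update_apply]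
  split_ifs
  · exact hk
  · exact this

theorem Scanned.found {i : ℕ} (h : Scanned G sd q par len i) {k : ℕ} {v : Fin n} (hk : k ≠ 0) :
    Scanned G sd q (Function.update par v k) len i := by
  intro j hj hj' u hu w hw huw
  have := h j hj (by omega) u hu w hw huw
  rw [Clos.update_apply]
  split_ifs
  · exact hk
  · exact this

/-- The unmatched vertices below `k` of the first class are listed, the others are not. -/
structure Roots (n : ℕ) (sd mt q par : ℕ → ℕ) (len k : ℕ) : Prop where
  q_mem : ∀ j < len, ∃ u : Fin n, u < k ∧ q j = u ∧ sd u = 1 ∧ mt u = 0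
  q_inj : ∀ j < len, ∀ j' < len, q j = q j' → j = j'
  root : ∀ u : Fin n, u < k → sd u = 1 → mt u = 0 → ∃ j < len, q j = u
  par_zero : ∀ v : Fin n, v < k → par v = 0

namespace Roots

theorem len_le {k : ℕ} (h : Roots n sd mt q par len k) : len ≤ n :=
  card_le_of_injective (fun j hj => by obtain ⟨v, -, hv, -⟩ := h.q_mem j hj; rw [hv]; exact v.2)
    h.q_inj

theorem lt_succ {z w : Fin n} (h : w < (z + 1 : ℕ)) : w = z ∨ w < (z : ℕ) := by
  by_cases e : w = z
  · exact Or.inl e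
  · exact Or.inr (by have : (w : ℕ) ≠ z := fun e' => e (Fin.ext e'); omega)

theorem skip {z : Fin n} (h : Roots n sd mt q par len z) (hz : ¬ (sd z = 1 ∧ mt z = 0)) :
    Roots n sd mt q (Function.update par z 0) len (z + 1) := by
  refine ⟨fun j hj => ?_, h.q_inj, fun u hu h1 h2 => ?_, fun v hv => ?_⟩
  · obtain ⟨u, hu, h1⟩ := h.q_mem j hj
    exact ⟨u, by omega, h1⟩
  · rcases lt_succ hu with rfl | hu
    · exact absurd ⟨h1, h2⟩ hz
    · exact h.root u hu h1 h2
  · rw [Clos.update_apply]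
    split_ifs with e
    · rfl
    · exact h.par_zero v ((lt_succ hv).resolve_left e)

theorem push {z : Fin n} (h : Roots n sd mt q par len z) (hz : sd z = 1) (hmz : mt z = 0) :
    Roots n sd mt (Function.update q len z) (Function.update par z 0) (len + 1) (z + 1) := by
  have eq : ∀ i < len, Function.update q len z i = q i := fun i hi =>
    Function.update_of_ne (by omega) _ _
  have hlt : ∀ i < len, q i < z := fun i hi => by
    obtain ⟨u, hu, h1, -⟩ := h.q_mem i hi; omega
  refine ⟨fun j hj => ?_, fun i hi i' hi' hii => ?_, fun u hu h1 h2 => ?_, fun v hv => ?_⟩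
  · by_cases ej : j = len
    · exact ⟨z, by omega, by rw [ej, Function.update_self], hz, hmz⟩
    · obtain ⟨u, hu, h1⟩ := h.q_mem j (by omega)
      exact ⟨u, by omega, by rwa [eq j (by omega)]⟩
  · by_cases ei : i = len <;> by_cases ei' : i' = len
    · omega
    · subst ei
      rw [Function.update_self, eq i' (by omega)] at hii
      have := hlt i' (by omega); omega
    · subst ei'
      rw [Function.update_self, eq i (by omega)] at hii
      have := hlt i (by omega); omega
    · rw [eq i (by omega), eq i' (by omega)] at hii
      exact h.q_inj i (by omega) i' (by omega) hii
  · rcases lt_succ hu with rfl | hu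
    · exact ⟨len, by omega, by simp⟩
    · obtain ⟨j, hj, hju⟩ := h.root u hu h1 h2
      exact ⟨j, by omega, by rw [eq j hj, hju]⟩
  · rw [Clos.update_apply]
    split_ifs with e
    · rfl
    · exact h.par_zero v ((lt_succ hv).resolve_left e)

theorem search (h : Roots n sd mt q par len n) : Search G sd mt q par len 0 := by
  refine ⟨fun j hj => ?_, h.q_inj, fun u => h.root u u.2, fun v hv => absurd (h.par_zero v v.2) hv,
    fun j hj u w hu huw => ?_, fun _ v hv => absurd (h.par_zero v v.2) hv, fun h' => absurd rfl h'⟩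
  · obtain ⟨u, -, h1, h2, -⟩ := h.q_mem j hj
    exact ⟨u, h1, h2⟩
  · obtain ⟨u', -, h1, -, h2⟩ := h.q_mem j hj
    obtain rfl : u = u' := Fin.ext (hu.symm.trans h1)
    omega

end Roots

/-- The state while the matching `mt₀` is augmented along the path found: `cur` is the code of
the vertex that has lost its partner, or `0` if the augmentation is complete; at most `m` steps
are left. -/
def Aug (G : SimpleGraph (Fin n)) (sd mt₀ q par : ℕ → ℕ) (len : ℕ) (mt : ℕ → ℕ) (cur m : ℕ) :
    Prop :=
  cur = 0 ∧ IsMate G sd mt ∧ mateCard n mt = mateCard n mt₀ + 2 ∨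
    ∃ v : Fin n, cur = v + 1 ∧ IsMate G sd (Function.update mt v 0) ∧
      mateCard n (Function.update mt v 0) = mateCard n mt₀ ∧ par v ≠ 0 ∧
      ∃ j < len, j < m ∧ par v = q j + 1 ∧ ∀ j' ≤ j, ∀ u : Fin n, q j' = u → mt u = mt₀ u

theorem aug_start (h : Search G sd mt q par len fnd) (hm : IsMate G sd mt) (hf : fnd ≠ 0) :
    Aug G sd mt q par len mt fnd n := by
  obtain ⟨v, h1, h2, h3⟩ := h.fnd_ne hf
  obtain ⟨h4, j, hj, u, h5, h6, -⟩ := h.par_spec v h2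
  have e : Function.update mt v 0 = mt := by rw [← h3, Function.update_eq_self]
  have := h.len_le
  exact Or.inr ⟨v, h1, by rwa [e], by rw [e], h2, j, hj, by omega, by omega,
    fun _ _ _ _ => rfl⟩

/-- The predecessor `u` takes `v` as its partner. If `u` had a partner `w`, then `w` is the next
vertex to be served, and its predecessor stands strictly before `u` in the queue. This decrease
gives termination, and it ensures that the mates still to be read are those of `mt₀`. -/
theorem aug_step {mt₀ : ℕ → ℕ} {v : Fin n} {m : ℕ} (h : Search G sd mt₀ q par len fnd)
    (hm : IsMate G sd mt₀) (ha : Aug G sd mt₀ q par len mt (v + 1) (m + 1)) :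
    ∃ u : Fin n, par v = u + 1 ∧ sd u = 1 ∧ sd v = 2 ∧ mt u ≤ n ∧
      Aug G sd mt₀ q par len (join mt u v) (mt u) m := by
  rcases ha with ⟨h', -⟩ | ⟨v', hv', h1, h2, h3, j, hj, hjm, h4, h5⟩
  · omega
  obtain rfl : v = v' := Fin.ext (by omega)
  obtain ⟨g1, j₁, hj₁, u, g2, g3, g4, -⟩ := h.par_spec v h3
  obtain rfl : j = j₁ := h.q_inj j hj j₁ hj₁ (by omega)
  have hu1 : sd u = 1 := by
    obtain ⟨u', h6, h7⟩ := h.q_mem j hj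
    obtain rfl : u = u' := Fin.ext (g3.symm.trans h6)
    exact h7
  have huv : u ≠ v := by rintro rfl; omega
  have e1 : Function.update mt v 0 u = mt u := by rw [Clos.update_apply, if_neg huv]
  have e2 : Function.update mt v 0 v = 0 := by simp
  have e3 : join (Function.update mt v 0) u v = join mt u v := by
    have : (v : ℕ) ≠ u := fun e => huv (Fin.ext e.symm)
    rw [join, join, Function.update_comm this, Function.update_idem]
  by_cases hmu : mt u = 0
  · refine ⟨u, g2, hu1, g1, by omega, Or.inl ⟨hmu, ?_, ?_⟩⟩
    · rw [← e3]; exact h1.join (e1.trans hmu) e2 hu1 g1 g4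
    · rw [← e3, mateCard_join (e1.trans hmu) e2 huv, h2]
  · obtain ⟨w, k1, k2, k3, -⟩ := h1 u (by rwa [e1])
    rw [e1] at k1
    have hwv : w ≠ v := by rintro rfl; omega
    obtain ⟨r1, r2⟩ := h1.rematch (e1.trans k1) e2 hu1 g1 g4
    have hpw := h.q_par j hj u w g3 (by rw [← h5 j le_rfl u g3, k1])
    obtain ⟨l1, j₂, hj₂, u₂, l2, l3, -, l4⟩ := h.par_spec w hpw
    have hmw : mt₀ u = w + 1 := by rw [← h5 j le_rfl u g3, k1]
    obtain ⟨x, n1, n2, -⟩ := hm u (by omega)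
    obtain rfl : w = x := Fin.ext (by omega)
    obtain ⟨j₃, hj₃, n3, n4⟩ := l4 (by omega)
    obtain rfl : j = j₃ := h.q_inj j hj j₃ hj₃ (by omega)
    refine ⟨u, g2, hu1, g1, by omega, Or.inr ⟨w, k1, by rwa [← e3], by rw [← e3, r2, h2], hpw, j₂,
      hj₂, by omega, by omega, fun j' hj' y hy => ?_⟩⟩
    have hyu : y ≠ u := by
      rintro rfl
      have := h.q_inj j' (by omega) j hj (by omega)
      omega
    have hyv : y ≠ v := by
      rintro rfl
      obtain ⟨y', o1, o2⟩ := h.q_mem j' (by omega)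
      obtain rfl : y = y' := Fin.ext (hy.symm.trans o1)
      omega
    rw [join_apply, if_neg hyv, if_neg hyu]
    exact h5 j' (by omega) y hy

end WordRAM


/-! ### Programs for the search, the augmentation and the maximum matching -/

namespace WordRAM

variable {n W : ℕ} {G : SimpleGraph (Fin n)}

theorem IsMate.le {sd mt : ℕ → ℕ} (h : IsMate G sd mt) (z : Fin n) : mt z ≤ n := by
  by_cases e : mt z = 0
  · omega
  · obtain ⟨w, h1, -⟩ := h z e; omega

/-- List the unmatched vertices of the first class and clear the predecessors. -/
def rootProg : Prog :=
  6 <~ .lit 0 ;; 12 <~ .lit 0 ;;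
  .for 5 0 (.write 6 (.reg 5) (.lit 0) ;;
    .cond (.bin .eq (.get 3 (.reg 5)) (.lit 1))
      (.cond (.get 5 (.reg 5)) .skip
        (.write 4 (.reg 6) (.reg 5) ;; 6 <~ .bin .add (.reg 6) (.lit 1))) .skip)

theorem rootProg_spec (hW : Ample n W) {s : Store} (h0 : s.reg 0 = n)
    (hs : ∀ z : Fin n, s.arr 3 z ≤ 2) (hm : IsMate G (s.arr 3) (s.arr 5)) :
    WP W rootProg s fun t s' => t ≤ n * 40 + 20 ∧
      Search G (s.arr 3) (s.arr 5) (s'.arr 4) (s'.arr 6) (s'.reg 6) (s'.reg 12) := by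
  have hW' := hW
  unfold Ample at hW
  have one_lt : 1 < W := by omega
  rw [rootProg, wp_seq, wp_assign]
  refine ⟨by simp only [Expr.Fits]; omega, ?_⟩
  rw [wp_seq, wp_assign]
  refine ⟨by simp only [Expr.Fits]; omega, ?_⟩
  refine WP.for (n := n) (T := 32) (I := fun k s' => s'.reg 12 = 0 ∧
      Roots n (s.arr 3) (s.arr 5) (s'.arr 4) (s'.arr 6) (s'.reg 6) k)
    (by decide) rfl rfl (by simp [h0]) hW'.succ_lt ?_ ?_ ?_
  · refine ⟨by simp [Expr.eval], ?_⟩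
    simp only [setReg_reg, Nat.reduceEqDiff, reduceIte, Expr.eval]
    exact ⟨fun j hj => by omega, fun j hj => by omega, fun u hu => by omega, fun u hu => by omega⟩
  · rintro z s' hz hF ⟨I0, I⟩
    have e3 : s'.arr 3 = s.arr 3 := by simpa using hF.2 3 rfl
    have e5 : s'.arr 5 = s.arr 5 := by simpa using hF.2 5 rfl
    have := hs z
    have := hm.le z
    have := I.len_le
    simp only [wp_cond, wp_skip, wp_assign, wp_seq, wp_write, Expr.Fits, Expr.eval, Op.add_apply,
      Op.eq_eq_zero, Op.eq_fits one_lt, and_true, hz, e3, e5, Expr.cost, setReg_reg, setReg_arr,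
      setArr_reg, setArr_arr, ne_eq, Nat.reduceEqDiff, reduceIte, Nat.reduceAdd, Nat.reduceLeDiff,
      true_and, not_not]
    refine ⟨by omega, by omega, fun c1 => ⟨by omega, fun c2 => ⟨I0, I.skip (by tauto)⟩,
      fun c2 => ⟨by omega, by omega, I0, I.push c1 c2⟩⟩, fun c1 =>
      ⟨I0, I.skip (by tauto)⟩⟩
  · rintro t s' ht hF ⟨I0, I⟩
    refine ⟨by simp only [Expr.cost]; omega, ?_⟩
    rw [I0]
    exact I.search

/-- Visit the non-neighbours of `reg 8` in the second class. -/
def visitProg : Prog :=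
  .for 5 0 (.cond (.bin .eq (.get 3 (.reg 5)) (.lit 2))
    (.cond (.get 6 (.reg 5)) .skip
      (.cond (.adj 8 5) .skip
        (.write 6 (.reg 5) (.bin .add (.reg 8) (.lit 1)) ;;
          .cond (.get 5 (.reg 5))
            (.write 4 (.reg 6) (.bin .sub (.get 5 (.reg 5)) (.lit 1)) ;;
              6 <~ .bin .add (.reg 6) (.lit 1))
            (12 <~ .bin .add (.reg 5) (.lit 1))))) .skip)

theorem Search.par_le {sd mt q par : ℕ → ℕ} {len fnd : ℕ} (h : Search G sd mt q par len fnd)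
    (z : Fin n) : par z ≤ n := by
  by_cases e : par z = 0
  · omega
  · obtain ⟨-, j, -, u, h1, -⟩ := h.par_spec z e; omega

theorem visitProg_spec (hW : Ample n W) {s : Store} (hA : Mat G (s.arr 0)) {u : Fin n} {i : ℕ}
    (h0 : s.reg 0 = n) (h8 : s.reg 8 = u)
    (hs : ∀ z : Fin n, s.arr 3 z ≤ 2) (hm : IsMate G (s.arr 3) (s.arr 5))
    (hS : Search G (s.arr 3) (s.arr 5) (s.arr 4) (s.arr 6) (s.reg 6) (s.reg 12))
    (hi : i < s.reg 6) (hqi : s.arr 4 i = u)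
    (hP : Scanned G (s.arr 3) (s.arr 4) (s.arr 6) (s.reg 6) i) :
    WP W visitProg s fun t s' => t ≤ n * 60 + 6 ∧
      Search G (s.arr 3) (s.arr 5) (s'.arr 4) (s'.arr 6) (s'.reg 6) (s'.reg 12) ∧
      Scanned G (s.arr 3) (s'.arr 4) (s'.arr 6) (s'.reg 6) (i + 1) := by
  have hW' := hW
  unfold Ample at hW
  have one_lt : 1 < W := by omega
  refine WP.for (n := n) (T := 52) (I := fun k s' =>
      Search G (s.arr 3) (s.arr 5) (s'.arr 4) (s'.arr 6) (s'.reg 6) (s'.reg 12) ∧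
      i < s'.reg 6 ∧ s'.arr 4 i = u ∧ Scanned G (s.arr 3) (s'.arr 4) (s'.arr 6) (s'.reg 6) i ∧
      ∀ v : Fin n, v < k → s.arr 3 v = 2 → ¬ G.Adj u v → s'.arr 6 v ≠ 0)
    (by decide) rfl rfl h0 hW'.succ_lt
    ⟨by simpa using hS, by simpa using hi, by simpa using hqi, by simpa using hP, by simp⟩ ?_ ?_
  · rintro v s' hv hF ⟨I1, I2, I3, I4, I5⟩
    have e0 : s'.reg 0 = n := by simpa [h0] using hF.1 0 rfl
    have e8 : s'.reg 8 = u := by simpa [h8] using hF.1 8 rfl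
    have e3 : s'.arr 3 = s.arr 3 := by simpa using hF.2 3 rfl
    have e5 : s'.arr 5 = s.arr 5 := by simpa using hF.2 5 rfl
    have eA : s'.arr 0 = s.arr 0 := hF.2 0 rfl
    have i1 := index_lt u v
    have := adjEntry_le (G := G) u v
    have := I1.len_le
    have := I1.par_le v
    have := hs v
    have := hm.le v
    have step : (s.arr 3 v = 2 → ¬ G.Adj u v → s'.arr 6 v ≠ 0) → ∀ w : Fin n, w < (v + 1 : ℕ) →
        s.arr 3 w = 2 → ¬ G.Adj u w → s'.arr 6 w ≠ 0 := fun h1 w hw => by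
      rcases Roots.lt_succ hw with rfl | hw
      exacts [h1, I5 w hw]
    have step' : ∀ w : Fin n, w < (v + 1 : ℕ) →
        s.arr 3 w = 2 → ¬ G.Adj u w → Function.update (s'.arr 6) v (u + 1) w ≠ 0 := fun w hw h1 h2 => by
      rw [Clos.update_apply]
      split_ifs with e
      · omega
      · exact I5 w ((Roots.lt_succ hw).resolve_left e) h1 h2
    simp only [wp_cond, wp_skip, wp_assign, wp_seq, wp_write, Expr.Fits, Expr.eval, Op.add_apply,
      Op.sub_apply, Op.mul_apply, hA u _,
      Op.eq_eq_zero, Op.eq_fits one_lt, and_true, hv, e0, e8, e3, e5, eA, Expr.cost, setReg_reg,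
      setReg_arr, setArr_reg, setArr_arr, ne_eq, Nat.reduceEqDiff, reduceIte, Nat.reduceAdd,
      Nat.reduceLeDiff, true_and, not_not, adjEntry_eq_zero]
    refine ⟨by omega, fun c1 => ⟨by omega, fun c2 => ⟨I1, I2, I3, I4, step fun _ _ => c2⟩, fun c2 =>
      ⟨by omega, fun c3 => ⟨I1, I2, I3, I4, step fun _ h => absurd c3 h⟩, fun c3 => ⟨by omega,
        by omega, fun c4 => ⟨by omega, by omega, ?_, by omega, ?_, ?_, step'⟩,
        fun c4 => ⟨by omega, I1.found I2 I3 c1 c3 c4, I2, I3, I4.found (by omega), step'⟩⟩⟩⟩,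
      fun c1 => ⟨I1, I2, I3, I4, step fun h => absurd h c1⟩⟩
    · exact I1.visit hm I2 I3 c1 c2 c3 c4
    · rw [Function.update_of_ne (by omega), I3]
    · exact I4.visit (by omega) (by omega)
  · rintro t s' ht hF ⟨I1, I2, I3, I4, I5⟩
    refine ⟨by omega, I1, fun j hj hj' w hw v => ?_⟩
    by_cases e : j = i
    · subst e
      obtain rfl : w = u := Fin.ext (hw.symm.trans I3)
      exact I5 v v.2
    · exact I4 j (by omega) hj' w hw v

/-- Search for an augmenting path; its end (plus one) goes to `reg 12`. -/
def searchProg : Prog :=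
  rootProg ;;
  .for 7 0 (.cond (.bin .lt (.reg 7) (.reg 6)) (8 <~ .get 4 (.reg 7) ;; visitProg) .skip)

theorem searchProg_spec (hW : Ample n W) {s : Store} (hA : Mat G (s.arr 0)) (h0 : s.reg 0 = n)
    (hs : ∀ z : Fin n, s.arr 3 z ≤ 2) (hm : IsMate G (s.arr 3) (s.arr 5)) :
    WP W searchProg s fun t s' => t ≤ 100 * (n + 1) * (n + 1) ∧
      Search G (s.arr 3) (s.arr 5) (s'.arr 4) (s'.arr 6) (s'.reg 6) (s'.reg 12) ∧
      Scanned G (s.arr 3) (s'.arr 4) (s'.arr 6) (s'.reg 6) n := by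
  have hW' := hW
  unfold Ample at hW'
  have one_lt : 1 < W := by omega
  refine WP.seq ((rootProg_spec hW h0 hs hm).mono ?_)
  rintro t1 s1 hF1 ⟨ht1, hC1⟩
  have f0 : s1.reg 0 = n := by simpa [h0] using hF1.1 0 rfl
  have fA : s1.arr 0 = s.arr 0 := hF1.2 0 rfl
  have f3 : s1.arr 3 = s.arr 3 := hF1.2 3 rfl
  have f5 : s1.arr 5 = s.arr 5 := hF1.2 5 rfl
  refine WP.for (n := n) (T := n * 60 + 30) (I := fun k s' =>
      Search G (s.arr 3) (s.arr 5) (s'.arr 4) (s'.arr 6) (s'.reg 6) (s'.reg 12) ∧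
      Scanned G (s.arr 3) (s'.arr 4) (s'.arr 6) (s'.reg 6) k)
    (by decide) rfl rfl f0 hW.succ_lt ⟨by simpa using hC1, fun j hj => by omega⟩ ?_ ?_
  · rintro z s' hz hF ⟨I1, I2⟩
    have e0 : s'.reg 0 = n := by simpa [f0] using hF.1 0 rfl
    have eA : s'.arr 0 = s.arr 0 := by simpa [fA] using hF.2 0 rfl
    have e3 : s'.arr 3 = s.arr 3 := by simpa [f3] using hF.2 3 rfl
    have e5 : s'.arr 5 = s.arr 5 := by simpa [f5] using hF.2 5 rfl
    have := I1.len_le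
    rw [wp_cond]
    simp only [Expr.Fits, Expr.eval, Op.lt_eq_zero, Op.lt_fits one_lt, and_true, hz, Expr.cost,
      ne_eq, not_not]
    refine ⟨by omega, fun c => ?_, fun c => ?_⟩
    · obtain ⟨u, hu, -⟩ := I1.q_mem z c
      rw [wp_seq, wp_assign]
      simp only [Expr.Fits, Expr.eval, hz, hu, Expr.cost]
      refine ⟨by omega, (visitProg_spec (G := G) (u := u) (i := z) hW (by simpa [eA] using hA)
        (by simpa using e0) (by simp) (by simpa [e3] using hs) (by simpa [e3, e5] using hm)
        (by simpa [e3, e5] using I1) (by simpa using c) (by simpa using hu)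
        (by simpa [e3] using I2)).mono ?_⟩
      rintro t s'' hF2 ⟨g1, g2, g3⟩
      simp only [setReg_arr, e3, e5] at g2 g3
      exact ⟨by omega, by simpa using g2, by simpa using g3⟩
    · rw [wp_skip]
      exact ⟨by omega, by simpa using I1, fun j hj hj' => I2 j (by simp at hj'; omega)
        (by simpa using hj')⟩
  · rintro t s' ht hF ⟨I1, I2⟩
    refine ⟨?_, I1, I2⟩
    have : n * (n * 60 + 30 + 8) = 60 * (n * n) + 38 * n := by ring
    have : 100 * (n + 1) * (n + 1) = 100 * (n * n) + 200 * n + 100 := by ring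
    omega

/-- Augment the matching along the path found. -/
def augProg : Prog :=
  14 <~ .reg 12 ;;
  .for 7 0 (.cond (.reg 14)
    (13 <~ .bin .sub (.reg 14) (.lit 1) ;; 15 <~ .bin .sub (.get 6 (.reg 13)) (.lit 1) ;;
      14 <~ .get 5 (.reg 15) ;; .write 5 (.reg 15) (.bin .add (.reg 13) (.lit 1)) ;;
      .write 5 (.reg 13) (.bin .add (.reg 15) (.lit 1))) .skip)

theorem augProg_spec (hW : Ample n W) {s : Store} (h0 : s.reg 0 = n)
    (hm : IsMate G (s.arr 3) (s.arr 5))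
    (hS : Search G (s.arr 3) (s.arr 5) (s.arr 4) (s.arr 6) (s.reg 6) (s.reg 12))
    (hf : s.reg 12 ≠ 0) :
    WP W augProg s fun t s' => t ≤ n * 50 + 20 ∧
      IsMate G (s.arr 3) (s'.arr 5) ∧ mateCard n (s'.arr 5) = mateCard n (s.arr 5) + 2 := by
  have hW' := hW
  unfold Ample at hW
  have hle : s.reg 12 ≤ n := by
    obtain ⟨v, h1, -⟩ := hS.fnd_ne hf; omega
  rw [augProg, wp_seq, wp_assign]
  refine ⟨by simp only [Expr.Fits]; omega, ?_⟩
  refine WP.for (n := n) (T := 42) (I := fun k s' =>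
      Aug G (s.arr 3) (s.arr 5) (s.arr 4) (s.arr 6) (s.reg 6) (s'.arr 5) (s'.reg 14) (n - k))
    (by decide) rfl rfl (by simp [h0]) hW'.succ_lt ?_ ?_ ?_
  · simpa [Expr.eval] using aug_start hS hm hf
  · rintro k s' hk hF I
    have e6 : s'.arr 6 = s.arr 6 := by simpa using hF.2 6 rfl
    have hcur : s'.reg 14 ≤ n := by
      rcases I with ⟨h1, -⟩ | ⟨v, h1, -⟩ <;> omega
    rw [wp_cond]
    simp only [Expr.Fits, Expr.eval]
    refine ⟨by omega, fun c => ?_, fun c => ?_⟩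
    · obtain ⟨v, hv⟩ : ∃ v : Fin n, s'.reg 14 = v + 1 := by
        rcases I with ⟨h1, -⟩ | ⟨v, h1, -⟩
        · exact absurd h1 c
        · exact ⟨v, h1⟩
      rw [hv, show n - k = (n - (k + 1)) + 1 by omega] at I
      obtain ⟨u, g1, g2, g3, g4, g5⟩ := aug_step hS hm I
      have huv : (u : ℕ) ≠ v := fun e => by
        obtain rfl : u = v := Fin.ext e
        omega
      simp only [wp_assign, wp_seq, wp_write, Expr.Fits, Expr.eval, Op.add_apply,
        Op.sub_apply, hv, e6, Expr.cost, setReg_reg, Nat.add_sub_cancel, g1,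
        setReg_arr, setArr_reg, setArr_arr, Nat.reduceEqDiff, reduceIte, Nat.reduceAdd,
        Nat.reduceLeDiff, true_and]
      exact ⟨by omega, by omega, by omega, by omega, by omega, g5⟩
    · rw [wp_skip]
      refine ⟨by simp [Expr.cost], ?_⟩
      rcases I with h | ⟨v, h1, -⟩
      · exact Or.inl (by simpa using h)
      · omega
  · rintro t s' ht hF I
    -- After `n` rounds no steps are left, and the unfinished case would need a queue position below
    -- `0`.
    rcases I with h | ⟨v, -, -, -, -, j, -, h1, -⟩
    · exact ⟨by simp only [Expr.cost]; omega, h.2⟩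
    · omega

/-- A maximum matching of non-adjacent pairs between the two sides of array `3`. -/
def matchProg : Prog :=
  .for 5 0 (.write 5 (.reg 5) (.lit 0)) ;; 12 <~ .lit 1 ;;
  .loop (.reg 12) (searchProg ;; .cond (.reg 12) augProg .skip)

theorem isMate_zero {sd mt : ℕ → ℕ} (h : ∀ z : Fin n, mt z = 0) :
    IsMate G sd mt ∧ mateCard n mt = 0 :=
  ⟨fun z hz => absurd (h z) hz, by simp [mateCard, h]⟩

/-- Each round except the last adds one pair, that is, two matched vertices, so there are `|M| + 1`
rounds of `O(n²)` steps. The data of the last, unsuccessful search are kept because they yield the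
minimum vertex cover. -/
theorem matchProg_spec (hW : Ample n W) {s : Store} (hA : Mat G (s.arr 0)) (h0 : s.reg 0 = n)
    (hs : ∀ z : Fin n, s.arr 3 z ≤ 2) :
    WP W matchProg s fun t s' => t ≤ 200 * (n + 1) * (n + 1) * (mateCard n (s'.arr 5) + 2) ∧
      IsMate G (s.arr 3) (s'.arr 5) ∧
      Search G (s.arr 3) (s'.arr 5) (s'.arr 4) (s'.arr 6) (s'.reg 6) 0 ∧
      Scanned G (s.arr 3) (s'.arr 4) (s'.arr 6) (s'.reg 6) n := by
  have hW' := hW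
  unfold Ample at hW'
  rw [matchProg, wp_seq]
  refine WP.for (n := n) (T := 3) (I := fun k s' => ∀ z : Fin n, z < k → s'.arr 5 z = 0)
    (by decide) rfl rfl h0 hW.succ_lt (by simp) ?_ ?_
  · intro z s' hz hF hI
    simp only [wp_write, Expr.Fits, Expr.eval, Expr.cost, hz, setReg_arr, setArr_arr, reduceIte,
      Nat.reduceAdd, Nat.reduceLeDiff, true_and]
    refine ⟨by omega, fun w hw => ?_⟩
    rw [Clos.update_apply]
    split_ifs with e
    · rfl
    · exact hI w ((Roots.lt_succ hw).resolve_left e)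
  intro t0 s0 ht0 hF0 hI0
  have f0 : s0.reg 0 = n := by simpa [h0] using hF0.1 0 rfl
  have fA : s0.arr 0 = s.arr 0 := hF0.2 0 rfl
  have f3 : s0.arr 3 = s.arr 3 := hF0.2 3 rfl
  obtain ⟨m1, m2⟩ := isMate_zero (G := G) (sd := s.arr 3) (fun z => hI0 z z.2)
  rw [wp_seq, wp_assign]
  refine ⟨by simp only [Expr.Fits]; omega, ?_⟩
  refine WP.loop (I := fun k t s' => t ≤ k * (150 * (n + 1) * (n + 1)) ∧
      IsMate G (s.arr 3) (s'.arr 5) ∧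
      (s'.reg 12 ≠ 0 → mateCard n (s'.arr 5) = 2 * k ∧ s'.reg 12 ≤ n + 1) ∧
      (s'.reg 12 = 0 → mateCard n (s'.arr 5) + 2 = 2 * k ∧
        Search G (s.arr 3) (s'.arr 5) (s'.arr 4) (s'.arr 6) (s'.reg 6) 0 ∧
        Scanned G (s.arr 3) (s'.arr 4) (s'.arr 6) (s'.reg 6) n)) (n + 1) ?_ ?_ ?_ ?_ ?_
  · exact ⟨by simp, by simpa using m1, fun _ => ⟨by simpa using m2, by simp [Expr.eval]⟩,
      fun h => by simp [Expr.eval] at h⟩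
  · rintro k t s' ⟨-, -, h1, h2⟩
    have := mateCard_le (n := n) (mt := s'.arr 5)
    by_cases e : s'.reg 12 = 0
    · have := (h2 e).1; omega
    · have := (h1 e).1; omega
  · rintro k t s' ⟨-, -, h1, h2⟩
    simp only [Expr.Fits]
    by_cases e : s'.reg 12 = 0
    · omega
    · have := (h1 e).2; omega
  · rintro k t s' ⟨J1, J2, J3, -⟩ hF he
    simp only [Expr.eval] at he
    have hk := (J3 he).1
    have e0 : s'.reg 0 = n := by simpa [f0] using hF.1 0 rfl
    have eA : s'.arr 0 = s.arr 0 := by simpa [fA] using hF.2 0 rfl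
    have e3 : s'.arr 3 = s.arr 3 := by simpa [f3] using hF.2 3 rfl
    refine WP.seq ((searchProg_spec (G := G) hW (by rwa [eA]) e0 (by simpa [e3] using hs)
      (by rwa [e3])).mono ?_)
    rintro t1 s1 hF1 ⟨ht1, hS1, hP1⟩
    have g0 : s1.reg 0 = n := by simpa [e0] using hF1.1 0 rfl
    have g3 : s1.arr 3 = s.arr 3 := by simpa [e3] using hF1.2 3 rfl
    have g5 : s1.arr 5 = s'.arr 5 := hF1.2 5 rfl
    rw [e3] at hS1 hP1
    have e1 : (k + 1) * (150 * (n + 1) * (n + 1)) = k * (150 * (n + 1) * (n + 1)) +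
      (150 * (n * n) + 300 * n + 150) := by ring
    have e2 : 100 * (n + 1) * (n + 1) = 100 * (n * n) + 200 * n + 100 := by ring
    rw [wp_cond]
    simp only [Expr.Fits, Expr.eval, Expr.cost]
    refine ⟨?_, fun c => ?_, fun c => ?_⟩
    · by_cases e : s1.reg 12 = 0
      · omega
      · obtain ⟨v, hv, -⟩ := hS1.fnd_ne e; omega
    · refine (augProg_spec (G := G) hW g0 (by rwa [g3, g5]) (by rwa [g3, g5]) c).mono ?_
      rintro t2 s2 hF2 ⟨ht2, k1, k2⟩
      have : s2.reg 12 = s1.reg 12 := hF2.1 12 rfl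
      rw [g3] at k1
      rw [g5] at k2
      refine ⟨by omega, k1, fun _ => ⟨by omega, ?_⟩, fun h => by omega⟩
      obtain ⟨v, hv, -⟩ := hS1.fnd_ne c; omega
    · rw [wp_skip]
      refine ⟨by omega, by rwa [g5], fun h => absurd c h, fun _ => ⟨by rw [g5]; omega, ?_, hP1⟩⟩
      rw [g5, ← c]
      exact hS1
  · rintro k t s' ⟨J1, J2, -, J4⟩ hF he
    simp only [Expr.eval] at he
    obtain ⟨J5, J6, J7⟩ := J4 he
    refine ⟨?_, J2, J6, J7⟩
    simp only [Expr.cost]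
    have hk : 2 * k = mateCard n (s'.arr 5) + 2 := by omega
    have e1 : 200 * (n + 1) * (n + 1) * (mateCard n (s'.arr 5) + 2) =
        k * (150 * (n + 1) * (n + 1)) + 250 * (k * ((n + 1) * (n + 1))) := by
      rw [← hk]; ring
    have e2 : 1 * ((n + 1) * (n + 1)) ≤ k * ((n + 1) * (n + 1)) :=
      Nat.mul_le_mul_right _ (by omega)
    have e3 : (n + 1) * (n + 1) = n * n + 2 * n + 1 := by ring
    omega

end WordRAM


/-! ### König's theorem and the amortisation of the matching -/

namespace WordRAM

open Finset SimpleGraph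

variable {n W : ℕ} {G : SimpleGraph (Fin n)} {sd mt q par : ℕ → ℕ} {len : ℕ}

/-- The vertices of side `i`. -/
abbrev side (n : ℕ) (sd : ℕ → ℕ) (i : ℕ) : Set (Fin n) := {z : Fin n | sd z = i}

/-- The vertices of the two sides that are outside the minimum vertex cover found by the search. -/
def Free (sd mt par : ℕ → ℕ) (z : Fin n) : Prop :=
  sd z = 1 ∧ (mt z = 0 ∨ par (mt z - 1) ≠ 0) ∨ sd z = 2 ∧ par z = 0

/-- A free vertex of the first class is reached and listed: either it is a root or its partner was
reached. As all its non-neighbours in the second class have been reached, an unreached `v` must be a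
neighbour. -/
theorem free_adj (hS : Search G sd mt q par len 0) (hP : Scanned G sd q par len n) {u v : Fin n}
    (hu : sd u = 1) (hv : sd v = 2) (hfu : Free sd mt par u) (hfv : Free sd mt par v)
    (hm : IsMate G sd mt) : G.Adj u v := by
  by_contra huv
  have hpv : par v = 0 := by rcases hfv with h | h <;> omega
  suffices ∃ j < len, q j = u by
    obtain ⟨j, hj, hju⟩ := this
    exact hP j (hj.trans_le hS.len_le) hj u hju v hv huv hpv
  by_cases hmu : mt u = 0
  · exact hS.root u hu hmu
  · obtain ⟨w, h1, h2, -⟩ := hm u hmu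
    have hpw : par w ≠ 0 := by
      rcases hfu with h | h
      · rw [h1, Nat.add_sub_cancel] at h
        exact h.2.resolve_left (by omega)
      · omega
    obtain ⟨-, j, -, x, -, -, -, h3⟩ := hS.par_spec w hpw
    obtain ⟨j', hj', -, h4⟩ := h3 (by omega)
    exact ⟨j', hj', by omega⟩

theorem free_iff_partner (hm : IsMate G sd mt) {z w : Fin n}
    (hz : mt z = w + 1) (hw : mt w = z + 1) : Free sd mt par z ↔ ¬ Free sd mt par w := by
  obtain ⟨w', h1, -, h3, -⟩ := hm z (by omega)
  obtain rfl : w' = w := Fin.ext (by omega)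
  have e : mt z - 1 = w' := by omega
  have e' : mt w' - 1 = z := by omega
  rw [Free, Free, e, e']
  rcases h3 with h | h <;> simp only [h, hz, hw] <;> simp

-- All unmatched vertices of the two classes are free, since no augmenting path was found, and each
-- matched pair contains exactly one free vertex.
open Classical in
theorem free_card (hS : Search G sd mt q par len 0) (hm : IsMate G sd mt)
    (hs : ∀ z : Fin n, sd z ≤ 2) :
    2 * #{z : Fin n | sd z ≠ 0} = 2 * #{z : Fin n | Free sd mt par z} + mateCard n mt := by
  have h1 := hm.two_mul (P := fun z => ¬ Free sd mt par z) fun z w a b => by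
    have := free_iff_partner (par := par) hm a b; tauto
  have h2 := card_split (fun z : Fin n => sd z ≠ 0) (fun z => Free sd mt par z)
  have h3 : #{z : Fin n | sd z ≠ 0 ∧ Free sd mt par z} = #{z : Fin n | Free sd mt par z} := by
    refine congrArg card (filter_congr fun z _ => ?_)
    have := hs z
    simp only [Free]
    omega
  have h4 : #{z : Fin n | sd z ≠ 0 ∧ ¬ Free sd mt par z} =
      #{z : Fin n | mt z ≠ 0 ∧ ¬ Free sd mt par z} := by
    refine congrArg card (filter_congr fun z _ => ?_)
    refine and_congr_left fun hf => ⟨fun hz => ?_, fun hz => ?_⟩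
    · have := hs z
      by_contra hmz
      rcases (by omega : sd z = 1 ∨ sd z = 2) with e | e
      · exact hf (Or.inl ⟨e, Or.inl hmz⟩)
      · by_cases hp : par z = 0
        · exact hf (Or.inr ⟨e, hp⟩)
        · exact hS.fnd_zero rfl z hp hmz
    · obtain ⟨w, -, -, h, -⟩ := hm z hz
      omega
  omega

theorem isHomogeneous_sd (hK : G.IsPHPair (side n sd 1) (side n sd 2))
    (hs : ∀ z : Fin n, sd z ≤ 2) {z u v : Fin n} (hz : sd z = 0) (hu : sd u ≠ 0)
    (huv : sd u = sd v) (ha : G.Adj z u) : G.Adj z v := by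
  have := hs u
  rcases (by omega : sd u = 1 ∨ sd u = 2) with e | e
  · exact hK.2.2.adj_left (by simp [hz]) (by simp [hz]) e (huv.symm.trans e) ha
  · exact hK.symm.2.2.adj_left (by simp [hz]) (by simp [hz]) e (huv.symm.trans e) ha

theorem isClique_sd (hK : G.IsPHPair (side n sd 1) (side n sd 2)) (hs : ∀ z : Fin n, sd z ≤ 2)
    {u v : Fin n} (hu : sd u ≠ 0) (huv : sd u = sd v) (hne : u ≠ v) : G.Adj u v := by
  have := hs u
  rcases (by omega : sd u = 1 ∨ sd u = 2) with e | e
  · exact hK.clique e (huv.symm.trans e) hne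
  · exact hK.symm.clique e (huv.symm.trans e) hne

/-- The vertex set `X` that determines which edges between the two sides are kept. -/
def Kept (sd mt par : ℕ → ℕ) (a b : Fin n) (X : Set (Fin n)) : Prop :=
  ((∃ u : Fin n, sd u = 1 ∧ Free sd mt par u) ∧ (∃ v : Fin n, sd v = 2 ∧ Free sd mt par v) ∧
    ∀ z, z ∈ X ↔ Free sd mt par z) ∨
  ¬ ((∃ u : Fin n, sd u = 1 ∧ Free sd mt par u) ∧ ∃ v : Fin n, sd v = 2 ∧ Free sd mt par v) ∧
    ∀ z, z ∈ X ↔ z = a ∨ z = b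

/-- A core must meet both sides. If all free vertices are on one side, the adjacent vertices `a` and
`b` serve instead. -/
theorem Kept.isCore (hS : Search G sd mt q par len 0) (hP : Scanned G sd q par len n)
    (hm : IsMate G sd mt) (hK : G.IsPHPair (side n sd 1) (side n sd 2)) {a b : Fin n}
    (ha : sd a = 1) (hb : sd b = 2) (hab : G.Adj a b) {X : Set (Fin n)}
    (hX : Kept sd mt par a b X) : G.IsCore (side n sd 1) (side n sd 2) X := by
  rcases hX with ⟨⟨u, hu, hfu⟩, ⟨v, hv, hfv⟩, hX⟩ | ⟨-, hX⟩
  · exact ⟨hK, fun x hx y hy hxX hyX => free_adj hS hP hx hy ((hX x).1 hxX) ((hX y).1 hyX) hm,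
      ⟨u, hu, (hX u).2 hfu⟩, ⟨v, hv, (hX v).2 hfv⟩⟩
  · refine ⟨hK, fun x hx y hy hxX hyX => ?_, ⟨a, ha, (hX a).2 (Or.inl rfl)⟩,
      ⟨b, hb, (hX b).2 (Or.inr rfl)⟩⟩
    simp only [side, Set.mem_ofPred_eq] at hx hy
    rcases (hX x).1 hxX with rfl | rfl
    · rcases (hX y).1 hyX with rfl | rfl
      · omega
      · exact hab
    · omega

/-- The clique `T` consists of the free vertices in either case: if they lie on a single side, no
edge among them is affected by the choice of `X`. -/
theorem Kept.step (hS : Search G sd mt q par len 0) (hP : Scanned G sd q par len n)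
    (hm : IsMate G sd mt) (hK : G.IsPHPair (side n sd 1) (side n sd 2)) (hs : ∀ z : Fin n, sd z ≤ 2)
    {a b : Fin n} {X : Set (Fin n)} (hX : Kept sd mt par a b X) :
    Step G (G.thin (side n sd 1) (side n sd 2) X) sd mt := by
  classical
  refine ⟨hs, fun u v => isClique_sd hK hs, fun z u v => isHomogeneous_sd hK hs, thin_le,
    fun u v huv ha => ⟨ha, fun h => ?_⟩, hm, ({z : Fin n | Free sd mt par z} : Finset (Fin n)), ?_, ?_,
    free_card hS hm hs⟩
  · simp only [side, Set.mem_ofPred_eq] at h; omega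
  · intro u hu v hv huv
    simp only [coe_filter, mem_univ, true_and, Set.mem_ofPred_eq] at hu hv
    have su : sd u = 1 ∨ sd u = 2 := by unfold Free at hu; omega
    have sv : sd v = 1 ∨ sd v = 2 := by unfold Free at hv; omega
    by_cases hsd : sd u = sd v
    · refine ⟨isClique_sd hK hs (by omega) hsd huv, fun h => ?_⟩
      simp only [side, Set.mem_ofPred_eq] at h; omega
    · have hboth : (∃ u : Fin n, sd u = 1 ∧ Free sd mt par u) ∧
          ∃ v : Fin n, sd v = 2 ∧ Free sd mt par v := by
        rcases su with e | e
        · exact ⟨⟨u, e, hu⟩, v, by omega, hv⟩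
        · exact ⟨⟨v, by omega, hv⟩, u, e, hu⟩
      rcases hX with ⟨-, -, hX⟩ | ⟨h, -⟩
      · refine ⟨?_, fun _ => ⟨(hX u).2 hu, (hX v).2 hv⟩⟩
        rcases su with e | e
        · exact free_adj hS hP e (by omega) hu hv hm
        · exact (free_adj hS hP (by omega) e hv hu hm).symm
      · exact absurd hboth h
  · intro z hz
    have : Free sd mt par z := by simpa using hz
    unfold Free at this; omega

open Classical in
/-- The number of ordered pairs of adjacent vertices. -/
noncomputable def adjCard (G : SimpleGraph (Fin n)) : ℕ :=
  #{p : Fin n × Fin n | G.Adj p.1 p.2}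

/-- Partners are not adjacent, so at least half of the matched vertices are outside `X`. Each of
these has a neighbour on the other side by properness, and loses the edge to it. The ordered pairs
so obtained differ in their first entries. -/
theorem thin_adjCard (hm : IsMate G sd mt) {X : Set (Fin n)}
    (hC : G.IsCore (side n sd 1) (side n sd 2) X) :
    mateCard n mt + 2 * adjCard (G.thin (side n sd 1) (side n sd 2) X) ≤ 2 * adjCard G := by
  classical
  have key : ∀ z : Fin n, mt z ≠ 0 ∧ z ∉ X → ∃ p : Fin n × Fin n, p.1 = z ∧ G.Adj p.1 p.2 ∧
      ¬ (G.thin (side n sd 1) (side n sd 2) X).Adj p.1 p.2 := by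
    rintro z ⟨hz, hzX⟩
    obtain ⟨w, -, -, h, -⟩ := hm z hz
    rcases h with ⟨h, -⟩ | ⟨h, -⟩
    · obtain ⟨y, hy, hzy⟩ := hC.ph.exists_adj (u := z) h
      exact ⟨(z, y), rfl, hzy, fun h' => hzX ((hC.thin_adj h hy).1 h').1⟩
    · obtain ⟨y, hy, hzy⟩ := hC.ph.symm.exists_adj (u := z) h
      exact ⟨(z, y), rfl, hzy, fun h' => hzX ((hC.thin_adj hy h).1 h'.symm).2⟩
  choose! f hf using key
  have h1 := hm.card_le (P := fun z => z ∈ X) (Q := fun z => z ∉ X) fun z w a b hz hw => by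
    obtain ⟨w', h1, -, h3, h4⟩ := hm z (by omega)
    obtain rfl : w' = w := Fin.ext (by omega)
    rcases h3 with h3 | h3
    · exact h4 (hC.adj z h3.1 w' h3.2 hz hw)
    · exact h4 (hC.adj w' h3.2 z h3.1 hw hz).symm
  have h2 := card_split (fun z : Fin n => mt z ≠ 0) (fun z => z ∈ X)
  have h3 : #{z : Fin n | mt z ≠ 0 ∧ z ∉ X} ≤
      #{p : Fin n × Fin n | G.Adj p.1 p.2 ∧ ¬ (G.thin (side n sd 1) (side n sd 2) X).Adj p.1 p.2} := by
    refine card_le_card_of_injOn f (fun z hz => ?_) (fun z hz w hw hzw => ?_)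
    · simp only [coe_filter, mem_univ, true_and, Set.mem_ofPred_eq] at hz ⊢
      exact (hf z hz).2
    · simp only [coe_filter, mem_univ, true_and, Set.mem_ofPred_eq] at hz hw
      rw [← (hf z hz).1, ← (hf w hw).1, hzw]
  have h4 : adjCard G = adjCard (G.thin (side n sd 1) (side n sd 2) X) +
      #{p : Fin n × Fin n | G.Adj p.1 p.2 ∧
        ¬ (G.thin (side n sd 1) (side n sd 2) X).Adj p.1 p.2} := by
    rw [adjCard, adjCard, ← card_union_of_disjoint]
    · congr 1
      ext p
      simp only [mem_filter, mem_univ, true_and, mem_union]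
      have : (G.thin (side n sd 1) (side n sd 2) X).Adj p.1 p.2 → G.Adj p.1 p.2 := fun h => h.1
      tauto
    · rw [disjoint_filter]; tauto
  rw [mateCard]
  omega

end WordRAM


/-! ### Programs that mark the core, delete edges and record the reduction -/

namespace WordRAM

variable {n W : ℕ} {G : SimpleGraph (Fin n)}

/-! ### Deleting edges -/

/-- Among the vertices below `k`, `f` marks those with property `P`, and the flags `r₁` and `r₂`
tell whether some vertex of the respective side is marked. -/
structure Flags (n : ℕ) (P : Fin n → Prop) (sd f : ℕ → ℕ) (k r₁ r₂ : ℕ) : Prop where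
  mark : ∀ z : Fin n, z < k → f z ≤ 1 ∧ (f z ≠ 0 ↔ P z)
  le₁ : r₁ ≤ 1
  le₂ : r₂ ≤ 1
  flag₁ : r₁ ≠ 0 ↔ ∃ z : Fin n, z < k ∧ sd z = 1 ∧ P z
  flag₂ : r₂ ≠ 0 ↔ ∃ z : Fin n, z < k ∧ sd z = 2 ∧ P z

theorem exists_lt_succ {z : Fin n} {Q : Fin n → Prop} :
    (∃ w : Fin n, w < (z + 1 : ℕ) ∧ Q w) ↔ (∃ w : Fin n, w < (z : ℕ) ∧ Q w) ∨ Q z := by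
  constructor
  · rintro ⟨w, hw, h⟩
    rcases Roots.lt_succ hw with rfl | hw
    · exact Or.inr h
    · exact Or.inl ⟨w, hw, h⟩
  · rintro (⟨w, hw, h⟩ | h)
    · exact ⟨w, by omega, h⟩
    · exact ⟨z, by omega, h⟩

theorem Flags.succ {P : Fin n → Prop} {sd f : ℕ → ℕ} {z : Fin n} {r₁ r₂ k s₁ s₂ : ℕ}
    (h : Flags n P sd f z r₁ r₂) (hk : k ≤ 1) (hP : k ≠ 0 ↔ P z) (h₁ : s₁ ≤ 1) (h₂ : s₂ ≤ 1)
    (hs₁ : s₁ ≠ 0 ↔ r₁ ≠ 0 ∨ sd z = 1 ∧ P z) (hs₂ : s₂ ≠ 0 ↔ r₂ ≠ 0 ∨ sd z = 2 ∧ P z) :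
    Flags n P sd (Function.update f z k) (z + 1) s₁ s₂ := by
  refine ⟨fun w hw => ?_, h₁, h₂, ?_, ?_⟩
  · rw [Clos.update_apply]
    rcases Roots.lt_succ hw with rfl | hw
    · simp [hk, hP]
    · rw [if_neg (by rintro rfl; omega)]
      exact h.mark w hw
  · rw [hs₁, h.flag₁, exists_lt_succ]
  · rw [hs₂, h.flag₂, exists_lt_succ]

/-- Mark in array `9` the vertices between which edges are kept. -/
def flagProg : Prog :=
  17 <~ .lit 0 ;; 18 <~ .lit 0 ;;
  .for 5 0 (.cond (.bin .eq (.get 3 (.reg 5)) (.lit 1))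
    (.cond (.get 5 (.reg 5))
      (.cond (.get 6 (.bin .sub (.get 5 (.reg 5)) (.lit 1)))
        (.write 9 (.reg 5) (.lit 1) ;; 17 <~ .lit 1) (.write 9 (.reg 5) (.lit 0)))
      (.write 9 (.reg 5) (.lit 1) ;; 17 <~ .lit 1))
    (.cond (.bin .eq (.get 3 (.reg 5)) (.lit 2))
      (.cond (.get 6 (.reg 5)) (.write 9 (.reg 5) (.lit 0))
        (.write 9 (.reg 5) (.lit 1) ;; 18 <~ .lit 1))
      (.write 9 (.reg 5) (.lit 0)))) ;;
  -- The product of the flags is non-zero if and only if both sides have a free vertex; otherwise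
  -- all marks are replaced by those of `a` and `b`.
  .cond (.bin .mul (.reg 17) (.reg 18)) .skip
    (.for 5 0 (.write 9 (.reg 5) (.lit 0)) ;; .write 9 (.reg 3) (.lit 1) ;;
      .write 9 (.reg 1) (.lit 1))

theorem flagProg_spec (hW : Ample n W) {s : Store} (h0 : s.reg 0 = n) {a b : Fin n}
    (h1 : s.reg 1 = b) (h3 : s.reg 3 = a) (hm : IsMate G (s.arr 3) (s.arr 5))
    (hs : ∀ z : Fin n, s.arr 3 z ≤ 2) (hp : ∀ z : Fin n, s.arr 6 z ≤ n) :
    WP W flagProg s fun t s' => t ≤ 60 * n + 60 ∧ (∀ z : Fin n, s'.arr 9 z ≤ 1) ∧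
      Kept (s.arr 3) (s.arr 5) (s.arr 6) a b {z : Fin n | s'.arr 9 z ≠ 0} := by
  have hW' := hW
  unfold Ample at hW'
  have one_lt : 1 < W := by omega
  rw [flagProg, wp_seq, wp_assign]
  refine ⟨by simp only [Expr.Fits]; omega, ?_⟩
  rw [wp_seq, wp_assign]
  refine ⟨by simp only [Expr.Fits]; omega, ?_⟩
  rw [wp_seq]
  refine WP.for (n := n) (T := 30) (I := fun k s' =>
      Flags n (Free (s.arr 3) (s.arr 5) (s.arr 6)) (s.arr 3) (s'.arr 9) k (s'.reg 17) (s'.reg 18))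
    (by decide) rfl rfl (by simp [h0]) hW.succ_lt ?_ ?_ ?_
  · exact ⟨by simp, by simp [Expr.eval], by simp [Expr.eval], by simp [Expr.eval], by simp [Expr.eval]⟩
  · intro z s' hz hF hI
    have e3 : s'.arr 3 = s.arr 3 := by simpa using hF.2 3 rfl
    have e5 : s'.arr 5 = s.arr 5 := by simpa using hF.2 5 rfl
    have e6 : s'.arr 6 = s.arr 6 := by simpa using hF.2 6 rfl
    have := hs z
    have := hp z
    have := hm.le z
    have hp' : s.arr 5 z ≠ 0 → s.arr 6 (s.arr 5 z - 1) ≤ n := fun h => by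
      obtain ⟨w, hw, -⟩ := hm z h
      rw [hw]; exact hp w
    have hr₁ := hI.le₁
    have hr₂ := hI.le₂
    simp only [wp_cond, wp_skip, wp_assign, wp_seq, wp_write, Expr.Fits, Expr.eval, Op.add_apply,
      Op.sub_apply, Op.mul_apply, Op.eq_eq_zero, Op.lt_eq_zero, Op.eq_fits one_lt,
      Op.lt_fits one_lt, and_true, hz, e3, e5, e6, Expr.cost, setReg_reg, setReg_arr, setArr_reg,
      setArr_arr, ne_eq, Nat.reduceEqDiff, reduceIte, Nat.reduceAdd, Nat.reduceLeDiff, true_and,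
      not_not]
    refine ⟨by omega, fun c1 => ⟨by omega, fun c2 => ⟨?_, fun c3 => ?_, fun c3 => ?_⟩,
      fun c2 => ?_⟩, fun c1 => ⟨by omega, fun c2 => ⟨by omega, fun c3 => ?_, fun c3 => ?_⟩,
      fun c2 => ?_⟩⟩
    · have := hp' c2; omega
    · exact ⟨by omega, by omega, hI.succ (by omega) (by unfold Free; omega) (by omega) hr₂
        (by unfold Free; omega) (by unfold Free; omega)⟩
    · exact ⟨by omega, hI.succ (by omega) (by unfold Free; omega) hr₁ hr₂
        (by unfold Free; omega) (by unfold Free; omega)⟩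
    · exact ⟨by omega, by omega, hI.succ (by omega) (by unfold Free; omega) (by omega) hr₂
        (by unfold Free; omega) (by unfold Free; omega)⟩
    · exact ⟨by omega, hI.succ (by omega) (by unfold Free; omega) hr₁ hr₂
        (by unfold Free; omega) (by unfold Free; omega)⟩
    · exact ⟨by omega, by omega, hI.succ (by omega) (by unfold Free; omega) hr₁ (by omega)
        (by unfold Free; omega) (by unfold Free; omega)⟩
    · exact ⟨by omega, hI.succ (by omega) (by unfold Free; omega) hr₁ hr₂
        (by unfold Free; omega) (by unfold Free; omega)⟩
  · intro t s' ht hF hI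
    have e0 : s'.reg 0 = n := by simpa [h0] using hF.1 0 rfl
    have e1 : s'.reg 1 = b := by simpa [h1] using hF.1 1 rfl
    have e3 : s'.reg 3 = a := by simpa [h3] using hF.1 3 rfl
    have hr₁ := hI.le₁
    have hr₂ := hI.le₂
    have hr := Nat.mul_le_mul hr₁ hr₂
    rw [wp_cond]
    simp only [Expr.Fits, Expr.eval, Op.mul_apply, Expr.cost, mul_ne_zero_iff, ne_eq]
    refine ⟨by omega, fun c => ?_, fun c => ?_⟩
    · rw [wp_skip]
      refine ⟨by omega, fun z => (hI.mark z z.2).1, Or.inl ⟨?_, ?_, fun z => (hI.mark z z.2).2⟩⟩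
      · obtain ⟨z, -, h⟩ := hI.flag₁.1 c.1
        exact ⟨z, h⟩
      · obtain ⟨z, -, h⟩ := hI.flag₂.1 c.2
        exact ⟨z, h⟩
    · rw [wp_seq]
      refine WP.for (n := n) (T := 3) (I := fun k s' => ∀ z : Fin n, z < k → s'.arr 9 z = 0)
        (by decide) rfl rfl e0 hW.succ_lt (by simp) ?_ ?_
      · intro z s' hz hF hI
        simp only [wp_write, Expr.Fits, Expr.eval, Expr.cost, hz, setReg_arr, setArr_arr, reduceIte,
          Nat.reduceAdd, Nat.reduceLeDiff, true_and]
        refine ⟨by omega, fun w hw => ?_⟩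
        rw [Clos.update_apply]
        split_ifs with e
        · rfl
        · exact hI w ((Roots.lt_succ hw).resolve_left e)
      · intro t2 s2 ht2 hF2 hI2
        have g1 : s2.reg 1 = b := by simpa [e1] using hF2.1 1 rfl
        have g3 : s2.reg 3 = a := by simpa [e3] using hF2.1 3 rfl
        simp only [wp_seq, wp_write, Expr.Fits, Expr.eval, Expr.cost, g1, g3, setArr_arr,
          setArr_reg, reduceIte, Nat.reduceAdd, Clos.update_apply, Set.mem_ofPred_eq]
        refine ⟨by omega, by omega, by omega, fun z => ?_, Or.inr ⟨?_, fun z => ?_⟩⟩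
        · have := hI2 z z.2; split_ifs <;> omega
        · rintro ⟨⟨u, h1⟩, v, h2⟩
          exact (mul_eq_zero.1 c).elim (hI.flag₁.2 ⟨u, u.2, h1⟩) (hI.flag₂.2 ⟨v, v.2, h2⟩)
        · have := hI2 z z.2
          simp only [Set.mem_ofPred_eq]; split_ifs <;> simp_all

theorem index_inj {u v u' v' : Fin n} (h : (u * n + v : ℕ) = u' * n + v') : u = u' ∧ v = v' := by
  have hn : 0 < n := Fin.pos v
  have key : ∀ {x y : ℕ}, y < n → (x * n + y) / n = x := fun {x y} hy => by
    rw [add_comm, Nat.add_mul_div_right _ _ hn, Nat.div_eq_of_lt hy, zero_add]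
  have h1 : (u : ℕ) = u' := by rw [← key (x := u) v.2, h, key v'.2]
  exact ⟨Fin.ext h1, Fin.ext (by rw [h1] at h; omega)⟩

/-- Delete the edges between the two sides with an unmarked end. -/
def deleteProg : Prog :=
  .for 11 0 (.for 5 0 (.cond (.bin .eq (.bin .add (.get 3 (.reg 11)) (.get 3 (.reg 5))) (.lit 3))
    (.cond (.bin .mul (.get 9 (.reg 11)) (.get 9 (.reg 5))) .skip
      (.write 0 (.bin .add (.bin .mul (.reg 11) (.reg 0)) (.reg 5)) (.lit 0))) .skip))

/-- The array holds the adjacency matrix of `H` in the cells of `S`, and of `G` elsewhere. -/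
def MatOn (G H : SimpleGraph (Fin n)) (S : Fin n → Fin n → Prop) (A : ℕ → ℕ) : Prop :=
  ∀ u v : Fin n, (S u v → A (u * n + v) = adjEntry H u v) ∧
    (¬ S u v → A (u * n + v) = adjEntry G u v)

theorem MatOn.congr {H : SimpleGraph (Fin n)} {S S' : Fin n → Fin n → Prop} {A : ℕ → ℕ}
    (h : MatOn G H S A) (hS : ∀ u v, S u v ↔ S' u v) : MatOn G H S' A := by
  obtain rfl : S = S' := by funext u v; exact propext (hS u v)
  exact h

theorem MatOn.insert {H : SimpleGraph (Fin n)} {S : Fin n → Fin n → Prop} {A : ℕ → ℕ}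
    (h : MatOn G H S A) {u v : Fin n} (huv : H.Adj u v ↔ G.Adj u v) :
    MatOn G H (fun x y => S x y ∨ x = u ∧ y = v) A := by
  refine fun x y => ⟨?_, fun hS => (h x y).2 (by tauto)⟩
  rintro (hS | ⟨rfl, rfl⟩)
  · exact (h x y).1 hS
  · have e : adjEntry H x y = adjEntry G x y := by classical exact if_congr huv rfl rfl
    by_cases hS : S x y
    · exact (h x y).1 hS
    · rw [e]; exact (h x y).2 hS

theorem MatOn.update {H : SimpleGraph (Fin n)} {S : Fin n → Fin n → Prop} {A : ℕ → ℕ}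
    (h : MatOn G H S A) {u v : Fin n} (huv : ¬ H.Adj u v) :
    MatOn G H (fun x y => S x y ∨ x = u ∧ y = v) (Function.update A (u * n + v) 0) := by
  intro x y
  by_cases e : x = u ∧ y = v
  · obtain ⟨rfl, rfl⟩ := e
    simp [adjEntry, huv]
  · rw [Function.update_of_ne fun h => e (index_inj h)]
    exact ⟨fun hS => (h x y).1 (by tauto), fun hS => (h x y).2 (by tauto)⟩

theorem thin_side_adj {sd : ℕ → ℕ} (hs : ∀ z : Fin n, sd z ≤ 2) {X : Set (Fin n)} {u v : Fin n} :
    (G.thin (side n sd 1) (side n sd 2) X).Adj u v ↔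
      G.Adj u v ∧ (sd u + sd v = 3 → u ∈ X ∧ v ∈ X) := by
  refine and_congr_right fun _ => imp_congr_left ?_
  have := hs u
  have := hs v
  simp only [side, Set.mem_ofPred_eq]
  omega

theorem deleteProg_spec (hW : Ample n W) {s : Store} (hA : Mat G (s.arr 0)) (h0 : s.reg 0 = n)
    (hs : ∀ z : Fin n, s.arr 3 z ≤ 2) (hf : ∀ z : Fin n, s.arr 9 z ≤ 1) :
    WP W deleteProg s fun t s' => t ≤ 100 * (n + 1) * (n + 1) ∧
      Mat (G.thin (side n (s.arr 3) 1) (side n (s.arr 3) 2) {z | s.arr 9 z ≠ 0}) (s'.arr 0) := by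
  have hW' := hW
  unfold Ample at hW'
  have one_lt : 1 < W := by omega
  set H := G.thin (side n (s.arr 3) 1) (side n (s.arr 3) 2) {z | s.arr 9 z ≠ 0} with hH
  have hadj : ∀ {u v : Fin n}, H.Adj u v ↔
      G.Adj u v ∧ (s.arr 3 u + s.arr 3 v = 3 → s.arr 9 u ≠ 0 ∧ s.arr 9 v ≠ 0) := thin_side_adj hs
  refine WP.for (n := n) (T := n * 58 + 6) (I := fun k s' =>
      MatOn G H (fun u _ => u < k) (s'.arr 0))
    (by decide) rfl rfl h0 hW.succ_lt (fun u v => by simpa using hA u v) ?_ ?_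
  · rintro u s1 hu hF1 I1
    have f0 : s1.reg 0 = n := by simpa [h0] using hF1.1 0 rfl
    have f3 : s1.arr 3 = s.arr 3 := by simpa using hF1.2 3 rfl
    have f9 : s1.arr 9 = s.arr 9 := by simpa using hF1.2 9 rfl
    refine WP.for (n := n) (T := 50) (I := fun k s' =>
        MatOn G H (fun x y => x < u ∨ x = u ∧ y < k) (s'.arr 0))
      (by decide) rfl rfl f0 hW.succ_lt (I1.congr (by simp)) ?_ ?_
    · rintro v s' hv hF J1
      have e0 : s'.reg 0 = n := by simpa [f0] using hF.1 0 rfl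
      have e11 : s'.reg 11 = u := by simpa [hu] using hF.1 11 rfl
      have e3 : s'.arr 3 = s.arr 3 := by simpa [f3] using hF.2 3 rfl
      have e9 : s'.arr 9 = s.arr 9 := by simpa [f9] using hF.2 9 rfl
      have i1 := index_lt u v
      have := hs u
      have := hs v
      have := hf u
      have := hf v
      have := Nat.mul_le_mul (hf u) (hf v)
      have hS : ∀ x y : Fin n, (x < u ∨ x = u ∧ y < (v : ℕ)) ∨ x = u ∧ y = v ↔
          x < u ∨ x = u ∧ y < (v + 1 : ℕ) := by
        intro x y
        rw [or_assoc, ← and_or_left, Nat.lt_succ_iff_lt_or_eq, Fin.ext_iff (a := y)]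
      simp only [wp_cond, wp_skip, wp_write, Expr.Fits, Expr.eval, Op.add_apply, Op.sub_apply,
        Op.mul_apply, Op.eq_eq_zero, Op.lt_eq_zero, Op.eq_fits one_lt, Op.lt_fits one_lt, and_true,
        hv, e11, e0, e3, e9, Expr.cost, setReg_reg, setReg_arr, setArr_arr, ne_eq, mul_eq_zero,
        Nat.reduceEqDiff, reduceIte, Nat.reduceAdd, Nat.reduceLeDiff, true_and, not_not]
      refine ⟨by omega, fun c1 => ⟨by omega, fun c2 => ?_, fun c2 => ⟨by omega, ?_⟩⟩, fun c1 => ?_⟩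
      · exact (J1.insert (by rw [hadj]; tauto)).congr hS
      · exact (J1.update (by rw [hadj]; tauto)).congr hS
      · exact (J1.insert (by rw [hadj]; tauto)).congr hS
    · rintro t s' ht hF J1
      refine ⟨by omega, J1.congr fun x y => ?_⟩
      simp only [Fin.is_lt, and_true, Nat.lt_succ_iff_lt_or_eq, Fin.ext_iff, Fin.lt_def]
  · rintro t s' ht hF I1
    refine ⟨?_, fun u v => by simpa using I1 u v⟩
    have : n * (n * 58 + 6 + 8) = 58 * (n * n) + 14 * n := by ring
    have : 100 * (n + 1) * (n + 1) = 100 * (n * n) + 200 * n + 100 := by ring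
    omega

/-- Append the sides and the matching to the history in arrays `7` and `8`. -/
def recordProg : Prog :=
  .for 5 0 (.write 7 (.bin .add (.bin .mul (.reg 16) (.reg 0)) (.reg 5)) (.get 3 (.reg 5)) ;;
    .write 8 (.bin .add (.bin .mul (.reg 16) (.reg 0)) (.reg 5)) (.get 5 (.reg 5))) ;;
  16 <~ .bin .add (.reg 16) (.lit 1)

theorem recordProg_spec (hW : Ample n W) {s : Store} {r : ℕ} (h0 : s.reg 0 = n)
    (h16 : s.reg 16 = r) (hr : r ≤ n * n) (hs : ∀ z : Fin n, s.arr 3 z ≤ 2)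
    (hm : ∀ z : Fin n, s.arr 5 z ≤ n) :
    WP W recordProg s fun t s' => t ≤ 40 * n + 20 ∧ s'.reg 16 = r + 1 ∧
      (∀ z : Fin n, s'.arr 7 (r * n + z) = s.arr 3 z ∧ s'.arr 8 (r * n + z) = s.arr 5 z) ∧
      ∀ i < r * n, s'.arr 7 i = s.arr 7 i ∧ s'.arr 8 i = s.arr 8 i := by
  have hW' := hW
  unfold Ample at hW'
  have one_lt : 1 < W := by omega
  have hrn : r * n ≤ n * n * n := Nat.mul_le_mul_right _ hr
  rw [recordProg, wp_seq]
  refine WP.for (n := n) (T := 30) (I := fun k s' =>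
      (∀ z : Fin n, z < k → s'.arr 7 (r * n + z) = s.arr 3 z ∧ s'.arr 8 (r * n + z) = s.arr 5 z) ∧
      ∀ i < r * n, s'.arr 7 i = s.arr 7 i ∧ s'.arr 8 i = s.arr 8 i)
    (by decide) rfl rfl h0 hW.succ_lt (by simp) ?_ ?_
  · rintro z s' hz hF ⟨I1, I2⟩
    have e0 : s'.reg 0 = n := by simpa [h0] using hF.1 0 rfl
    have e16 : s'.reg 16 = r := by simpa [h16] using hF.1 16 rfl
    have e3 : s'.arr 3 = s.arr 3 := by simpa using hF.2 3 rfl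
    have e5 : s'.arr 5 = s.arr 5 := by simpa using hF.2 5 rfl
    have := hs z
    have := hm z
    simp only [wp_seq, wp_write, Expr.Fits, Expr.eval, Op.add_apply, Op.mul_apply, Expr.cost, hz,
      e0, e16, e3, e5, setReg_arr, setArr_arr, setArr_reg, reduceIte, Nat.reduceEqDiff,
      Nat.reduceAdd, Nat.reduceLeDiff, true_and]
    refine ⟨by omega, by omega, fun w hw => ?_, fun i hi => ?_⟩
    · by_cases e : w = z
      · simp [e]
      · have : (w : ℕ) ≠ z := fun e' => e (Fin.ext e')
        rw [Function.update_of_ne (by omega), Function.update_of_ne (by omega)]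
        exact I1 w (by omega)
    · rw [Function.update_of_ne (by omega), Function.update_of_ne (by omega)]
      exact I2 i hi
  · rintro t s' ht hF ⟨I1, I2⟩
    have e16 : s'.reg 16 = r := by simpa [h16] using hF.1 16 rfl
    simp only [wp_assign, Expr.Fits, Expr.eval, Op.add_apply, e16, Expr.cost, setReg_reg,
      setReg_arr, reduceIte]
    exact ⟨by omega, by omega, trivial, fun z => I1 z z.2, I2⟩

end WordRAM


/-! ### The cost of a reduction, the history, and the treatment of one pair -/

namespace WordRAM

open SimpleGraph

variable {n W : ℕ} {G H : SimpleGraph (Fin n)}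

/-! ### One reduction -/

/-- Reduce the graph by means of the PH pair in array `3`. -/
def reduceProg : Prog := matchProg ;; flagProg ;; deleteProg ;; recordProg

/-- The number of adjacent ordered pairs, weighted by `600 (n + 1)²`, is a potential. By
`thin_adjCard` its decrease pays for the augmentations, and one further unit covers the rest of the
round. -/
theorem reduceProg_spec (hW : Ample n W) {s : Store} (hA : Mat G (s.arr 0)) (h0 : s.reg 0 = n)
    {a b : Fin n} {r : ℕ} (h1 : s.reg 1 = b) (h3 : s.reg 3 = a) (h16 : s.reg 16 = r)
    (hr : r ≤ n * n) (hs : ∀ z : Fin n, s.arr 3 z ≤ 2)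
    (hK : G.IsPHPair (side n (s.arr 3) 1) (side n (s.arr 3) 2)) (ha : s.arr 3 a = 1)
    (hb : s.arr 3 b = 2) (hab : G.Adj a b) :
    WP W reduceProg s fun t s' => ∃ (X : Set (Fin n)) (mt : ℕ → ℕ),
      G.IsCore (side n (s.arr 3) 1) (side n (s.arr 3) 2) X ∧
      Mat (G.thin (side n (s.arr 3) 1) (side n (s.arr 3) 2) X) (s'.arr 0) ∧
      Step G (G.thin (side n (s.arr 3) 1) (side n (s.arr 3) 2) X) (s.arr 3) mt ∧
      s'.reg 16 = r + 1 ∧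
      (∀ z : Fin n, s'.arr 7 (r * n + z) = s.arr 3 z ∧ s'.arr 8 (r * n + z) = mt z) ∧
      (∀ i < r * n, s'.arr 7 i = s.arr 7 i ∧ s'.arr 8 i = s.arr 8 i) ∧
      t + 600 * ((n + 1) * (n + 1)) *
        adjCard (G.thin (side n (s.arr 3) 1) (side n (s.arr 3) 2) X) ≤
        600 * ((n + 1) * (n + 1)) * (adjCard G + 1) := by
  refine WP.seq ((matchProg_spec (G := G) hW hA h0 hs).mono ?_)
  rintro t1 s1 F1 ⟨ht1, hm, hS, hP⟩
  have a0 : s1.reg 0 = n := by simpa [h0] using F1.1 0 rfl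
  have a1 : s1.reg 1 = b := by simpa [h1] using F1.1 1 rfl
  have a3 : s1.reg 3 = a := by simpa [h3] using F1.1 3 rfl
  have a16 : s1.reg 16 = r := by simpa [h16] using F1.1 16 rfl
  have aA : s1.arr 0 = s.arr 0 := F1.2 0 rfl
  have aS : s1.arr 3 = s.arr 3 := F1.2 3 rfl
  have a7 : s1.arr 7 = s.arr 7 := F1.2 7 rfl
  have a8 : s1.arr 8 = s.arr 8 := F1.2 8 rfl
  refine WP.seq ((flagProg_spec (G := G) hW a0 a1 a3 (by rwa [aS]) (by rwa [aS])
    hS.par_le).mono ?_)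
  rintro t2 s2 F2 ⟨ht2, hf, hX⟩
  have b0 : s2.reg 0 = n := by simpa [a0] using F2.1 0 rfl
  have b16 : s2.reg 16 = r := by simpa [a16] using F2.1 16 rfl
  have bA : s2.arr 0 = s.arr 0 := by simpa [aA] using F2.2 0 rfl
  have bS : s2.arr 3 = s.arr 3 := by simpa [aS] using F2.2 3 rfl
  have b5 : s2.arr 5 = s1.arr 5 := F2.2 5 rfl
  have b7 : s2.arr 7 = s.arr 7 := by simpa [a7] using F2.2 7 rfl
  have b8 : s2.arr 8 = s.arr 8 := by simpa [a8] using F2.2 8 rfl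
  rw [aS] at hX
  have hC := hX.isCore hS hP hm hK ha hb hab
  refine WP.seq ((deleteProg_spec (G := G) hW (by rwa [bA]) b0 (by rwa [bS]) hf).mono ?_)
  rintro t3 s3 F3 ⟨ht3, hD⟩
  have c0 : s3.reg 0 = n := by simpa [b0] using F3.1 0 rfl
  have c16 : s3.reg 16 = r := by simpa [b16] using F3.1 16 rfl
  have cS : s3.arr 3 = s.arr 3 := by simpa [bS] using F3.2 3 rfl
  have c5 : s3.arr 5 = s1.arr 5 := by simpa [b5] using F3.2 5 rfl
  have c7 : s3.arr 7 = s.arr 7 := by simpa [b7] using F3.2 7 rfl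
  have c8 : s3.arr 8 = s.arr 8 := by simpa [b8] using F3.2 8 rfl
  refine (recordProg_spec hW c0 c16 hr (by rwa [cS]) (by rw [c5]; exact hm.le)).mono ?_
  rintro t4 s4 F4 ⟨ht4, d16, hR, hR'⟩
  have dA : s4.arr 0 = s3.arr 0 := F4.2 0 rfl
  rw [bS] at hD
  rw [cS, c5] at hR
  rw [c7, c8] at hR'
  refine ⟨_, s1.arr 5, hC, by rwa [dA], hX.step hS hP hm hK hs, d16, hR, hR', ?_⟩
  have key := thin_adjCard hm hC
  set x := adjCard (G.thin (side n (s.arr 3) 1) (side n (s.arr 3) 2) {z | s2.arr 9 z ≠ 0})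
  have k1 := Nat.mul_le_mul_left (300 * ((n + 1) * (n + 1))) key
  have e1 : 200 * (n + 1) * (n + 1) * (mateCard n (s1.arr 5) + 2) =
    200 * ((n + 1) * (n + 1) * mateCard n (s1.arr 5)) + 400 * ((n + 1) * (n + 1)) := by ring
  have e2 : 300 * ((n + 1) * (n + 1)) * (mateCard n (s1.arr 5) + 2 * x) =
    300 * ((n + 1) * (n + 1) * mateCard n (s1.arr 5)) + 600 * ((n + 1) * (n + 1)) * x := by ring
  have e3 : 300 * ((n + 1) * (n + 1)) * (2 * adjCard G) + 600 * ((n + 1) * (n + 1)) =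
    600 * ((n + 1) * (n + 1)) * (adjCard G + 1) := by ring
  have e4 : 100 * (n + 1) * (n + 1) = 100 * ((n + 1) * (n + 1)) := by ring
  have e5 : (n + 1) * (n + 1) = n * n + 2 * n + 1 := by ring
  omega

/-! ### The history of the reductions -/

/-- The arrays `f` and `f'` record `r` reductions that lead from `G` to `H`. -/
def History (G H : SimpleGraph (Fin n)) (r : ℕ) (f f' : ℕ → ℕ) : Prop :=
  ∃ g : ℕ → SimpleGraph (Fin n), g 0 = G ∧ g r = H ∧
    ∀ i < r, Step (g i) (g (i + 1)) (fun z => f (i * n + z)) (fun z => f' (i * n + z))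

theorem IsMate.congr {sd mt sd' mt' : ℕ → ℕ} (h : IsMate G sd mt)
    (hs : ∀ z : Fin n, sd' z = sd z) (hm : ∀ z : Fin n, mt' z = mt z) : IsMate G sd' mt' := by
  simpa only [IsMate, hs, hm] using h

theorem Step.congr {sd mt sd' mt' : ℕ → ℕ} (h : Step G H sd mt) (hs : ∀ z : Fin n, sd' z = sd z)
    (hm : ∀ z : Fin n, mt' z = mt z) : Step G H sd' mt' := by
  refine ⟨?_, ?_, ?_, h.le, ?_, h.mate.congr hs hm, ?_⟩
  · simpa only [hs] using h.sd_le
  · simpa only [hs] using h.clique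
  · simpa only [hs] using h.homogeneous
  · simpa only [hs] using h.agree
  · simpa only [hs, mateCard, hm] using h.core

theorem History.zero {f f' : ℕ → ℕ} : History G G 0 f f' :=
  ⟨fun _ => G, rfl, rfl, fun i hi => by omega⟩

theorem History.snoc {r : ℕ} {f f' k k' sd mt : ℕ → ℕ} {H' : SimpleGraph (Fin n)}
    (h : History G H r f f') (hS : Step H H' sd mt)
    (h1 : ∀ z : Fin n, k (r * n + z) = sd z ∧ k' (r * n + z) = mt z)
    (h2 : ∀ i < r * n, k i = f i ∧ k' i = f' i) : History G H' (r + 1) k k' := by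
  obtain ⟨g, g0, gr, hg⟩ := h
  refine ⟨fun i => if i ≤ r then g i else H', by simp [g0], by simp, fun i hi => ?_⟩
  by_cases e : i = r
  · subst e
    simp only [le_refl, if_true, gr, Nat.not_succ_le_self, if_false]
    exact hS.congr (fun z => (h1 z).1) fun z => (h1 z).2
  · simp only [if_pos (by omega : i ≤ r), if_pos (by omega : i + 1 ≤ r)]
    have hlt : ∀ z : Fin n, i * n + z < r * n := fun z => by
      have := Nat.mul_le_mul_right n (by omega : i + 1 ≤ r)
      rw [Nat.succ_mul] at this
      omega
    exact (hg i (by omega)).congr (fun z => (h2 _ (hlt z)).1) fun z => (h2 _ (hlt z)).2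

theorem History.le {r : ℕ} {f f' : ℕ → ℕ} (h : History G H r f f') : H ≤ G := by
  obtain ⟨g, rfl, rfl, hg⟩ := h
  suffices ∀ i ≤ r, g i ≤ g 0 from this r le_rfl
  intro i
  induction i with
  | zero => exact fun _ => le_rfl
  | succ i ih => exact fun hi => (hg i hi).le.trans (ih (by omega))

theorem History.cliqueNum_eq {r : ℕ} {f f' : ℕ → ℕ} (h : History G H r f f') :
    G.cliqueNum = H.cliqueNum := by
  obtain ⟨g, rfl, rfl, hg⟩ := h
  suffices ∀ i ≤ r, (g 0).cliqueNum = (g i).cliqueNum from this r le_rfl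
  intro i
  induction i with
  | zero => exact fun _ => rfl
  | succ i ih => exact fun hi => (ih (by omega)).trans (hg i hi).cliqueNum_eq

/-! ### One seed -/

theorem _root_.SimpleGraph.IsSeed.adj {b b' : Fin n} (h : G.IsSeed b b') : G.Adj b b' := by
  obtain ⟨K₁, K₂, hK, hb, hb', a, -, -, -, hab, hab', -⟩ := h
  exact hK.symm.clique hb hb' (by rintro rfl; exact hab' hab)

theorem Priv.ne_zero {b b' : Fin n} {r : ℕ} (h : Priv G b b' n r) {a : Fin n} (hab : G.Adj a b)
    (hab' : ¬ G.Adj a b') (hne : a ≠ b') : r ≠ 0 := by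
  rcases h with ⟨-, h⟩ | ⟨a, h, -⟩
  · exact absurd (h a a.2 hab hab') hne
  · omega

theorem _root_.SimpleGraph.IsSeed.ne_zero {b b' : Fin n} (h : G.IsSeed b b') {r r' : ℕ}
    (hr : Priv G b b' n r) (hr' : Priv G b' b n r') : r ≠ 0 ∧ r' ≠ 0 := by
  obtain ⟨K₁, K₂, hK, hb, hb', a, ha, a', ha', h1, h2, h3, h4⟩ := h
  exact ⟨hr.ne_zero h1 h2 (by rintro rfl; exact hK.notMem ha hb'),
    hr'.ne_zero h3 h4 (by rintro rfl; exact hK.notMem ha' hb)⟩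

/-- By minimality the sides lie inside the cliques of any PH pair that witnesses the seed. So a
failure of the clique test shows that there is no such pair. -/
theorem Clos.fine {b b' a : Fin n} {sd q : ℕ → ℕ} {len : ℕ} (h : Clos G b b' a sd q len)
    (hs : G.IsSeed b b') (u v : Fin n) : Fine G sd u v := by
  intro hu huv hne
  obtain ⟨K₁, K₂, hK, hb, hb', -⟩ := hs
  obtain ⟨m1, m2⟩ := h.minimal K₁ K₂ hK hb hb'
  have := h.sd_le u
  rcases (by omega : sd u = 1 ∨ sd u = 2) with e | e
  · exact hK.clique (m1 u e) (m1 v (by omega)) hne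
  · exact hK.symm.clique (m2 u e) (m2 v (by omega)) hne

/-- Make sure that `reg 1, reg 2` is not a seed. -/
def seedProg : Prog :=
  .cond (.adj 1 2)
    (privProg ;; .cond (.reg 3)
      (.cond (.reg 4)
        (3 <~ .bin .sub (.reg 3) (.lit 1) ;; closProg ;; checkProg ;;
          .cond (.reg 10) reduceProg .skip) .skip) .skip) .skip

/-- A missing edge, a missing private neighbour and a side that is not a clique each refute the
seed; in the remaining case the reduction destroys it. A non-adjacent pair costs constant time, so
only edges are charged `O(n²)`. -/
theorem seedProg_spec (hW : Ample n W) {s : Store} (hA : Mat H (s.arr 0)) (h0 : s.reg 0 = n)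
    {b b' : Fin n} {r : ℕ} (h1 : s.reg 1 = b) (h2 : s.reg 2 = b') (h16 : s.reg 16 = r)
    (hr : r ≤ n * n) (hH : History G H r (s.arr 7) (s.arr 8)) :
    WP W seedProg s fun t s' => ∃ H', Mat H' (s'.arr 0) ∧
      History G H' (s'.reg 16) (s'.arr 7) (s'.arr 8) ∧
      s'.reg 16 ≤ r + adjEntry H b b' ∧ (∀ x y, H'.IsSeed x y → H.IsSeed x y) ∧
      ¬ H'.IsSeed b b' ∧ t + 600 * ((n + 1) * (n + 1)) * adjCard H' ≤
        600 * ((n + 1) * (n + 1)) * adjCard H + 20 +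
        1000 * ((n + 1) * (n + 1)) * adjEntry H b b' := by
  have hW' := hW
  unfold Ample at hW'
  have one_lt : 1 < W := by omega
  have i1 := index_lt b b'
  have := adjEntry_le (G := H) b b'
  rw [seedProg, wp_cond]
  simp only [Expr.Fits, Expr.eval, Op.add_apply, Op.mul_apply, Expr.cost, h0, h1, h2, hA b b',
    ne_eq, adjEntry_eq_zero, not_not, wp_skip]
  refine ⟨by omega, fun hbb' => ?_, fun hbb' => ⟨H, hA, by rwa [h16], by omega, fun _ _ => id,
    fun h => hbb' h.adj, by omega⟩⟩
  have hE : adjEntry H b b' = 1 := by simp [adjEntry, hbb']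
  rw [hE]
  refine WP.seq ((privProg_spec (G := H) hW hA h0 h1 h2).mono ?_)
  rintro t1 s1 F1 ⟨ht1, p3, p4⟩
  have a0 : s1.reg 0 = n := by simpa [h0] using F1.1 0 rfl
  have a1 : s1.reg 1 = b := by simpa [h1] using F1.1 1 rfl
  have a2 : s1.reg 2 = b' := by simpa [h2] using F1.1 2 rfl
  have a16 : s1.reg 16 = r := by simpa [h16] using F1.1 16 rfl
  have aA : s1.arr 0 = s.arr 0 := F1.2 0 rfl
  have a7 : s1.arr 7 = s.arr 7 := F1.2 7 rfl
  have a8 : s1.arr 8 = s.arr 8 := F1.2 8 rfl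
  have e5 : (n + 1) * (n + 1) = n * n + 2 * n + 1 := by ring
  have same : ∀ s' : Store, s'.arr 0 = s.arr 0 → s'.arr 7 = s.arr 7 → s'.arr 8 = s.arr 8 →
      s'.reg 16 = r → Mat H (s'.arr 0) ∧
      History G H (s'.reg 16) (s'.arr 7) (s'.arr 8) ∧ s'.reg 16 ≤ r + 1 ∧
      ∀ x y, H.IsSeed x y → H.IsSeed x y := fun s' c1 c2 c3 c4 => by
    rw [c1, c2, c3, c4]; exact ⟨hA, hH, by omega, fun _ _ => id⟩
  have le3 : s1.reg 3 ≤ n := by rcases p3 with h | ⟨a, h, -⟩ <;> omega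
  have le4 : s1.reg 4 ≤ n := by rcases p4 with h | ⟨a, h, -⟩ <;> omega
  rw [wp_cond]
  simp only [Expr.Fits, Expr.eval, Expr.cost]
  refine ⟨by omega, fun c3 => ?_, fun c3 => ?_⟩
  swap
  · rw [wp_skip]
    obtain ⟨q1, q2, q3, q4⟩ := same s1 aA a7 a8 a16
    exact ⟨H, q1, q2, q3, q4, fun h => (h.ne_zero p3 p4).1 c3, by omega⟩
  rw [wp_cond]
  simp only [Expr.Fits, Expr.eval, Expr.cost]
  refine ⟨by omega, fun c4 => ?_, fun c4 => ?_⟩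
  swap
  · rw [wp_skip]
    obtain ⟨q1, q2, q3, q4⟩ := same s1 aA a7 a8 a16
    exact ⟨H, q1, q2, q3, q4, fun h => (h.ne_zero p3 p4).2 c4, by omega⟩
  obtain ⟨a, ha, hab, hab', hne⟩ := p3.resolve_left fun h => c3 h.1
  obtain ⟨a', -, hab2, hab2', hne'⟩ := p4.resolve_left fun h => c4 h.1
  rw [wp_seq, wp_assign]
  simp only [Expr.Fits, Expr.eval, Expr.cost, Op.sub_apply, ha, Nat.add_sub_cancel]
  refine ⟨by omega, ?_⟩
  refine WP.seq ((closProg_spec (G := H) (b := b) (b' := b') (a := a) hW (by simpa [aA] using hA)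
    (by simpa using a0) (by simpa using a1) (by simpa using a2) (by simp) hbb'.ne hab hab'
    hne).mono ?_)
  rintro t2 s2 F2 ⟨ht2, hC, hP⟩
  have b0 : s2.reg 0 = n := by simpa [a0] using F2.1 0 rfl
  have b1 : s2.reg 1 = b := by simpa [a1] using F2.1 1 rfl
  have b3 : s2.reg 3 = a := by simpa using F2.1 3 rfl
  have b16 : s2.reg 16 = r := by simpa [a16] using F2.1 16 rfl
  have bA : s2.arr 0 = s.arr 0 := by simpa [aA] using F2.2 0 rfl
  have b7 : s2.arr 7 = s.arr 7 := by simpa [a7] using F2.2 7 rfl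
  have b8 : s2.arr 8 = s.arr 8 := by simpa [a8] using F2.2 8 rfl
  refine WP.seq ((checkProg_spec (G := H) hW (by rwa [bA]) b0 hC.sd_le).mono ?_)
  rintro t3 s3 F3 ⟨ht3, hy, hno, h10⟩
  have d0 : s3.reg 0 = n := by simpa [b0] using F3.1 0 rfl
  have d1 : s3.reg 1 = b := by simpa [b1] using F3.1 1 rfl
  have d3 : s3.reg 3 = a := by simpa [b3] using F3.1 3 rfl
  have d16 : s3.reg 16 = r := by simpa [b16] using F3.1 16 rfl
  have dA : s3.arr 0 = s.arr 0 := by simpa [bA] using F3.2 0 rfl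
  have d7 : s3.arr 7 = s.arr 7 := by simpa [b7] using F3.2 7 rfl
  have d8 : s3.arr 8 = s.arr 8 := by simpa [b8] using F3.2 8 rfl
  have dS : s3.arr 3 = s2.arr 3 := F3.2 3 rfl
  have e4 : 100 * (n + 1) * (n + 1) = 100 * ((n + 1) * (n + 1)) := by ring
  rw [wp_cond]
  simp only [Expr.Fits, Expr.eval, Expr.cost]
  refine ⟨by omega, fun c => ?_, fun c => ?_⟩
  · obtain ⟨hK, -⟩ := hC.isPHPair hP (hy c) hab hab' hab2 hab2' hne'
    refine (reduceProg_spec (G := H) hW (by rwa [dA]) d0 d1 d3 d16 hr (by rw [dS]; exact hC.sd_le)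
      (by rwa [dS]) (by rw [dS]; exact hC.sd_a) (by rw [dS]; exact hC.sd_b) hab).mono ?_
    rintro t4 s4 F4 ⟨X, mt, hcore, hM, hS, f16, hR, hR', ht4⟩
    rw [d7, d8] at hR'
    refine ⟨_, hM, ?_, by omega, fun x y => hcore.isSeed_of_thin,
      hcore.not_isSeed_thin (by rw [dS]; exact hC.sd_b) (by rw [dS]; exact hC.sd_b'), ?_⟩
    · rw [f16]
      exact hH.snoc hS hR hR'
    · have : 600 * ((n + 1) * (n + 1)) * (adjCard H + 1) =
        600 * ((n + 1) * (n + 1)) * adjCard H + 600 * ((n + 1) * (n + 1)) := by ring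
      omega
  · rw [wp_skip]
    obtain ⟨q1, q2, q3, q4⟩ := same s3 dA d7 d8 d16
    refine ⟨H, q1, q2, q3, q4, fun h => ?_, by omega⟩
    obtain ⟨u, v, huv⟩ := hno c
    exact huv (hC.fine h u v)

end WordRAM


/-! ### The sweep over all ordered pairs -/

namespace WordRAM

open Finset SimpleGraph

variable {n W : ℕ} {G H : SimpleGraph (Fin n)}

open Classical in
/-- The number of ordered pairs of adjacent vertices among the first `k` pairs. -/
noncomputable def adjBelow (G : SimpleGraph (Fin n)) (k : ℕ) : ℕ :=
  #{p : Fin n × Fin n | G.Adj p.1 p.2 ∧ (p.1 * n + p.2 : ℕ) < k}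

theorem adjBelow_succ (u v : Fin n) :
    adjBelow G (u * n + v + 1) = adjBelow G (u * n + v) + adjEntry G u v := by
  classical
  have e : ({p : Fin n × Fin n | G.Adj p.1 p.2 ∧ (p.1 * n + p.2 : ℕ) < u * n + v + 1} :
      Finset (Fin n × Fin n)) = ({p : Fin n × Fin n | G.Adj p.1 p.2 ∧
        (p.1 * n + p.2 : ℕ) < u * n + v} : Finset (Fin n × Fin n)) ∪
        if G.Adj u v then {(u, v)} else ∅ := by
    ext ⟨x, y⟩
    simp only [mem_filter, mem_univ, true_and, mem_union, Nat.lt_succ_iff_lt_or_eq]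
    by_cases hxy : (x * n + y : ℕ) = u * n + v
    · obtain ⟨rfl, rfl⟩ := index_inj hxy
      split_ifs with h <;> simp [h]
    · have : (x, y) ≠ (u, v) := by rintro ⟨⟩; exact hxy rfl
      split_ifs
      · simp only [hxy, or_false, mem_singleton, this]
      · simp [hxy]
  rw [adjBelow, adjBelow, adjEntry]
  simp only [e]
  rw [card_union_of_disjoint]
  · split_ifs <;> simp
  · split_ifs <;> simp

theorem adjBelow_le (k : ℕ) : adjBelow G k ≤ adjCard G := by
  classical
  exact card_le_card fun p => by simp only [mem_filter]; tauto

theorem adjCard_le : adjCard G ≤ n * n :=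
  (card_le_univ _).trans (by simp)

/-- The first `m` pairs are not seeds of the current graph `H`, which arises from `G` in `t`
steps. -/
def CoreInv (G : SimpleGraph (Fin n)) (m e t : ℕ) (s : Store) : Prop :=
  ∃ H : SimpleGraph (Fin n), Mat H (s.arr 0) ∧
    History G H (s.reg 16) (s.arr 7) (s.arr 8) ∧ s.reg 16 ≤ adjBelow G m ∧
    (∀ x y : Fin n, (x * n + y : ℕ) < m → ¬ H.IsSeed x y) ∧
    t + 600 * ((n + 1) * (n + 1)) * adjCard H ≤
      600 * ((n + 1) * (n + 1)) * adjCard G + 1000 * ((n + 1) * (n + 1)) * adjBelow G m + e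

/-- Compute a graph without PH pairs in array `0`, with the history in arrays `7` and `8`. -/
def coreProg : Prog := 16 <~ .lit 0 ;; .for 1 0 (.for 2 0 seedProg)

/-- One sweep suffices because seeds, once gone, never return; at the end no seed is left, hence no
PH pair. -/
theorem coreProg_spec (hW : Ample n W) {s : Store} (hA : Mat G (s.arr 0)) (h0 : s.reg 0 = n) :
    WP W coreProg s fun t s' => ∃ H : SimpleGraph (Fin n), Mat H (s'.arr 0) ∧
      History G H (s'.reg 16) (s'.arr 7) (s'.arr 8) ∧ s'.reg 16 ≤ adjCard G ∧
      (¬ ∃ K₁ K₂ : Set (Fin n), H.IsPHPair K₁ K₂) ∧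
      t ≤ 1600 * ((n + 1) * (n + 1)) * (adjCard G + 1) := by
  have hW' := hW
  unfold Ample at hW'
  rw [coreProg, wp_seq, wp_assign]
  refine ⟨by simp only [Expr.Fits]; omega, ?_⟩
  -- Each pair has an overhead of 20 steps in `seedProg` and 8 in the inner loop; each row has 6 for
  -- the inner loop and 8 for the outer one.
  refine WP.forTime (n := n) (I := fun k t s' => CoreInv G (k * n) (28 * (k * n) + 14 * k) t s')
    (by decide) rfl rfl (by simp [h0]) hW.succ_lt ?_ ?_ ?_
  · refine ⟨G, by simpa using hA, ?_, ?_, fun x y h => by omega, by simp⟩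
    · simpa [Expr.eval] using History.zero
    · simp [Expr.eval]
  · rintro u t1 s1 hu hu1 F1 hI
    have a0 : s1.reg 0 = n := by simpa [h0] using F1.1 0 rfl
    refine WP.forTime (n := n)
      (I := fun v t s' => CoreInv G (u * n + v) (28 * (u * n) + 14 * u + 28 * v) (t1 + t) s')
      (by decide) rfl rfl a0 hW.succ_lt ?_ ?_ ?_
    · simpa [CoreInv] using hI
    · rintro v t s' hv hv2 F ⟨H, I1, I2, I3, I4, I5⟩
      have b0 : s'.reg 0 = n := by simpa [a0] using F.1 0 rfl
      have b1 : s'.reg 1 = u := by simpa [hu1] using F.1 1 rfl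
      have k1 := adjBelow_le (G := G) (u * n + v)
      have k2 := adjCard_le (G := G)
      have k3 := adjBelow_succ (G := G) ⟨u, hu⟩ ⟨v, hv⟩
      -- Edges are only deleted, so the work on a pair can be charged to the original graph, where
      -- each edge is counted once in either direction.
      have k4 : adjEntry H ⟨u, hu⟩ ⟨v, hv⟩ ≤ adjEntry G ⟨u, hu⟩ ⟨v, hv⟩ := by
        simp only [adjEntry]
        split_ifs with h h'
        · exact le_rfl
        · exact absurd (I2.le h) h'
        all_goals omega
      simp only at k3
      refine (seedProg_spec hW I1 b0 (b := ⟨u, hu⟩) (b' := ⟨v, hv⟩) b1 hv2 rfl (by omega)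
        I2).mono ?_
      rintro t' s'' F' ⟨H', J1, J2, J3, J4, J5, J6⟩
      refine ⟨H', J1, by simpa using J2, ?_, fun x y hxy h => ?_, ?_⟩
      · simp only [setReg_reg, Nat.reduceEqDiff, reduceIte, ← add_assoc]
        omega
      · by_cases e : (x * n + y : ℕ) = u * n + v
        · obtain ⟨rfl, rfl⟩ := index_inj (u' := ⟨u, hu⟩) (v' := ⟨v, hv⟩) e
          exact J5 h
        · exact I4 x y (by omega) (J4 x y h)
      · have e1 := Nat.mul_le_mul_left (1000 * ((n + 1) * (n + 1))) k4
        rw [← add_assoc (u * n), k3, mul_add (1000 * ((n + 1) * (n + 1)))]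
        omega
    · rintro t s' F hI'
      have e : (u + 1) * n = u * n + n := by ring
      simp only [CoreInv, setReg_reg, setReg_arr, Nat.reduceEqDiff, reduceIte, e] at hI' ⊢
      obtain ⟨H, I1, I2, I3, I4, I5⟩ := hI'
      exact ⟨H, I1, I2, I3, I4, by omega⟩
  · rintro t s' F ⟨H, I1, I2, I3, I4, I5⟩
    have k1 := adjBelow_le (G := G) (n * n)
    refine ⟨H, I1, I2, by omega, ?_, ?_⟩
    · rintro ⟨K₁, K₂, hK⟩
      obtain ⟨b, b', h⟩ := hK.exists_isSeed
      exact I4 b b' (index_lt b b') h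
    · have e1 := Nat.mul_le_mul_left (1000 * ((n + 1) * (n + 1))) k1
      have e2 : 1600 * ((n + 1) * (n + 1)) * (adjCard G + 1) =
        600 * ((n + 1) * (n + 1)) * adjCard G + 1000 * ((n + 1) * (n + 1)) * adjCard G +
          1600 * (n * n + 2 * n + 1) := by ring
      simp only [Expr.cost]
      omega

end WordRAM


/-! ### Rebuilding the vertex orders from the history -/

namespace WordRAM

variable {n W : ℕ} {G H : SimpleGraph (Fin n)}

/-! ### Lists in arrays -/

/-- The array starts with the entries of the list. -/
def ListIn (L : List ℕ) (A : ℕ → ℕ) : Prop := ∀ i < L.length, A i = L.getD i 0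

theorem ListIn.append {L : List ℕ} {A : ℕ → ℕ} (h : ListIn L A) (x : ℕ) :
    ListIn (L ++ [x]) (Function.update A L.length x) := by
  intro i hi
  by_cases e : i = L.length
  · subst e
    simp
  · rw [List.length_append, List.length_singleton] at hi
    rw [Function.update_of_ne e, List.getD_append _ _ _ _ (by omega)]
    exact h i (by omega)

/-- Append the values of `e` at those `reg 5` with `c` to the list in array `a`, the length of
which is in register `l`. -/
def selProg (a l : ℕ) (c e : Expr) : Prog :=
  .for 5 0 (.cond c (.write a (.reg l) e ;; l <~ .bin .add (.reg l) (.lit 1)) .skip)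

/-- The program extends a given list, so that two calls in succession produce the concatenations of
which the orders and palettes consist. -/
theorem selProg_spec (hW : Ample n W) {s : Store} {a l : ℕ} {c e : Expr} (hl : l ≠ 5) (hl0 : l ≠ 0)
    (h0 : s.reg 0 = n) {L : List ℕ} (hL : ListIn L (s.arr a)) (hlen : s.reg l = L.length)
    (hn : L.length ≤ n) {p : ℕ → Prop} [DecidablePred p] {f : ℕ → ℕ}
    (hc : ∀ (z : Fin n) s', s'.reg 5 = (z : ℕ) → Frame (selProg a l c e) s s' →
      c.Fits W s' ∧ (c.eval s' ≠ 0 ↔ p z) ∧ (p z → e.Fits W s' ∧ e.eval s' = f z)) :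
    WP W (selProg a l c e) s fun t s' => t ≤ n * (c.cost + e.cost + 20) + 6 ∧
      ListIn (L ++ (sel n p).map f) (s'.arr a) ∧ s'.reg l = (L ++ (sel n p).map f).length := by
  have hW' := hW
  unfold Ample at hW'
  refine WP.for (n := n) (T := c.cost + e.cost + 12) (I := fun k s' =>
      ListIn (L ++ (sel k p).map f) (s'.arr a) ∧ s'.reg l = (L ++ (sel k p).map f).length)
    (by decide) (by simp [Prog.wr, hl]) (by simp [Prog.wr, hl0]) h0 hW.succ_lt ?_ ?_ ?_
  · simpa [sel, hl] using ⟨hL, hlen⟩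
  · rintro z s' hz hF ⟨I1, I2⟩
    obtain ⟨c1, c2, c3⟩ := hc z s' hz hF
    have hlt : s'.reg l ≤ n + n := by
      rw [I2, List.length_append, List.length_map]
      have := length_sel_le (n := z) (p := p)
      omega
    rw [sel_succ, wp_cond]
    refine ⟨c1, fun h => ?_, fun h => ?_⟩
    · have hp := c2.1 h
      obtain ⟨f1, f2⟩ := c3 hp
      simp only [if_pos hp, List.map_append, ← List.append_assoc, List.map_cons, List.map_nil,
        wp_seq, wp_write, wp_assign, Expr.Fits, Expr.eval, Op.add_apply, Expr.cost, f1, f2,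
        setArr_reg, setArr_arr, setReg_reg, setReg_arr, reduceIte, hl, and_true]
      refine ⟨by omega, by omega, by omega, ?_, ?_⟩
      · rw [I2]; exact I1.append _
      · rw [I2]; simp; ring
    · rw [if_neg fun hp => c2.2 hp h, List.append_nil, wp_skip]
      exact ⟨by omega, by simpa using I1, by simpa [hl] using I2⟩
  · rintro t s' ht hF ⟨I1, I2⟩
    exact ⟨by convert ht using 2, I1, I2⟩

/-! ### Recolouring -/

/-- The vertex `reg 5` in the part number `reg 16` of the history in array `a`. -/
abbrev Expr.past (a : ℕ) : Expr := .get a (.bin .add (.bin .mul (.reg 16) (.reg 0)) (.reg 5))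

theorem Op.eq_apply_le (a b : ℕ) : Op.eq.apply a b ≤ 1 := by
  simp only [Op.apply]; split_ifs <;> omega

/-- Multiplication serves as conjunction of tests. The product fits into a word because the first
factor is at most `1`. -/
theorem Expr.eq_mul_spec {s : Store} {e e' : Expr} {x y k : ℕ} (hk : k < W) (one_lt : 1 < W)
    (he : e.Fits W s) (hx : e.eval s = x) (he' : e'.Fits W s) (hy : e'.eval s = y) (hyW : y < W) :
    (Expr.bin .mul (.bin .eq e (.lit k)) e').Fits W s ∧
      ((Expr.bin .mul (.bin .eq e (.lit k)) e').eval s ≠ 0 ↔ x = k ∧ y ≠ 0) := by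
  have k1 := Nat.mul_le_mul (Op.eq_apply_le x k) (le_refl y)
  simp only [Expr.Fits, Expr.eval, he, he', hx, hy, hk, Op.mul_apply, mul_ne_zero_iff, ne_eq,
    Op.eq_eq_zero, not_not, Op.eq_fits one_lt, true_and, and_true]
  omega

theorem Expr.eq_spec {s : Store} {e : Expr} {x k : ℕ} (hk : k < W) (one_lt : 1 < W)
    (he : e.Fits W s) (hx : e.eval s = x) :
    (Expr.bin .eq e (.lit k)).Fits W s ∧ (Expr.bin .eq e (.lit k)).eval s = Op.eq.apply x k := by
  simp only [Expr.Fits, Expr.eval, he, hx, hk, Op.eq_fits one_lt, true_and]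

theorem Expr.sub_spec {s : Store} {e : Expr} {x k : ℕ} (hk : k < W) (he : e.Fits W s)
    (hx : e.eval s = x) (hxW : x < W) :
    (Expr.bin .sub e (.lit k)).Fits W s ∧ (Expr.bin .sub e (.lit k)).eval s = x - k := by
  simp only [Expr.Fits, Expr.eval, he, hx, hk, Op.sub_apply, true_and, and_true]
  omega

/-- The lists `order₁` and `order₂` in the arrays `10` and `11`. -/
def orderProg : Prog :=
  19 <~ .lit 0 ;; 20 <~ .lit 0 ;;
  selProg 10 19 (.bin .mul (.bin .eq (.past 7) (.lit 1)) (.past 8)) (.reg 5) ;;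
  selProg 10 19 (.bin .mul (.bin .eq (.past 7) (.lit 1)) (.bin .eq (.past 8) (.lit 0))) (.reg 5) ;;
  selProg 11 20 (.bin .mul (.bin .eq (.past 7) (.lit 1)) (.past 8))
    (.bin .sub (.past 8) (.lit 1)) ;;
  selProg 11 20 (.bin .mul (.bin .eq (.past 7) (.lit 2)) (.bin .eq (.past 8) (.lit 0))) (.reg 5)

theorem orderProg_spec (hW : Ample n W) {s : Store} {r : ℕ} (h0 : s.reg 0 = n)
    (h16 : s.reg 16 = r) (hr : r ≤ n * n) {sd mt : ℕ → ℕ}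
    (hsd : ∀ z : Fin n, s.arr 7 (r * n + z) = sd z) (hmt : ∀ z : Fin n, s.arr 8 (r * n + z) = mt z)
    (hs : ∀ z : Fin n, sd z ≤ 2) (hm : ∀ z : Fin n, mt z ≤ n) :
    WP W orderProg s fun t s' => t ≤ 250 * n + 100 ∧
      ListIn (order₁ n sd mt) (s'.arr 10) ∧ s'.reg 19 = (order₁ n sd mt).length ∧
      ListIn (order₂ n sd mt) (s'.arr 11) ∧ s'.reg 20 = (order₂ n sd mt).length := by
  have hW' := hW
  unfold Ample at hW'
  have one_lt : 1 < W := by omega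
  have hrn : r * n ≤ n * n * n := Nat.mul_le_mul_right _ hr
  have len : ∀ (p : ℕ → Prop) [DecidablePred p] (f : ℕ → ℕ), ([] ++ (sel n p).map f).length ≤ n :=
    fun p _ f => by simpa using length_sel_le
  -- the expressions at `z`
  have get : ∀ s' : Store, s'.reg 0 = n → s'.reg 16 = r → s'.arr 7 = s.arr 7 →
      s'.arr 8 = s.arr 8 → ∀ z : Fin n, s'.reg 5 = (z : ℕ) →
      (Expr.past 7).Fits W s' ∧ (Expr.past 7).eval s' = sd z ∧
      (Expr.past 8).Fits W s' ∧ (Expr.past 8).eval s' = mt z := fun s' e0 e16 e7 e8 z ez => by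
    have := hs z
    have := hm z
    simp only [Expr.Fits, Expr.eval, Op.add_apply, Op.mul_apply, e0, e16, e7, e8, ez, hsd, hmt, and_true,
      true_and]
    omega
  have two : ∀ s' : Store, s'.reg 0 = n → s'.reg 16 = r → s'.arr 7 = s.arr 7 →
      s'.arr 8 = s.arr 8 → ∀ z : Fin n, s'.reg 5 = (z : ℕ) → ∀ k ≤ 2,
      (Expr.bin .mul (.bin .eq (.past 7) (.lit k)) (.past 8)).Fits W s' ∧
      ((Expr.bin .mul (.bin .eq (.past 7) (.lit k)) (.past 8)).eval s' ≠ 0 ↔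
        sd z = k ∧ mt z ≠ 0) ∧
      (Expr.bin .mul (.bin .eq (.past 7) (.lit k)) (.bin .eq (.past 8) (.lit 0))).Fits W s' ∧
      ((Expr.bin .mul (.bin .eq (.past 7) (.lit k)) (.bin .eq (.past 8) (.lit 0))).eval s' ≠ 0 ↔
        sd z = k ∧ mt z = 0) := fun s' e0 e16 e7 e8 z ez k hk => by
    obtain ⟨g1, g2, g3, g4⟩ := get s' e0 e16 e7 e8 z ez
    have := hm z
    obtain ⟨q1, q2⟩ := Expr.eq_mul_spec (k := k) (by omega) one_lt g1 g2 g3 g4 (by omega)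
    obtain ⟨g5, g6⟩ := Expr.eq_spec (k := 0) (by omega) one_lt g3 g4
    obtain ⟨q3, q4⟩ := Expr.eq_mul_spec (k := k) (by omega) one_lt g1 g2 g5 g6 (Op.eq_fits one_lt)
    exact ⟨q1, q2, q3, by rw [q4, ne_eq, Op.eq_eq_zero, not_not]⟩
  rw [orderProg, wp_seq, wp_assign]
  refine ⟨by simp only [Expr.Fits]; omega, ?_⟩
  rw [wp_seq, wp_assign]
  refine ⟨by simp only [Expr.Fits]; omega, ?_⟩
  refine WP.seq ((selProg_spec (n := n) hW (L := []) (p := fun z => sd z = 1 ∧ mt z ≠ 0) (f := id)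
    (by decide) (by decide) (by simp [h0]) (fun i hi => by simp at hi) (by simp [Expr.eval])
    (by simp) fun z s' hz hF => ?_).mono ?_)
  · obtain ⟨q1, q2, -, -⟩ := two s' (by simpa [h0] using hF.1 0 rfl)
      (by simpa [h16] using hF.1 16 rfl) (by simpa using hF.2 7 rfl) (by simpa using hF.2 8 rfl) z
      hz 1 (by omega)
    exact ⟨q1, q2, fun _ => ⟨by simp only [Expr.Fits]; omega, hz⟩⟩
  rintro t1 s1 F1 ⟨ht1, L1, l1⟩
  have a0 : s1.reg 0 = n := by simpa [h0] using F1.1 0 rfl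
  have a16 : s1.reg 16 = r := by simpa [h16] using F1.1 16 rfl
  have a20 : s1.reg 20 = 0 := by simpa [Expr.eval] using F1.1 20 rfl
  have a7 : s1.arr 7 = s.arr 7 := by simpa using F1.2 7 rfl
  have a8 : s1.arr 8 = s.arr 8 := by simpa using F1.2 8 rfl
  refine WP.seq ((selProg_spec hW (p := fun z => sd z = 1 ∧ mt z = 0) (f := id)
    (by decide) (by decide) a0 L1 l1 (len _ _) fun z s' hz hF => ?_).mono ?_)
  · obtain ⟨-, -, q1, q2⟩ := two s' (by simpa [a0] using hF.1 0 rfl)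
      (by simpa [a16] using hF.1 16 rfl) (by simpa [a7] using hF.2 7 rfl)
      (by simpa [a8] using hF.2 8 rfl) z hz 1 (by omega)
    exact ⟨q1, q2, fun _ => ⟨by simp only [Expr.Fits]; omega, hz⟩⟩
  rintro t2 s2 F2 ⟨ht2, L2, l2⟩
  have b0 : s2.reg 0 = n := by simpa [a0] using F2.1 0 rfl
  have b16 : s2.reg 16 = r := by simpa [a16] using F2.1 16 rfl
  have b20 : s2.reg 20 = 0 := by simpa [a20] using F2.1 20 rfl
  have b7 : s2.arr 7 = s.arr 7 := by simpa [a7] using F2.2 7 rfl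
  have b8 : s2.arr 8 = s.arr 8 := by simpa [a8] using F2.2 8 rfl
  refine WP.seq ((selProg_spec (n := n) hW (L := []) (p := fun z => sd z = 1 ∧ mt z ≠ 0)
    (f := fun z => mt z - 1) (by decide) (by decide) b0 (fun i hi => by simp at hi) (by simp [b20])
    (by simp) fun z s' hz hF => ?_).mono ?_)
  · have e0 : s'.reg 0 = n := by simpa [b0] using hF.1 0 rfl
    have e16 : s'.reg 16 = r := by simpa [b16] using hF.1 16 rfl
    have e7 : s'.arr 7 = s.arr 7 := by simpa [b7] using hF.2 7 rfl
    have e8 : s'.arr 8 = s.arr 8 := by simpa [b8] using hF.2 8 rfl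
    obtain ⟨q1, q2, -, -⟩ := two s' e0 e16 e7 e8 z hz 1 (by omega)
    obtain ⟨-, -, g3, g4⟩ := get s' e0 e16 e7 e8 z hz
    have := hm z
    exact ⟨q1, q2, fun _ => Expr.sub_spec one_lt g3 g4 (by omega)⟩
  rintro t3 s3 F3 ⟨ht3, L3, l3⟩
  have c0 : s3.reg 0 = n := by simpa [b0] using F3.1 0 rfl
  have c16 : s3.reg 16 = r := by simpa [b16] using F3.1 16 rfl
  have c7 : s3.arr 7 = s.arr 7 := by simpa [b7] using F3.2 7 rfl
  have c8 : s3.arr 8 = s.arr 8 := by simpa [b8] using F3.2 8 rfl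
  refine (selProg_spec hW (p := fun z => sd z = 2 ∧ mt z = 0) (f := id)
    (by decide) (by decide) c0 L3 l3 (len _ _) fun z s' hz hF => ?_).mono ?_
  · obtain ⟨-, -, q1, q2⟩ := two s' (by simpa [c0] using hF.1 0 rfl)
      (by simpa [c16] using hF.1 16 rfl) (by simpa [c7] using hF.2 7 rfl)
      (by simpa [c8] using hF.2 8 rfl) z hz 2 (by omega)
    exact ⟨q1, q2, fun _ => ⟨by simp only [Expr.Fits]; omega, hz⟩⟩
  rintro t4 s4 F4 ⟨ht4, L4, l4⟩
  have d10 : s4.arr 10 = s2.arr 10 := (F4.2 10 rfl).trans (F3.2 10 rfl)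
  have d19 : s4.reg 19 = s2.reg 19 := (F4.1 19 rfl).trans (F3.1 19 rfl)
  simp only [List.map_id, List.nil_append] at L2 l2 L4 l4
  refine ⟨?_, by rwa [d10], by rw [d19]; exact l2, L4, l4⟩
  simp only [Expr.cost] at *
  omega

end WordRAM


/-! ### Programs for the colour flags, the palettes and the painting -/

namespace WordRAM

variable {n W : ℕ} {G H : SimpleGraph (Fin n)}

/-- Flag in the arrays `12` and `13` the colours (in array `1`) of the two sides. -/
def ownProg : Prog :=
  .for 5 0 (.write 12 (.reg 5) (.lit 0) ;; .write 13 (.reg 5) (.lit 0)) ;;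
  .for 5 0 (.cond (.bin .eq (.past 7) (.lit 1)) (.write 12 (.get 1 (.reg 5)) (.lit 1))
    (.cond (.bin .eq (.past 7) (.lit 2)) (.write 13 (.get 1 (.reg 5)) (.lit 1)) .skip))

/-- The colours below `n` flagged by `o` are those of the vertices `z < k` with `sd z = i`. -/
def Own (n : ℕ) (sd c o : ℕ → ℕ) (i k : ℕ) : Prop :=
  ∀ x < n, o x ≤ 1 ∧ (o x ≠ 0 ↔ ∃ z : Fin n, z < k ∧ sd z = i ∧ c z = x)

theorem Own.skip {sd c o : ℕ → ℕ} {i : ℕ} {z : Fin n} (h : Own n sd c o i z) (hz : sd z ≠ i) :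
    Own n sd c o i (z + 1) := by
  refine fun x hx => ⟨(h x hx).1, ?_⟩
  rw [(h x hx).2, exists_lt_succ]
  simp [hz]

theorem Own.set {sd c o : ℕ → ℕ} {i : ℕ} {z : Fin n} (h : Own n sd c o i z) (hz : sd z = i) :
    Own n sd c (Function.update o (c z) 1) i (z + 1) := by
  intro x hx
  rw [exists_lt_succ, ← (h x hx).2]
  by_cases e : x = c z
  · subst e
    simp [hz]
  · rw [Function.update_of_ne e]
    exact ⟨(h x hx).1, by have := Ne.symm e; tauto⟩

theorem ownProg_spec (hW : Ample n W) {s : Store} {r : ℕ} (h0 : s.reg 0 = n)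
    (h16 : s.reg 16 = r) (hr : r ≤ n * n) {sd : ℕ → ℕ}
    (hsd : ∀ z : Fin n, s.arr 7 (r * n + z) = sd z) (hs : ∀ z : Fin n, sd z ≤ 2)
    (hcn : ∀ z : Fin n, s.arr 1 z < n) :
    WP W ownProg s fun t s' => t ≤ 70 * n + 20 ∧ Own n sd (s.arr 1) (s'.arr 12) 1 n ∧
      Own n sd (s.arr 1) (s'.arr 13) 2 n := by
  have hW' := hW
  unfold Ample at hW'
  have one_lt : 1 < W := by omega
  have hrn : r * n ≤ n * n * n := Nat.mul_le_mul_right _ hr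
  rw [ownProg, wp_seq]
  refine WP.for (n := n) (T := 6) (I := fun k s' => ∀ x < k, s'.arr 12 x = 0 ∧ s'.arr 13 x = 0)
    (by decide) rfl rfl h0 hW.succ_lt (by simp) ?_ ?_
  · intro z s' hz hF hI
    simp only [wp_seq, wp_write, Expr.Fits, Expr.eval, Expr.cost, hz, setReg_arr, setArr_arr,
      setArr_reg, reduceIte, Nat.reduceEqDiff, Nat.reduceAdd, Nat.reduceLeDiff, true_and]
    refine ⟨by omega, by omega, fun w hw => ?_⟩
    by_cases e : w = z
    · simp [e]
    · rw [Function.update_of_ne e, Function.update_of_ne e]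
      exact hI w (by omega)
  intro t1 s1 ht1 F1 hI1
  have a0 : s1.reg 0 = n := by simpa [h0] using F1.1 0 rfl
  have a16 : s1.reg 16 = r := by simpa [h16] using F1.1 16 rfl
  have a7 : s1.arr 7 = s.arr 7 := F1.2 7 rfl
  have a1 : s1.arr 1 = s.arr 1 := F1.2 1 rfl
  have z1 : ∀ o : ℕ → ℕ, (∀ x < n, o x = 0) → ∀ i, Own n sd (s.arr 1) o i 0 := fun o ho i x hx => by
    simp [ho x hx]
  refine WP.for (n := n) (T := 40) (I := fun k s' => Own n sd (s.arr 1) (s'.arr 12) 1 k ∧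
      Own n sd (s.arr 1) (s'.arr 13) 2 k)
    (by decide) rfl rfl a0 hW.succ_lt
    ⟨z1 _ (fun x hx => (hI1 x hx).1) 1, z1 _ (fun x hx => (hI1 x hx).2) 2⟩ ?_ ?_
  · rintro z s' hz hF ⟨I1, I2⟩
    have e0 : s'.reg 0 = n := by simpa [a0] using hF.1 0 rfl
    have e16 : s'.reg 16 = r := by simpa [a16] using hF.1 16 rfl
    have e7 : s'.arr 7 = s.arr 7 := by simpa [a7] using hF.2 7 rfl
    have e1 : s'.arr 1 = s.arr 1 := by simpa [a1] using hF.2 1 rfl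
    have := hs z
    have := hcn z
    simp only [wp_cond, wp_skip, wp_write, Expr.Fits, Expr.eval, Op.add_apply, Op.mul_apply,
      Op.eq_eq_zero, Op.eq_fits one_lt, and_true, true_and, hz, e0, e16, e7, e1, hsd, Expr.cost,
      setReg_reg, setReg_arr, setArr_arr, ne_eq, Nat.reduceEqDiff, reduceIte, Nat.reduceAdd,
      Nat.reduceLeDiff, not_not]
    refine ⟨by omega, fun c1 => ⟨by omega, I1.set c1, I2.skip (by omega)⟩, fun c1 => ⟨by omega,
      fun c2 => ⟨by omega, I1.skip c1, I2.set c2⟩, fun c2 => ⟨I1.skip c1, I2.skip c2⟩⟩⟩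
  · rintro t s' ht hF ⟨I1, I2⟩
    exact ⟨by omega, I1, I2⟩

/-- The two palettes in the arrays `14` and `15`. -/
def paletteProg : Prog :=
  21 <~ .lit 0 ;; 22 <~ .lit 0 ;;
  selProg 14 21 (.bin .mul (.get 12 (.reg 5)) (.get 13 (.reg 5))) (.reg 5) ;;
  selProg 14 21 (.bin .mul (.get 12 (.reg 5)) (.bin .eq (.get 13 (.reg 5)) (.lit 0))) (.reg 5) ;;
  selProg 15 22 (.bin .mul (.get 13 (.reg 5)) (.get 12 (.reg 5))) (.reg 5) ;;
  selProg 15 22 (.bin .mul (.get 13 (.reg 5)) (.bin .eq (.get 12 (.reg 5)) (.lit 0))) (.reg 5)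

theorem paletteProg_spec (hW : Ample n W) {s : Store} (h0 : s.reg 0 = n)
    (h12 : ∀ x < n, s.arr 12 x ≤ 1) (h13 : ∀ x < n, s.arr 13 x ≤ 1) :
    WP W paletteProg s fun t s' => t ≤ 250 * n + 100 ∧
      ListIn (palette n (s.arr 12) (s.arr 13)) (s'.arr 14) ∧
      ListIn (palette n (s.arr 13) (s.arr 12)) (s'.arr 15) := by
  have hW' := hW
  unfold Ample at hW'
  have one_lt : 1 < W := by omega
  have len : ∀ (p : ℕ → Prop) [DecidablePred p] (f : ℕ → ℕ), ([] ++ (sel n p).map f).length ≤ n :=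
    fun p _ f => by simpa using length_sel_le
  have two : ∀ i j, (∀ x < n, s.arr i x ≤ 1) → (∀ x < n, s.arr j x ≤ 1) → ∀ s' : Store,
      s'.arr i = s.arr i → s'.arr j = s.arr j → ∀ z : Fin n, s'.reg 5 = (z : ℕ) →
      ((Expr.bin .mul (.get i (.reg 5)) (.get j (.reg 5))).Fits W s' ∧
      ((Expr.bin .mul (.get i (.reg 5)) (.get j (.reg 5))).eval s' ≠ 0 ↔
        s.arr i z ≠ 0 ∧ s.arr j z ≠ 0)) ∧
      ((Expr.bin .mul (.get i (.reg 5)) (.bin .eq (.get j (.reg 5)) (.lit 0))).Fits W s' ∧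
      ((Expr.bin .mul (.get i (.reg 5)) (.bin .eq (.get j (.reg 5)) (.lit 0))).eval s' ≠ 0 ↔
        s.arr i z ≠ 0 ∧ s.arr j z = 0)) := fun i j hi hj s' ei ej z ez => by
    have := hi z z.2
    have := hj z z.2
    have k1 := Nat.mul_le_mul (hi z z.2) (hj z z.2)
    have k2 := Nat.mul_le_mul (hi z z.2) (Op.eq_apply_le (s.arr j z) 0)
    simp only [Expr.Fits, Expr.eval, Op.mul_apply, Op.eq_fits one_lt, and_true, true_and, ez, ei,
      ej, mul_ne_zero_iff, ne_eq, Op.eq_eq_zero, not_not]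
    omega
  rw [paletteProg, wp_seq, wp_assign]
  refine ⟨by simp only [Expr.Fits]; omega, ?_⟩
  rw [wp_seq, wp_assign]
  refine ⟨by simp only [Expr.Fits]; omega, ?_⟩
  refine WP.seq ((selProg_spec (n := n) hW (L := []) (p := fun z => s.arr 12 z ≠ 0 ∧ s.arr 13 z ≠ 0)
    (f := id) (by decide) (by decide) (by simp [h0]) (fun i hi => by simp at hi)
    (by simp [Expr.eval]) (by simp) fun z s' hz hF => ?_).mono ?_)
  · obtain ⟨⟨q1, q2⟩, -⟩ := two 12 13 h12 h13 s' (by simpa using hF.2 12 rfl)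
      (by simpa using hF.2 13 rfl) z hz
    exact ⟨q1, q2, fun _ => ⟨by simp only [Expr.Fits]; omega, hz⟩⟩
  rintro t1 s1 F1 ⟨ht1, L1, l1⟩
  have a0 : s1.reg 0 = n := by simpa [h0] using F1.1 0 rfl
  have a22 : s1.reg 22 = 0 := by simpa [Expr.eval] using F1.1 22 rfl
  have a12 : s1.arr 12 = s.arr 12 := by simpa using F1.2 12 rfl
  have a13 : s1.arr 13 = s.arr 13 := by simpa using F1.2 13 rfl
  refine WP.seq ((selProg_spec hW (p := fun z => s.arr 12 z ≠ 0 ∧ s.arr 13 z = 0) (f := id)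
    (by decide) (by decide) a0 L1 l1 (len _ _) fun z s' hz hF => ?_).mono ?_)
  · obtain ⟨-, q1, q2⟩ := two 12 13 h12 h13 s' (by simpa [a12] using hF.2 12 rfl)
      (by simpa [a13] using hF.2 13 rfl) z hz
    exact ⟨q1, q2, fun _ => ⟨by simp only [Expr.Fits]; omega, hz⟩⟩
  rintro t2 s2 F2 ⟨ht2, L2, l2⟩
  have b0 : s2.reg 0 = n := by simpa [a0] using F2.1 0 rfl
  have b22 : s2.reg 22 = 0 := by simpa [a22] using F2.1 22 rfl
  have b12 : s2.arr 12 = s.arr 12 := by simpa [a12] using F2.2 12 rfl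
  have b13 : s2.arr 13 = s.arr 13 := by simpa [a13] using F2.2 13 rfl
  refine WP.seq ((selProg_spec (n := n) hW (L := []) (p := fun z => s.arr 13 z ≠ 0 ∧ s.arr 12 z ≠ 0)
    (f := id) (by decide) (by decide) b0 (fun i hi => by simp at hi) (by simp [b22])
    (by simp) fun z s' hz hF => ?_).mono ?_)
  · obtain ⟨⟨q1, q2⟩, -⟩ := two 13 12 h13 h12 s' (by simpa [b13] using hF.2 13 rfl)
      (by simpa [b12] using hF.2 12 rfl) z hz
    exact ⟨q1, q2, fun _ => ⟨by simp only [Expr.Fits]; omega, hz⟩⟩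
  rintro t3 s3 F3 ⟨ht3, L3, l3⟩
  have c0 : s3.reg 0 = n := by simpa [b0] using F3.1 0 rfl
  have c12 : s3.arr 12 = s.arr 12 := by simpa [b12] using F3.2 12 rfl
  have c13 : s3.arr 13 = s.arr 13 := by simpa [b13] using F3.2 13 rfl
  refine (selProg_spec hW (p := fun z => s.arr 13 z ≠ 0 ∧ s.arr 12 z = 0) (f := id)
    (by decide) (by decide) c0 L3 l3 (len _ _) fun z s' hz hF => ?_).mono ?_
  · obtain ⟨-, q1, q2⟩ := two 13 12 h13 h12 s' (by simpa [c13] using hF.2 13 rfl)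
      (by simpa [c12] using hF.2 12 rfl) z hz
    exact ⟨q1, q2, fun _ => ⟨by simp only [Expr.Fits]; omega, hz⟩⟩
  rintro t4 s4 F4 ⟨ht4, L4, l4⟩
  have d14 : s4.arr 14 = s2.arr 14 := (F4.2 14 rfl).trans (F3.2 14 rfl)
  simp only [List.map_id, List.nil_append] at L2 L4
  refine ⟨?_, by rwa [d14], L4⟩
  simp only [Expr.cost] at *
  omega

/-- Assign the colours of the palettes to the vertices of the two sides. -/
def paintProg : Prog :=
  .for 5 0 (.cond (.bin .lt (.reg 5) (.reg 19)) (.write 1 (.get 10 (.reg 5)) (.get 14 (.reg 5)))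
      .skip ;;
    .cond (.bin .lt (.reg 5) (.reg 20)) (.write 1 (.get 11 (.reg 5)) (.get 15 (.reg 5))) .skip)

/-- `c'` assigns the first `k` colours in `S` to the vertices in `L`, the first `k'` colours in
`S'` to those in `L'`, and agrees with `c` on all other vertices. -/
def Painted (L L' S S' : List ℕ) (c c' : ℕ → ℕ) (k k' : ℕ) : Prop :=
  (∀ i < k, i < L.length → c' (L.getD i 0) = S.getD i 0) ∧
  (∀ i < k', i < L'.length → c' (L'.getD i 0) = S'.getD i 0) ∧
  ∀ x, x ∉ L → x ∉ L' → c' x = c x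

variable {L L' S S' : List ℕ} {c c' : ℕ → ℕ} {k k' : ℕ}

theorem Painted.symm (h : Painted L L' S S' c c' k k') : Painted L' L S' S c c' k' k :=
  ⟨h.2.1, h.1, fun x hx hx' => h.2.2 x hx' hx⟩

theorem Painted.skip (h : Painted L L' S S' c c' k k') (hk : L.length ≤ k) :
    Painted L L' S S' c c' (k + 1) k' :=
  ⟨fun i _ hi' => h.1 i (by omega) hi', h.2⟩

theorem getD_mem {i : ℕ} (hi : i < L.length) : L.getD i 0 ∈ L := by
  rw [List.getD_eq_getElem _ _ hi]
  exact List.getElem_mem _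

theorem Painted.set (h : Painted L L' S S' c c' k k') (hL : L.Nodup) (hd : ∀ x ∈ L, x ∉ L')
    (hk : k < L.length) :
    Painted L L' S S' c (Function.update c' (L.getD k 0) (S.getD k 0)) (k + 1) k' := by
  refine ⟨fun i hi hi' => ?_, fun i hi hi' => ?_, fun x hx hx' => ?_⟩
  · by_cases e : i = k
    · rw [e, Function.update_self]
    · rw [Function.update_of_ne, h.1 i (by omega) hi']
      rw [List.getD_eq_getElem _ _ hi', List.getD_eq_getElem _ _ hk]
      exact fun h' => e ((hL.getElem_inj_iff).1 h')
  · rw [Function.update_of_ne, h.2.1 i hi hi']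
    exact fun h' => hd _ (getD_mem hk) (h' ▸ getD_mem hi')
  · rw [Function.update_of_ne, h.2.2 x hx hx']
    exact fun h' => hx (h' ▸ getD_mem hk)

theorem length_le_of_nodup (h : L.Nodup) (h' : ∀ x ∈ L, x < n) : L.length ≤ n := by
  have := (h.subperm fun x hx => List.mem_range.2 (h' x hx)).length_le
  simpa using this

/-- The two vertex lists have no repetitions and are disjoint, so no vertex is painted twice. Equal
lengths of lists and palettes guarantee that every colour read is an entry of the palette. -/
theorem paintProg_spec (hW : Ample n W) {s : Store} (h0 : s.reg 0 = n)
    (hL : ListIn L (s.arr 10)) (hL' : ListIn L' (s.arr 11)) (hS : ListIn S (s.arr 14))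
    (hS' : ListIn S' (s.arr 15)) (h19 : s.reg 19 = L.length) (h20 : s.reg 20 = L'.length)
    (hlen : L.length = S.length) (hlen' : L'.length = S'.length) (hn : L.Nodup) (hn' : L'.Nodup)
    (hd : ∀ x ∈ L, x ∉ L') (lt : ∀ x ∈ L, x < n) (lt' : ∀ x ∈ L', x < n) (ltS : ∀ x ∈ S, x < n)
    (ltS' : ∀ x ∈ S', x < n) :
    WP W paintProg s fun t s' => t ≤ 50 * n + 10 ∧
      Painted L L' S S' (s.arr 1) (s'.arr 1) n n := by
  have hW' := hW
  unfold Ample at hW'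
  have one_lt : 1 < W := by omega
  have l1 := length_le_of_nodup hn lt
  have l2 := length_le_of_nodup hn' lt'
  refine WP.for (n := n) (T := 30) (I := fun k s' => Painted L L' S S' (s.arr 1) (s'.arr 1) k k)
    (by decide) rfl rfl h0 hW.succ_lt ⟨by simp, by simp, fun x _ _ => rfl⟩ ?_ ?_
  · rintro z s' hz hF I
    have e19 : s'.reg 19 = L.length := by simpa [h19] using hF.1 19 rfl
    have e20 : s'.reg 20 = L'.length := by simpa [h20] using hF.1 20 rfl
    have e10 : s'.arr 10 = s.arr 10 := by simpa using hF.2 10 rfl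
    have e11 : s'.arr 11 = s.arr 11 := by simpa using hF.2 11 rfl
    have e14 : s'.arr 14 = s.arr 14 := by simpa using hF.2 14 rfl
    have e15 : s'.arr 15 = s.arr 15 := by simpa using hF.2 15 rfl
    have v1 : z < L.length → s.arr 10 z = L.getD z 0 ∧ L.getD z 0 < n ∧
        s.arr 14 z = S.getD z 0 ∧ S.getD z 0 < n := fun h =>
      ⟨hL z h, lt _ (getD_mem h), hS z (hlen ▸ h), ltS _ (getD_mem (hlen ▸ h))⟩
    have v2 : z < L'.length → s.arr 11 z = L'.getD z 0 ∧ L'.getD z 0 < n ∧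
        s.arr 15 z = S'.getD z 0 ∧ S'.getD z 0 < n := fun h =>
      ⟨hL' z h, lt' _ (getD_mem h), hS' z (hlen' ▸ h), ltS' _ (getD_mem (hlen' ▸ h))⟩
    have hd' : ∀ x ∈ L', x ∉ L := fun x hx hx' => hd x hx' hx
    simp only [wp_cond, wp_seq, wp_skip, wp_write, Expr.Fits, Expr.eval, Op.lt_eq_zero,
      Op.lt_fits one_lt, and_true, true_and, hz, e19, e20, e10, e11, e14, e15, Expr.cost,
      setReg_reg, setReg_arr, setArr_arr, setArr_reg, ne_eq, Nat.reduceEqDiff, reduceIte,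
      Nat.reduceAdd, Nat.reduceLeDiff, not_not]
    refine ⟨by omega, fun c1 => ?_, fun c1 => ?_⟩
    · obtain ⟨w1, w2, w3, w4⟩ := v1 c1
      rw [w1, w3]
      refine ⟨by omega, by omega, fun c2 => ?_, fun c2 => ?_⟩
      · obtain ⟨x1, x2, x3, x4⟩ := v2 c2
        rw [x1, x3]
        exact ⟨by omega, ((I.set hn hd c1).symm.set hn' hd' c2).symm⟩
      · exact ((I.set hn hd c1).symm.skip (by omega)).symm
    · refine ⟨by omega, fun c2 => ?_, fun c2 => ?_⟩
      · obtain ⟨x1, x2, x3, x4⟩ := v2 c2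
        rw [x1, x3]
        exact ⟨by omega, ((I.skip (by omega)).symm.set hn' hd' c2).symm⟩
      · exact ((I.skip (by omega)).symm.skip (by omega)).symm
  · rintro t s' ht hF I
    exact ⟨by omega, I⟩

end WordRAM


/-! ### Undoing the reductions -/

namespace WordRAM

variable {n W : ℕ} {G H : SimpleGraph (Fin n)}

/-- Turn a colouring of the graph after reduction number `reg 16` into one of the graph before. -/
def roundProg : Prog := orderProg ;; ownProg ;; paletteProg ;; paintProg

theorem roundProg_spec (hW : Ample n W) {s : Store} {r : ℕ} (h0 : s.reg 0 = n)
    (h16 : s.reg 16 = r) (hr : r ≤ n * n)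
    (hS : Step G H (fun z => s.arr 7 (r * n + z)) (fun z => s.arr 8 (r * n + z)))
    (hc : ∀ u v : Fin n, H.Adj u v → s.arr 1 u ≠ s.arr 1 v) (hcn : ∀ u : Fin n, s.arr 1 u < n) :
    WP W roundProg s fun t s' => t ≤ 700 * (n + 1) ∧
      (∀ u v : Fin n, G.Adj u v → s'.arr 1 u ≠ s'.arr 1 v) ∧
      ∀ z : Fin n, ∃ w : Fin n, s'.arr 1 z = s.arr 1 w := by
  set sd : ℕ → ℕ := fun z => s.arr 7 (r * n + z) with hsd
  set mt : ℕ → ℕ := fun z => s.arr 8 (r * n + z) with hmt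
  refine WP.seq ((orderProg_spec hW h0 h16 hr (sd := sd) (mt := mt) (fun _ => rfl) (fun _ => rfl)
    hS.sd_le hS.mate.le).mono ?_)
  rintro t1 s1 F1 ⟨ht1, L1, l1, L2, l2⟩
  have a0 : s1.reg 0 = n := by simpa [h0] using F1.1 0 rfl
  have a16 : s1.reg 16 = r := by simpa [h16] using F1.1 16 rfl
  have a7 : s1.arr 7 = s.arr 7 := F1.2 7 rfl
  have a1 : s1.arr 1 = s.arr 1 := F1.2 1 rfl
  refine WP.seq ((ownProg_spec hW a0 a16 hr (sd := sd) (by rw [a7]; exact fun _ => rfl)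
    hS.sd_le (by rwa [a1])).mono ?_)
  rintro t2 s2 F2 ⟨ht2, O1, O2⟩
  rw [a1] at O1 O2
  have b0 : s2.reg 0 = n := by simpa [a0] using F2.1 0 rfl
  refine WP.seq ((paletteProg_spec hW b0 (fun x hx => (O1 x hx).1) fun x hx => (O2 x hx).1).mono ?_)
  rintro t3 s3 F3 ⟨ht3, P1, P2⟩
  have c0 : s3.reg 0 = n := by simpa [b0] using F3.1 0 rfl
  have c1 : s3.arr 1 = s.arr 1 := ((F3.2 1 rfl).trans (F2.2 1 rfl)).trans a1
  have c10 : s3.arr 10 = s1.arr 10 := (F3.2 10 rfl).trans (F2.2 10 rfl)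
  have c11 : s3.arr 11 = s1.arr 11 := (F3.2 11 rfl).trans (F2.2 11 rfl)
  have c19 : s3.reg 19 = s1.reg 19 := (F3.1 19 rfl).trans (F2.1 19 rfl)
  have c20 : s3.reg 20 = s1.reg 20 := (F3.1 20 rfl).trans (F2.1 20 rfl)
  have ho₁ : ∀ x < n, s2.arr 12 x ≠ 0 ↔ ∃ z : Fin n, sd z = 1 ∧ s.arr 1 z = x := fun x hx => by
    rw [(O1 x hx).2]; simp
  have ho₂ : ∀ x < n, s2.arr 13 x ≠ 0 ↔ ∃ z : Fin n, sd z = 2 ∧ s.arr 1 z = x := fun x hx => by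
    rw [(O2 x hx).2]; simp
  -- The edges inside a class survive the reduction, so the given colouring is injective on it.
  have hin : ∀ u v : Fin n, sd u ≠ 0 → sd u = sd v → u ≠ v → s.arr 1 u ≠ s.arr 1 v :=
    fun u v hu huv hne =>
      hc u v (hS.agree u v (by simp only [← hsd] at *; have := hS.sd_le u; omega)
        (hS.clique u v hu huv hne))
  refine (paintProg_spec hW c0 (by rwa [c10]) (by rwa [c11]) P1 P2 (by rwa [c19]) (by rwa [c20])
    (palette_length nodup_order₁ (fun x => mem_order₁)
      (fun u v hu hv => hin u v (by omega) (by omega)) ho₁ hcn)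
    (palette_length hS.mate.nodup_order₂ (fun x => hS.mate.mem_order₂)
      (fun u v hu hv => hin u v (by omega) (by omega)) ho₂ hcn) nodup_order₁ hS.mate.nodup_order₂
    (fun x hx hx' => ?_) (fun x hx => (mem_order₁.1 hx).1) (fun x hx => (hS.mate.mem_order₂.1 hx).1)
    (fun x hx => (mem_palette.1 hx).1) (fun x hx => (mem_palette.1 hx).1)).mono ?_
  · have e1 := (mem_order₁.1 hx).2
    have e2 := (hS.mate.mem_order₂.1 hx').2
    omega
  · rintro t4 s4 F4 ⟨ht4, k1, k2, k3⟩
    rw [c1] at k3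
    refine ⟨by omega, hS.recolour hc hcn ho₁ ho₂ (fun z hz => k3 z ?_ ?_)
      (fun i hi => k1 i (hi.trans_le (length_le_of_nodup nodup_order₁ fun x hx => (mem_order₁.1 hx).1)) hi)
      (fun i hi => k2 i (hi.trans_le (length_le_of_nodup hS.mate.nodup_order₂ fun x hx =>
        (hS.mate.mem_order₂.1 hx).1)) hi)⟩
    · intro h; have := (mem_order₁.1 h).2; omega
    · intro h; have := (hS.mate.mem_order₂.1 h).2; omega

/-- Undo all reductions, the last one first. -/
def undoProg : Prog := .loop (.reg 16) (16 <~ .bin .sub (.reg 16) (.lit 1) ;; roundProg)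

/-- No new colours are ever introduced. So the number of colours does not grow, and colours stay
below `n`, as needed for using them as array indices. The counter is lowered before each round
because reductions are numbered from `0`. -/
theorem undoProg_spec (hW : Ample n W) {s : Store} {r : ℕ} (h0 : s.reg 0 = n)
    (h16 : s.reg 16 = r) (hr : r ≤ n * n) (hH : History G H r (s.arr 7) (s.arr 8))
    (hc : ∀ u v : Fin n, H.Adj u v → s.arr 1 u ≠ s.arr 1 v) (hcn : ∀ u : Fin n, s.arr 1 u < n) :
    WP W undoProg s fun t s' => t ≤ 710 * (n + 1) * (r + 1) ∧
      (∀ u v : Fin n, G.Adj u v → s'.arr 1 u ≠ s'.arr 1 v) ∧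
      ∀ z : Fin n, ∃ w : Fin n, s'.arr 1 z = s.arr 1 w := by
  obtain ⟨g, rfl, rfl, hg⟩ := hH
  have hW' := hW
  unfold Ample at hW'
  refine WP.loop (I := fun k t s' => t ≤ 710 * (n + 1) * k ∧ k ≤ r ∧ s'.reg 16 = r - k ∧
      (∀ u v : Fin n, (g (r - k)).Adj u v → s'.arr 1 u ≠ s'.arr 1 v) ∧
      ∀ z : Fin n, ∃ w : Fin n, s'.arr 1 z = s.arr 1 w) r ?_ (fun k t s' h => h.2.1) ?_ ?_ ?_
  · exact ⟨by simp, by omega, by simpa using h16, by simpa using hc, fun z => ⟨z, rfl⟩⟩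
  · rintro k t s' ⟨-, -, h, -⟩
    simp only [Expr.Fits]
    omega
  · rintro k t s' ⟨I1, I2, I3, I4, I5⟩ hF he
    simp only [Expr.eval] at he
    have e0 : s'.reg 0 = n := by simpa [h0] using hF.1 0 rfl
    have e7 : s'.arr 7 = s.arr 7 := by simpa using hF.2 7 rfl
    have e8 : s'.arr 8 = s.arr 8 := by simpa using hF.2 8 rfl
    rw [wp_seq, wp_assign]
    refine ⟨by simp only [Expr.Fits, Expr.eval, Op.sub_apply]; omega, ?_⟩
    have hS := hg (r - (k + 1)) (by omega)
    rw [show r - (k + 1) + 1 = r - k by omega] at hS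
    refine (roundProg_spec (G := g (r - (k + 1))) (H := g (r - k)) (r := r - (k + 1)) hW
      (by simpa using e0) (by simp [Expr.eval, Op.sub_apply, I3]; omega) (by omega)
      (by simpa [e7, e8] using hS) (by simpa using I4) fun u => ?_).mono ?_
    · obtain ⟨w, hw⟩ := I5 u
      simpa [hw] using hcn w
    · rintro t' s'' hF' ⟨J1, J2, J3⟩
      have e16 : s''.reg 16 = r - k - 1 := by
        simpa [Expr.eval, Op.sub_apply, I3] using hF'.1 16 rfl
      refine ⟨?_, by omega, by omega, J2, fun z => ?_⟩
      · have : 710 * (n + 1) * (k + 1) = 710 * (n + 1) * k + 710 * (n + 1) := by ring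
        simp only [Expr.cost]
        omega
      · obtain ⟨w, hw⟩ := J3 z
        obtain ⟨w', hw'⟩ := I5 w
        exact ⟨w', hw.trans (by simpa using hw')⟩
  · rintro k t s' ⟨I1, I2, I3, I4, I5⟩ hF he
    simp only [Expr.eval] at he
    rw [show r - k = 0 by omega] at I4
    refine ⟨?_, I4, I5⟩
    have e1 := Nat.mul_le_mul_left (710 * (n + 1)) I2
    have : 710 * (n + 1) * (r + 1) = 710 * (n + 1) * r + 710 * (n + 1) := by ring
    simp only [Expr.cost]
    omega

end WordRAM


/-! ### Word length, time bound, output, and assembly -/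

namespace WordRAM

open Finset SimpleGraph

variable {n W : ℕ} {G H : SimpleGraph (Fin n)}

theorem mat_matrixCells : Mat G (matrixCells G) := by
  intro u v
  have hn : 0 < n := Fin.pos v
  have h1 : (u * n + v : ℕ) / n = u := by
    rw [add_comm, Nat.add_mul_div_right _ _ hn, Nat.div_eq_of_lt v.2, zero_add]
  have h2 : (u * n + v : ℕ) % n = v := by
    rw [add_comm, Nat.add_mul_mod_self_right, Nat.mod_eq_of_lt v.2]
  rw [matrixCells, dif_pos (index_lt u v)]
  congr 1
  · exact Fin.ext h1
  · exact Fin.ext h2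

theorem ample_pow : Ample n ((n + 2) ^ 10) := by
  -- The fourth power is already enough: the largest values are addresses `r * n + z` in the history
  -- with `r ≤ n * n`.
  have h : (n + 2) ^ 4 ≤ (n + 2) ^ 10 := Nat.pow_le_pow_right (by omega) (by omega)
  have e : (n + 2) ^ 4 = n * n * n * n + 8 * (n * n * n) + 24 * (n * n) + 32 * n + 16 := by ring
  unfold Ample
  omega

theorem adjCard_eq : adjCard G = 2 * G.edgeSet.ncard := by
  classical
  rw [← G.coe_edgeFinset, Set.ncard_coe_finset, ← G.sum_degrees_eq_twice_card_edges, adjCard,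
    card_filter, Fintype.sum_prod_type]
  refine sum_congr rfl fun u _ => ?_
  rw [← card_filter, ← card_neighborFinset_eq_degree, neighborFinset_eq_filter]


/-- With `m ≥ 1` edges, `(n + 1)² ≤ 4 n²` and `2 m + 1 ≤ 3 m`, which gives the factor `36000 = 3000
* 4 * 3`; moreover `n²` is at most `n ^ (5/2)`. -/
theorem timeBound_of_le {t : ℕ} (ht : t ≤ 3000 * ((n + 1) * (n + 1)) * (adjCard G + 1)) :
    TimeBound 36000 G t := by
  have hsq : (n : ℝ) ^ 2 ≤ (n : ℝ) ^ (5 / 2 : ℝ) := by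
    rcases Nat.eq_zero_or_pos n with rfl | hn
    · norm_num
    · rw [← Real.rpow_natCast]
      exact Real.rpow_le_rpow_of_exponent_le (by exact_mod_cast hn) (by norm_num)
  have ht' : (t : ℝ) ≤ 3000 * ((n + 1) * (n + 1)) * (2 * G.edgeSet.ncard + 1) := by
    rw [adjCard_eq] at ht
    exact_mod_cast ht
  refine ⟨fun hm => ?_, fun hm => ?_⟩
  · have hn : 1 ≤ n := by
      rcases Nat.eq_zero_or_pos n with rfl | hn
      · have : adjCard G = 0 := by simp [adjCard]
        rw [adjCard_eq] at this
        omega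
      · exact hn
    have hn' : (1 : ℝ) ≤ n := by exact_mod_cast hn
    have hm' : (1 : ℝ) ≤ G.edgeSet.ncard := by exact_mod_cast hm
    have h1 : ((n : ℝ) + 1) * (n + 1) ≤ 4 * (n : ℝ) ^ (5 / 2 : ℝ) := by nlinarith
    calc (t : ℝ) ≤ 3000 * ((n + 1) * (n + 1)) * (2 * G.edgeSet.ncard + 1) := ht'
      _ ≤ 3000 * (4 * (n : ℝ) ^ (5 / 2 : ℝ)) * (3 * G.edgeSet.ncard) := by
        gcongr
        linarith
      _ = 36000 * (n : ℝ) ^ (5 / 2 : ℝ) * G.edgeSet.ncard := by ring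
  · rw [hm] at ht'
    have h1 : ((n : ℝ) + 1) * (n + 1) ≤ 2 * ((n : ℝ) ^ (5 / 2 : ℝ) + 1) := by
      nlinarith [sq_nonneg ((n : ℝ) - 1)]
    norm_num at ht'
    nlinarith [Real.rpow_nonneg (Nat.cast_nonneg (α := ℝ) n) (5 / 2 : ℝ)]

/-- Copy the matrix in array `0` to array `2`. -/
def copyMatrix : Prog := .for 11 0 (.for 5 0
  (.write 2 (.bin .add (.bin .mul (.reg 11) (.reg 0)) (.reg 5)) (.adj 11 5)))

theorem copyMatrix_spec (hW : Ample n W) {s : Store} (hA : Mat G (s.arr 0)) (h0 : s.reg 0 = n) :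
    WP W copyMatrix s fun t s' => t ≤ 100 * ((n + 1) * (n + 1)) ∧ HoldsGraph s' G := by
  have hW' := hW
  unfold Ample at hW'
  refine WP.for (n := n) (T := n * 30 + 6) (I := fun k s' => ∀ u v : Fin n, u < k →
      s'.arr 2 (u * n + v) = adjEntry G u v)
    (by decide) rfl rfl h0 hW.succ_lt (by simp) ?_ ?_
  · intro u s1 hu F1 I
    have a0 : s1.reg 0 = n := by simpa [h0] using F1.1 0 rfl
    have aA : s1.arr 0 = s.arr 0 := F1.2 0 rfl
    refine WP.for (n := n) (T := 22) (I := fun k s' => ∀ x y : Fin n, (x < u ∨ x = u ∧ y < k) →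
        s'.arr 2 (x * n + y) = adjEntry G x y)
      (by decide) rfl rfl a0 hW.succ_lt (fun x y h => by simpa using I x y (by omega)) ?_ ?_
    · intro v s' hv F J
      have e0 : s'.reg 0 = n := by simpa [a0] using F.1 0 rfl
      have e11 : s'.reg 11 = u := by simpa [hu] using F.1 11 rfl
      have eA : s'.arr 0 = s.arr 0 := by simpa [aA] using F.2 0 rfl
      have i1 := index_lt u v
      have := adjEntry_le (G := G) u v
      simp only [wp_write, Expr.Fits, Expr.eval, Op.add_apply, Op.mul_apply, e0, e11, eA, hv, hA u v,
        Expr.cost, setReg_arr, setArr_arr, reduceIte, Nat.reduceAdd, Nat.reduceLeDiff, true_and]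
      refine ⟨by omega, fun x y h => ?_⟩
      by_cases e : x = u ∧ y = v
      · obtain ⟨rfl, rfl⟩ := e
        simp
      · rw [Function.update_of_ne fun h => e (index_inj h)]
        refine J x y ?_
        rcases h with h | ⟨h, h'⟩
        · exact Or.inl h
        · exact Or.inr ⟨h, (Roots.lt_succ h').resolve_left fun h'' => e ⟨h, h''⟩⟩
    · intro t s' ht F J
      refine ⟨by omega, fun x y h => J x y ?_⟩
      rcases Roots.lt_succ h with h | h
      · exact Or.inr ⟨h, y.2⟩
      · exact Or.inl h
  · intro t s' ht F I
    refine ⟨?_, fun u v => I u v u.2⟩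
    have : n * (n * 30 + 6 + 8) = 30 * (n * n) + 14 * n := by ring
    have : 100 * ((n + 1) * (n + 1)) = 100 * (n * n) + 200 * n + 100 := by ring
    omega

/-- Copy the colouring in array `1` to array `2`. -/
def copyColours : Prog := .for 5 0 (.write 2 (.reg 5) (.get 1 (.reg 5)))

theorem copyColours_spec (hW : Ample n W) {s : Store} (h0 : s.reg 0 = n)
    (hcn : ∀ z : Fin n, s.arr 1 z < n) :
    WP W copyColours s fun t s' => t ≤ 20 * n + 10 ∧ ∀ z : Fin n, s'.arr 2 z = s.arr 1 z := by
  have hW' := hW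
  unfold Ample at hW'
  refine WP.for (n := n) (T := 4) (I := fun k s' => ∀ z : Fin n, z < k → s'.arr 2 z = s.arr 1 z)
    (by decide) rfl rfl h0 hW.succ_lt (by simp) ?_ ?_
  · intro z s' hz F I
    have e1 : s'.arr 1 = s.arr 1 := by simpa using F.2 1 rfl
    have := hcn z
    simp only [wp_write, Expr.Fits, Expr.eval, e1, hz, Expr.cost, setReg_arr, setArr_arr, reduceIte,
      Nat.reduceAdd, Nat.reduceLeDiff, true_and]
    refine ⟨by omega, fun w hw => ?_⟩
    rw [Clos.update_apply]
    split_ifs with e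
    · rw [e]
    · exact I w ((Roots.lt_succ hw).resolve_left e)
  · intro t s' ht F I
    exact ⟨by omega, fun z => I z z.2⟩

theorem graphColourInput_eq {k : ℕ} (c : Fin n → Fin k) :
    graphColourInput G c = (graphInput G).withArr 1 (colourCells c) := rfl

/-- A run of the core program extends to a computation of an optimal colouring of `G` from one of
`H`. -/
theorem colour_spec (hW : Ample n W) {t : ℕ} {s : Store} (hrun : Run W coreProg (graphInput G) t s)
    (hH : History G H (s.reg 16) (s.arr 7) (s.arr 8)) (hr : s.reg 16 ≤ adjCard G)
    (ht : t ≤ 1600 * ((n + 1) * (n + 1)) * (adjCard G + 1)) {k : ℕ} (hk : k ≤ n)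
    (c : H.Coloring (Fin k)) :
    ∃ (c' : G.Coloring (Fin k)) (t' : ℕ) (s' : Store),
      Run W (coreProg ;; undoProg ;; copyColours) (graphColourInput G c) t' s' ∧
      HoldsColouring s' c' ∧ t' ≤ 3000 * ((n + 1) * (n + 1)) * (adjCard G + 1) := by
  have h0 : s.reg 0 = n := by simpa [graphInput] using hrun.frame.1 0 rfl
  -- The core program does not touch array `1`, so its run in the presence of the colouring is the
  -- same and produces the same history.
  have hrun' := hrun.withArr (b := 1) rfl (colourCells c)
  rw [← graphColourInput_eq] at hrun'
  set s1 := s.withArr 1 (colourCells c) with hs1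
  have a1 : ∀ z : Fin n, s1.arr 1 z = c z := fun z => by
    simp [hs1, Store.withArr, colourCells]
  have a7 : s1.arr 7 = s.arr 7 := by simp [hs1, Store.withArr]
  have a8 : s1.arr 8 = s.arr 8 := by simp [hs1, Store.withArr]
  have hcn : ∀ z : Fin n, s1.arr 1 z < n := fun z => by rw [a1]; exact (c z).2.trans_le hk
  obtain ⟨t2, s2, hrun2, ht2, hp, hw⟩ := undoProg_spec (G := G) (H := H) (s := s1) hW h0 rfl
    (hr.trans adjCard_le) (by rw [a7, a8]; exact hH)
    (fun u v huv => by
      rw [a1, a1]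
      exact fun h => c.valid huv (Fin.ext h)) hcn
  have hlt : ∀ z : Fin n, s2.arr 1 z < k := fun z => by
    obtain ⟨w, hw⟩ := hw z
    rw [hw, a1]
    exact (c w).2
  have b0 : s2.reg 0 = n := (hrun2.frame.1 0 rfl).trans h0
  obtain ⟨t3, s3, hrun3, ht3, h2⟩ := copyColours_spec hW b0 fun z => (hlt z).trans_le hk
  refine ⟨Coloring.mk (fun z => ⟨s2.arr 1 z, hlt z⟩) fun {u v} huv h => hp u v huv
    (congrArg Fin.val h), _, s3, .seq hrun' (.seq hrun2 hrun3), fun z => h2 z, ?_⟩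
  -- Undoing takes `O(n)` per reduction, and there are at most `adjCard G` of them.
  have e1 : 710 * (n + 1) * (s.reg 16 + 1) ≤ 710 * ((n + 1) * (n + 1)) * (adjCard G + 1) :=
    Nat.mul_le_mul (Nat.mul_le_mul_left _ (Nat.le_mul_of_pos_left _ (by omega))) (by omega)
  have e2 : 20 * n + 10 ≤ 20 * ((n + 1) * (n + 1)) * (adjCard G + 1) :=
    le_trans (by ring_nf; omega) (Nat.le_mul_of_pos_right (20 * ((n + 1) * (n + 1)))
      (by omega : 0 < adjCard G + 1))
  have e3 : s1.reg 16 = s.reg 16 := rfl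
  rw [e3] at ht2
  simp only [mul_assoc] at *
  omega

end WordRAM

theorem mainTheorem4 :
    -- one program `P`, one program `Q`, word length `O(log n)`, and one constant for all graphs
    ∃ (P Q : WordRAM.Prog) (d : ℕ) (C : ℝ), ∀ (n : ℕ) (G : SimpleGraph (Fin n)),
      ∃ G' : SimpleGraph (Fin n),
        -- `P` computes `G'` from `G`
        (∃ (t : ℕ) (s : WordRAM.Store), WordRAM.Run ((n + 2) ^ d) P (WordRAM.graphInput G) t s ∧
          WordRAM.HoldsGraph s G' ∧ WordRAM.TimeBound C G t) ∧
        (¬ ∃ K₁ K₂ : Set (Fin n), G'.IsPHPair K₁ K₂) ∧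
        G.chromaticNumber = G'.chromaticNumber ∧
        G.cliqueNum = G'.cliqueNum ∧
        -- `Q` computes an optimal colouring of `G` from `G` and an optimal colouring of `G'`
        (∀ k : ℕ, G'.chromaticNumber = k → ∀ c : G'.Coloring (Fin k),
          ∃ c' : G.Coloring (Fin k), G.chromaticNumber = k ∧
            ∃ (t : ℕ) (s : WordRAM.Store), WordRAM.Run ((n + 2) ^ d) Q (WordRAM.graphColourInput G c) t s ∧
              WordRAM.HoldsColouring s c' ∧ WordRAM.TimeBound C G t) ∧
        (∀ X : Finset (Fin n), G'.IsMaximumClique X → G.IsMaximumClique X) := by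
  -- The input of the second program does not include the history, so this program starts by
  -- repeating the sweep.
  refine ⟨.seq WordRAM.coreProg WordRAM.copyMatrix,
    .seq WordRAM.coreProg (.seq WordRAM.undoProg WordRAM.copyColours), 10, 36000, fun n G => ?_⟩
  have hW := WordRAM.ample_pow (n := n)
  obtain ⟨t, s, hrun, H, hA, hH, hr, hPH, ht⟩ := WordRAM.coreProg_spec (G := G) hW
    (s := WordRAM.graphInput G) (by simpa [WordRAM.graphInput] using WordRAM.mat_matrixCells)
    (by simp [WordRAM.graphInput])
  have h0 : s.reg 0 = n := by simpa [WordRAM.graphInput] using hrun.frame.1 0 rfl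
  obtain ⟨t', s', hrun', ht', hs'⟩ := WordRAM.copyMatrix_spec hW hA h0
  have hω := hH.cliqueNum_eq
  have hk : ∀ k : ℕ, H.chromaticNumber = k → k ≤ n := fun k h => by
    have := H.chromaticNumber_le_card
    rw [h, Fintype.card_fin] at this
    exact_mod_cast this
  -- Deleting edges cannot raise the chromatic number; conversely, undoing the reductions turns an
  -- optimal colouring of `H` into one of `G` with the same colours.
  have hχ : G.chromaticNumber = H.chromaticNumber := by
    refine le_antisymm ?_ (SimpleGraph.chromaticNumber_mono _ hH.le)
    obtain ⟨k, hk'⟩ := ENat.ne_top_iff_exists.1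
      (SimpleGraph.chromaticNumber_ne_top_iff_exists.2 ⟨_, H.colorable_of_fintype⟩)
    obtain ⟨c⟩ := SimpleGraph.chromaticNumber_le_iff_colorable.1 hk'.symm.le
    obtain ⟨c', -⟩ := WordRAM.colour_spec hW hrun hH hr ht (hk k hk'.symm) c
    rw [← hk']
    exact SimpleGraph.Colorable.chromaticNumber_le ⟨c'⟩
  refine ⟨H, ⟨_, s', .seq hrun hrun', hs', WordRAM.timeBound_of_le ?_⟩, hPH, hχ, hω,
    fun k hk' c => ?_, fun X hX => ⟨hX.isClique.mono hH.le, fun Y hY => ?_⟩⟩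
  · have e2 : 100 * ((n + 1) * (n + 1)) ≤ 100 * ((n + 1) * (n + 1)) * (WordRAM.adjCard G + 1) :=
      Nat.le_mul_of_pos_right _ (by omega)
    simp only [mul_assoc] at *
    omega
  · obtain ⟨c', t', s', h1, h2, h3⟩ := WordRAM.colour_spec hW hrun hH hr ht (hk k hk') c
    exact ⟨c', hχ.trans hk', t', s', h1, h2, WordRAM.timeBound_of_le h3⟩
  -- `X` is a clique of `G` because `H` is a subgraph, and it is maximum because the clique numbers
  -- agree.
  · rw [SimpleGraph.maximumClique_card_eq_cliqueNum X hX, ← hω]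
    exact hY.card_le_cliqueNum
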